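/- Let $F=F(x_1,\dots,x_r)$ be a free group of finite rank $r\ge 0$, write $u^x=x^{-1}ux$, and let elements of $F$ be given by words (not necessarily reduced) over $\{x_1^{\pm1},\dots,x_r^{\pm1}\}$. Consider the following algorithmic problems in $F$. - Conjugacy Problem (CP): given words $u,v$, decide whether there is $x\in F$ with $u^x=v$. - Conjugacy Search Problem (CSP): given words $u,v$ such that $u^x=v$ has a solution in $F$, find a word $x$ that is a solution. - Root (Search) Problem (RP): given a word $w$, find a shortest word $u$ such that $w=u^n$ in $F$ for some positive integer $n$. - Simultaneous Conjugacy Problem (SCP): given a finite list of pairs of words $(u_1,v_1),\dots,(u_n,v_n)$, decide whether there is $x\in F$ with $u_i^x=v_i$ for all $i=1,\dots,n$. - Simultaneous Conjugacy Search Problem (SCSP): given such a list for which the system $u_i^x=v_i$ $(i=1,\dots,n)$ has a solution in $F$, find a word $x$ that is a solution. The number $n$ of equations is part of the input. An input is written as the sequence of its words, each followed by an end mark, and its size is the length of this sequence, e.g. $\sum_{i=1}^n(|u_i|+|v_i|+2)$ for SCP and SCSP. Running time is the number of steps of a unit-cost random access machine whose only arithmetic operations are adding and subtracting $1$. A problem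 is linear-time reducible to other problems if one such program with oracles solves it in time linear in the input size, whatever correct oracles for those problems it is given; an oracle query costs one step plus the length of the query. Programs and constants may depend on $r$. **Theorem.** For every $r$, each of SCP and SCSP in $F$ is linear-time reducible to CP, CSP and RP in $F$. Moreover, each of SCP and SCSP in $F$ is decidable in linear time (without oracles). -/

import Mathlib

/-! # Random access machines with oracles, and conjugacy problems in free groups -/

namespace RAM

/-- Comparisons of two registers. -/
inductive Test : Type
  | eq (x y : ℕ)
  | ne (x y : ℕ)
  | lt (x y : ℕ)
  | le (x y : ℕ)

/-- Programs of a successor random access machine. There are registers `0, 1, 2, …` and arrays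
`0, 1, 2, …` (a program mentions finitely many of each), whose entries are natural numbers.
The only arithmetic is adding or subtracting one, so that in `t` steps a number grows by at most `t`
and unit cost is legitimate. The type `κ` names the oracles; `Prog Empty` has no oracle calls. -/
inductive Prog (κ : Type) : Type
  | skip : Prog κ
  /-- `x := n`, a constant of the program -/
  | const (x n : ℕ) : Prog κ
  /-- `x := y` -/
  | copy (x y : ℕ) : Prog κ
  /-- `x := x + 1` -/
  | succ (x : ℕ) : Prog κ
  /-- `x := x - 1`, and `0` stays `0` -/
  | pred (x : ℕ) : Prog κ
  /-- `x := a[y]`, where `a` is the number of an array -/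
  | load (x a y : ℕ) : Prog κ
  /-- `a[x] := y`, where `a` is the number of an array -/
  | store (a x y : ℕ) : Prog κ
  | seq (p q : Prog κ) : Prog κ
  | ite (b : Test) (p q : Prog κ) : Prog κ
  /-- while `b` do `p` -/
  | loop (b : Test) (p : Prog κ) : Prog κ
  /-- query oracle `k` about the list in array `a` -/
  | call (k : κ) (a : ℕ) : Prog κ

/-- The contents of the registers and of the arrays. -/
structure State : Type where
  reg : ℕ → ℕ
  arr : ℕ → ℕ → ℕ

namespace State

/-- Register `x` receives the value `v`. -/
def setReg (s : State) (x v : ℕ) : State :=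
  { s with reg := Function.update s.reg x v }

/-- Cell `i` of array `a` receives the value `v`. -/
def setCell (s : State) (a i v : ℕ) : State :=
  { s with arr := Function.update s.arr a (Function.update (s.arr a) i v) }

/-- The list stored in array `a`, where register `a` holds the length of the list. -/
def list (s : State) (a : ℕ) : List ℕ :=
  (List.range (s.reg a)).map (s.arr a)

/-- Store the list `l` in array `a` and its length in register `a`. -/
def setList (s : State) (a : ℕ) (l : List ℕ) : State where
  reg := Function.update s.reg a l.length
  arr := Function.update s.arr a (fun i => l.getD i 0)

/-- The initial state: the input is in array `0`, its length in register `0`, and all else is `0`. -/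
def init (l : List ℕ) : State :=
  setList ⟨fun _ => 0, fun _ _ => 0⟩ 0 l

end State

/-- The outcome of a comparison. -/
def Test.holds (s : State) : Test → Prop
  | .eq x y => s.reg x = s.reg y
  | .ne x y => s.reg x ≠ s.reg y
  | .lt x y => s.reg x < s.reg y
  | .le x y => s.reg x ≤ s.reg y

/-- `Exec O p s t s'`: with oracles `O`, the program `p`, started in the state `s`, halts after `t`
steps in the state `s'`. Every instruction and every evaluation of a test is one step. An oracle is
queried about the list stored in an array; its answer replaces the query, and the call costs
one step plus the length of the query. -/
inductive Exec {κ : Type} (O : κ → List ℕ → List ℕ) : Prog κ → State → ℕ → State → Prop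
  | skip (s : State) : Exec O .skip s 1 s
  | const (s : State) (x n : ℕ) : Exec O (.const x n) s 1 (s.setReg x n)
  | copy (s : State) (x y : ℕ) : Exec O (.copy x y) s 1 (s.setReg x (s.reg y))
  | succ (s : State) (x : ℕ) : Exec O (.succ x) s 1 (s.setReg x (s.reg x + 1))
  | pred (s : State) (x : ℕ) : Exec O (.pred x) s 1 (s.setReg x (s.reg x - 1))
  | load (s : State) (x a y : ℕ) : Exec O (.load x a y) s 1 (s.setReg x (s.arr a (s.reg y)))
  | store (s : State) (a x y : ℕ) : Exec O (.store a x y) s 1 (s.setCell a (s.reg x) (s.reg y))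
  | seq {p q : Prog κ} {s s' s'' : State} {t t' : ℕ} :
      Exec O p s t s' → Exec O q s' t' s'' → Exec O (.seq p q) s (t + t') s''
  | ite_true {b : Test} {p q : Prog κ} {s s' : State} {t : ℕ} :
      b.holds s → Exec O p s t s' → Exec O (.ite b p q) s (t + 1) s'
  | ite_false {b : Test} {p q : Prog κ} {s s' : State} {t : ℕ} :
      ¬ b.holds s → Exec O q s t s' → Exec O (.ite b p q) s (t + 1) s'
  | loop_true {b : Test} {p : Prog κ} {s s' s'' : State} {t t' : ℕ} :
      b.holds s → Exec O p s t s' → Exec O (.loop b p) s' t' s'' →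
        Exec O (.loop b p) s (t + t' + 1) s''
  | loop_false {b : Test} {p : Prog κ} {s : State} :
      ¬ b.holds s → Exec O (.loop b p) s 1 s
  | call (s : State) (k : κ) (a : ℕ) :
      Exec O (.call k a) s (1 + s.reg a) (s.setList a (O k (s.list a)))

/-- An algorithmic problem: instances, written as lists of numbers, a promise that the instances must
satisfy (`True` for a decision problem), and the correct answers to each instance. -/
structure Problem : Type 1 where
  Inst : Type
  encode : Inst → List ℕ
  Promise : Inst → Prop
  IsAnswer : Inst → List ℕ → Prop

/-- The oracle `f` answers every instance of `P` that satisfies the promise correctly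
(nothing is known about its replies to other lists). -/
def Problem.IsOracle (P : Problem) (f : List ℕ → List ℕ) : Prop :=
  ∀ a : P.Inst, P.Promise a → P.IsAnswer a (f (P.encode a))

/-- With oracles `O`, the program `M` answers every instance of `P` that satisfies the promise
within `c * (n + 1)` steps, where `n` is the length of the instance. -/
def SolvesInTime {κ : Type} (O : κ → List ℕ → List ℕ) (M : Prog κ) (P : Problem) (c : ℕ) : Prop :=
  ∀ a : P.Inst, P.Promise a → ∃ (t : ℕ) (s : State),
    Exec O M (State.init (P.encode a)) t s ∧
      t ≤ c * ((P.encode a).length + 1) ∧ P.IsAnswer a (s.list 0)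

/-- `P` is solvable in linear time. -/
def LinearTimeSolvable (P : Problem) : Prop :=
  ∃ (M : Prog Empty) (c : ℕ), SolvesInTime (fun k : Empty => k.elim) M P c

/-- `P` is reducible in linear time to the problems `Q k`: one program solves `P` in linear time
from any correct oracles for the problems `Q k`. -/
def LinearTimeReducible {κ : Type} (P : Problem) (Q : κ → Problem) : Prop :=
  ∃ (M : Prog κ) (c : ℕ), ∀ O : κ → List ℕ → List ℕ,
    (∀ k, (Q k).IsOracle (O k)) → SolvesInTime O M P c

end RAM

namespace FreeConj

open RAM

/-- Words, not necessarily reduced, in `r` letters and their inverses: `(i, true)` is the `i`-th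
generator, `(i, false)` its inverse, and `FreeGroup.mk w` is the element that `w` represents. -/
abbrev Word (r : ℕ) : Type := List (Fin r × Bool)

/-- The letters are numbered `1, …, 2 * r`. -/
def encodeLetter {r : ℕ} (l : Fin r × Bool) : ℕ :=
  2 * l.1.val + 1 + (if l.2 then 1 else 0)

def encodeWord {r : ℕ} (w : Word r) : List ℕ :=
  w.map encodeLetter

/-- Several words are written one after the other, each followed by the end mark `0`. -/
def encodeWords {r : ℕ} (ws : List (Word r)) : List ℕ :=
  ws.flatMap fun w => encodeWord w ++ [0]

/-- `u ^ x = v` in the free group, where `u ^ x = x⁻¹ * u * x`. -/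
def Conjugates {r : ℕ} (u v x : Word r) : Prop :=
  (FreeGroup.mk x)⁻¹ * FreeGroup.mk u * FreeGroup.mk x = FreeGroup.mk v

/-- `x` solves the system of equations `u ^ x = v`, `(u, v) ∈ S`. -/
def SolvesSystem {r : ℕ} (S : List (Word r × Word r)) (x : Word r) : Prop :=
  ∀ e ∈ S, Conjugates e.1 e.2 x

/-- The answer to a yes-no question: `1` for yes, `0` for no. -/
def Decides (p : Prop) (out : List ℕ) : Prop :=
  (p ∧ out = [1]) ∨ (¬ p ∧ out = [0])

/-- Conjugacy Problem: are the elements given by `u` and `v` conjugate? -/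
def CP (r : ℕ) : Problem where
  Inst := Word r × Word r
  encode e := encodeWords [e.1, e.2]
  Promise _ := True
  IsAnswer e out := Decides (∃ x : Word r, Conjugates e.1 e.2 x) out

/-- Conjugacy Search Problem: given conjugate `u` and `v`, find a conjugator. -/
def CSP (r : ℕ) : Problem where
  Inst := Word r × Word r
  encode e := encodeWords [e.1, e.2]
  Promise e := ∃ x : Word r, Conjugates e.1 e.2 x
  IsAnswer e out := ∃ x : Word r, out = encodeWord x ∧ Conjugates e.1 e.2 x

/-- Root (Search) Problem: given `w`, find a shortest word `u` such that `w = u ^ n` in the free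
group for some positive `n`. -/
def RSP (r : ℕ) : Problem where
  Inst := Word r
  encode w := encodeWords [w]
  Promise _ := True
  IsAnswer w out := ∃ u : Word r, out = encodeWord u ∧
    (∃ n : ℕ, 0 < n ∧ FreeGroup.mk w = FreeGroup.mk u ^ n) ∧
    ∀ (u' : Word r) (n : ℕ), 0 < n → FreeGroup.mk w = FreeGroup.mk u' ^ n → u.length ≤ u'.length

/-- The words of a system in the order `u₁, v₁, u₂, v₂, …`. -/
def encodeSystem {r : ℕ} (S : List (Word r × Word r)) : List ℕ :=
  encodeWords (S.flatMap fun e => [e.1, e.2])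

/-- Simultaneous Conjugacy Problem: does a finite system of conjugacy equations, of any number of
equations, have a solution? -/
def SCP (r : ℕ) : Problem where
  Inst := List (Word r × Word r)
  encode := encodeSystem
  Promise _ := True
  IsAnswer S out := Decides (∃ x : Word r, SolvesSystem S x) out

/-- Simultaneous Conjugacy Search Problem: given a finite system of conjugacy equations that has a
solution, find one. -/
def SCSP (r : ℕ) : Problem where
  Inst := List (Word r × Word r)
  encode := encodeSystem
  Promise S := ∃ x : Word r, SolvesSystem S x
  IsAnswer S out := ∃ x : Word r, out = encodeWord x ∧ SolvesSystem S x

end FreeConj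

set_option linter.constructorNameAsVariable false

namespace FreeConj

open RAM

/-! ## Stack machines on top of random access machines -/

/-! The system is solved in linear time by one program without oracle calls. The program can be
written over any type of oracle names, so it is also a reduction to CP, CSP and RP.

If in some pair exactly one word is trivial in `F`, there is no solution; if all words are trivial,
`x = 1` is one. Otherwise a shortest pair `(u, v)` of nontrivial elements is chosen. Cyclic
reduction writes both as conjugates of cyclically reduced words, which are conjugate only if they
are rotations of each other (`isRotated_of_conj`). A two-pointer search for a common rotation
decides this in linear time (`MatchInv`). It yields `g`, `h` and a cyclically reduced `w` with `g⁻¹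
u g = w = h⁻¹ v h`, so the solutions of the chosen equation are the elements `g c h⁻¹` with `c` in
the centralizer of `w`.

For such an `x`, another equation becomes `a c = c b`, where `a` and `b` are conjugates of its two
sides by `g` and `h`. If `a` commutes with `w`, it commutes with `c`, because centralizers are
commutative (`commute_of_commute`); the equation then says `a = b` and does not involve `c`. If `a`
does not commute with `w`, at most one `c` is possible, and it can be read off. Let `N` be a power
of `w` that is longer than `a` and `b` by at least the length of `w`. By a periodicity argument
(`toWord_conj_periodic`), the reduced word of `N a N⁻¹` still begins with a letter of `N` and ends
with a letter of `N⁻¹`, and likewise for `b`. Up to inversion `c` is a prefix of a power of `w`, so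
in `N a N⁻¹ = c (N b N⁻¹) c⁻¹`, or in the same identity solved for `N b N⁻¹`, nothing cancels: the
lengths differ by twice the length of `c`, and `c` is a prefix of the longer word
(`conjugator_eq_take`). The candidate is verified and compared with the candidate found earlier, if
any.

The time is linear because the chosen pair is shortest: `g`, `h` and `w` are bounded by a multiple
of the size of each nontrivial pair, so each pair costs time linear in its own size.

All words are read as inverses: letters arrive from left to right, while a stack changes only at its
left end. Inverting both sides of an equation does not change its solutions. -/

abbrev Letter (r : ℕ) : Type := Fin r × Bool

/-- The inverse letter. -/
def Letter.inv {r : ℕ} (l : Letter r) : Letter r := (l.1, !l.2)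

/-- The input symbols: letters and the end mark. -/
def encodeSymbol {r : ℕ} : Option (Letter r) → ℕ
  | none => 0
  | some l => encodeLetter l

theorem encodeLetter_injective {r : ℕ} :
    Function.Injective (encodeLetter : Letter r → ℕ) := by
  rintro ⟨⟨i, hi⟩, b⟩ ⟨⟨j, hj⟩, c⟩ h
  cases b <;> cases c <;> simp_all [encodeLetter] <;> omega

theorem encodeLetter_ne_zero {r : ℕ} (l : Letter r) : encodeLetter l ≠ 0 := by
  simp [encodeLetter]

/-- The stacks used by the program. -/
inductive Stack : Type
  | tmp | mat | wa | wb | u | v | x | y | gu | gv | zu | zv | al | be | g | h | z | n | p | q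
  | c₁ | c₂ | c | s | d | conj | core | ca | cb
  deriving DecidableEq

/-- The counters used by the program. -/
inductive Counter : Type
  | len | best | fail | seen | go | i | j
  deriving DecidableEq

/-- The array and the length register of a stack. -/
def Stack.reg : Stack → ℕ
  | tmp => 20 | mat => 21 | wa => 22 | wb => 23 | u => 24 | v => 25 | x => 26 | y => 27 | gu => 28
  | gv => 29 | zu => 30 | zv => 31 | al => 32 | be => 33 | g => 34 | h => 35 | z => 36 | n => 37
  | p => 38 | q => 39 | c₁ => 40 | c₂ => 41 | c => 42 | s => 43 | d => 44 | conj => 45 | core => 46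
  | ca => 47 | cb => 48

/-- The register of a counter. -/
def Counter.reg : Counter → ℕ
  | len => 6 | best => 7 | fail => 8 | seen => 9 | go => 10 | i => 11 | j => 12

theorem Stack.reg_injective : Function.Injective Stack.reg := by
  intro a b h
  cases a <;> cases b <;> first | rfl | (exact absurd h (by decide))

theorem Counter.reg_injective : Function.Injective Counter.reg := by
  intro a b h
  cases a <;> cases b <;> first | rfl | (exact absurd h (by decide))

@[simp] theorem Stack.reg_inj {a b : Stack} : a.reg = b.reg ↔ a = b := Stack.reg_injective.eq_iff

@[simp] theorem Counter.reg_inj {a b : Counter} : a.reg = b.reg ↔ a = b :=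
  Counter.reg_injective.eq_iff

theorem Stack.le_reg (a : Stack) : 20 ≤ a.reg := by cases a <;> decide

theorem Counter.le_reg (c : Counter) : 6 ≤ c.reg := by cases c <;> decide

theorem Counter.reg_lt (c : Counter) : c.reg < 20 := by cases c <;> decide

/-- An abstract state: the input, its unread part, the stacks and the counters. -/
structure Env (r : ℕ) : Type where
  inp : List (Option (Letter r))
  rem : List (Option (Letter r))
  stk : Stack → List (Letter r)
  cnt : Counter → ℕ

namespace Env

variable {r : ℕ}

def setStk (E : Env r) (a : Stack) (l : List (Letter r)) : Env r :=
  { E with stk := Function.update E.stk a l }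

def setCnt (E : Env r) (c : Counter) (n : ℕ) : Env r :=
  { E with cnt := Function.update E.cnt c n }

def setRem (E : Env r) (l : List (Option (Letter r))) : Env r :=
  { E with rem := l }

@[simp] theorem setStk_stk (E : Env r) (a b : Stack) (l : List (Letter r)) :
    (E.setStk a l).stk b = if b = a then l else E.stk b := by
  simp [setStk, Function.update_apply]

@[simp] theorem setStk_cnt (E : Env r) (a : Stack) (l : List (Letter r)) :
    (E.setStk a l).cnt = E.cnt := rfl

@[simp] theorem setStk_inp (E : Env r) (a : Stack) (l : List (Letter r)) :
    (E.setStk a l).inp = E.inp := rfl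

@[simp] theorem setStk_rem (E : Env r) (a : Stack) (l : List (Letter r)) :
    (E.setStk a l).rem = E.rem := rfl

@[simp] theorem setCnt_cnt (E : Env r) (c d : Counter) (n : ℕ) :
    (E.setCnt c n).cnt d = if d = c then n else E.cnt d := by
  simp [setCnt, Function.update_apply]

@[simp] theorem setCnt_stk (E : Env r) (c : Counter) (n : ℕ) :
    (E.setCnt c n).stk = E.stk := rfl

@[simp] theorem setCnt_inp (E : Env r) (c : Counter) (n : ℕ) :
    (E.setCnt c n).inp = E.inp := rfl

@[simp] theorem setCnt_rem (E : Env r) (c : Counter) (n : ℕ) :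
    (E.setCnt c n).rem = E.rem := rfl

@[simp] theorem setRem_stk (E : Env r) (l : List (Option (Letter r))) :
    (E.setRem l).stk = E.stk := rfl

@[simp] theorem setRem_cnt (E : Env r) (l : List (Option (Letter r))) :
    (E.setRem l).cnt = E.cnt := rfl

@[simp] theorem setRem_inp (E : Env r) (l : List (Option (Letter r))) :
    (E.setRem l).inp = E.inp := rfl

@[simp] theorem setRem_rem (E : Env r) (l : List (Option (Letter r))) :
    (E.setRem l).rem = l := rfl

theorem ext_stk {E E' : Env r} (h₁ : E.inp = E'.inp) (h₂ : E.rem = E'.rem)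
    (h₃ : ∀ a, E.stk a = E'.stk a) (h₄ : ∀ c, E.cnt c = E'.cnt c) : E = E' := by
  cases E; cases E'
  simp only [mk.injEq]
  exact ⟨h₁, h₂, funext h₃, funext h₄⟩

end Env

section State

@[simp] theorem setReg_reg (s : State) (x v y : ℕ) :
    (s.setReg x v).reg y = if y = x then v else s.reg y := by
  simp [State.setReg, Function.update_apply]

@[simp] theorem setReg_arr (s : State) (x v : ℕ) : (s.setReg x v).arr = s.arr := rfl

@[simp] theorem setCell_reg (s : State) (a i v : ℕ) : (s.setCell a i v).reg = s.reg := rfl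

@[simp] theorem setCell_arr (s : State) (a i v b : ℕ) :
    (s.setCell a i v).arr b = if b = a then Function.update (s.arr a) i v else s.arr b := by
  simp [State.setCell, Function.update_apply]

end State

/-! ### Representation of the input, stacks and counters by registers and arrays -/

variable {r : ℕ}

/-- The array `f` holds the stack `l`, whose top is the head of the list. -/
def Holds (f : ℕ → ℕ) : List (Letter r) → Prop
  | [] => True
  | x :: l => f l.length = encodeLetter x ∧ Holds f l

theorem Holds.congr {f g : ℕ → ℕ} : ∀ {l : List (Letter r)}, Holds f l →
    (∀ i < l.length, g i = f i) → Holds g l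
  | [], _, _ => trivial
  | x :: l, h, hg => ⟨(hg _ (by simp)).trans h.1, h.2.congr fun i hi => hg i (by simp; omega)⟩

/-- The state `s` of the machine represents the abstract state `E`. -/
structure Rep (s : State) (E : Env r) : Prop where
  zero : s.reg 5 = 0
  len : s.reg 0 = E.inp.length
  pos : s.reg 1 ≤ E.inp.length
  rem : E.rem = E.inp.drop (s.reg 1)
  inp : ∀ i, s.arr 0 i = (E.inp.map encodeSymbol).getD i 0
  cur : s.reg 4 = (E.rem.map encodeSymbol).getD 0 0
  inv : ∀ l : Letter r, s.arr 1 (encodeLetter l) = encodeLetter l.inv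
  stkLen : ∀ a : Stack, s.reg a.reg = (E.stk a).length
  stk : ∀ a : Stack, Holds (s.arr a.reg) (E.stk a)
  cnt : ∀ c : Counter, s.reg c.reg = E.cnt c

namespace Rep

variable {s : State} {E : Env r}

theorem setScratch (h : Rep s E) {x : ℕ} (hx : x = 2 ∨ x = 3) (v : ℕ) :
    Rep (s.setReg x v) E := by
  have hs (a : Stack) : a.reg ≠ x := by have := a.le_reg; omega
  have hc (c : Counter) : c.reg ≠ x := by have := c.le_reg; omega
  have h0 : 0 ≠ x := by omega
  have h1 : 1 ≠ x := by omega
  have h4 : 4 ≠ x := by omega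
  have h5 : 5 ≠ x := by omega
  obtain ⟨z, l, p, rm, i, cu, iv, sl, st, c⟩ := h
  constructor <;> simp_all

theorem setLen (h : Rep s E) (a : Stack) {n : ℕ} {l : List (Letter r)} (hn : n = l.length)
    (hl : Holds (s.arr a.reg) l) : Rep (s.setReg a.reg n) (E.setStk a l) := by
  have ha := a.le_reg
  have hc (c : Counter) : c.reg ≠ a.reg := by have := c.reg_lt; omega
  have h0 : 0 ≠ a.reg := by omega
  have h1 : 1 ≠ a.reg := by omega
  have h4 : 4 ≠ a.reg := by omega
  have h5 : 5 ≠ a.reg := by omega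
  obtain ⟨z, le, p, rm, i, cu, iv, sl, st, c⟩ := h
  constructor <;> simp_all
  · intro b; split_ifs <;> rfl
  · intro b; split_ifs with hb
    · exact hb ▸ hl
    · exact st b

/-- The cell that is written lies just above the top of the stack, and `Holds` looks only at cells
below the height. -/
theorem setCell (h : Rep s E) (a : Stack) (v : ℕ) :
    Rep (s.setCell a.reg (s.reg a.reg) v) E := by
  have ha := a.le_reg
  have h0 : 0 ≠ a.reg := by omega
  have h1 : 1 ≠ a.reg := by omega
  obtain ⟨z, le, p, rm, i, cu, iv, sl, st, c⟩ := h
  constructor <;> simp_all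
  intro b
  split_ifs with hb
  · subst hb
    exact (st b).congr fun i hi => by simp [hi.ne]
  · exact st b

theorem setCnt (h : Rep s E) (c : Counter) (n : ℕ) :
    Rep (s.setReg c.reg n) (E.setCnt c n) := by
  have ha := c.le_reg
  have ha' := c.reg_lt
  have hc (a : Stack) : a.reg ≠ c.reg := by have := a.le_reg; omega
  have h0 : 0 ≠ c.reg := by omega
  have h1 : 1 ≠ c.reg := by omega
  have h4 : 4 ≠ c.reg := by omega
  have h5 : 5 ≠ c.reg := by omega
  obtain ⟨z, le, p, rm, i, cu, iv, sl, st, c⟩ := h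
  constructor <;> simp_all

theorem push (h : Rep s E) (a : Stack) (x : Letter r) :
    Rep ((s.setCell a.reg (s.reg a.reg) (encodeLetter x)).setReg a.reg (s.reg a.reg + 1))
      (E.setStk a (x :: E.stk a)) := by
  refine (h.setCell a _).setLen a (by simp [h.stkLen]) ⟨?_, (h.setCell a _).stk a⟩
  simp [h.stkLen]

theorem pop (h : Rep s E) (a : Stack) :
    Rep (s.setReg a.reg (s.reg a.reg - 1)) (E.setStk a (E.stk a).tail) := by
  refine h.setLen a (by simp [h.stkLen]) ?_
  have := h.stk a
  cases hl : E.stk a with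
  | nil => trivial
  | cons x l => rw [hl] at this; exact this.2

theorem clear (h : Rep s E) (a : Stack) : Rep (s.setReg a.reg 0) (E.setStk a []) :=
  h.setLen a rfl trivial

theorem top (h : Rep s E) {a : Stack} {x : Letter r} {l : List (Letter r)}
    (hl : E.stk a = x :: l) : s.arr a.reg (s.reg a.reg - 1) = encodeLetter x := by
  have := h.stk a
  rw [hl] at this
  rw [h.stkLen, hl]
  exact this.1

/-- Position and current symbol change together, as `Rep` ties both to `rem`. The position just past
the input is allowed: the cell there holds `0`, the default value in `cur`. -/
theorem move (h : Rep s E) {n : ℕ} (hn : n ≤ E.inp.length) :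
    Rep ((s.setReg 1 n).setReg 4 (s.arr 0 n)) (E.setRem (E.inp.drop n)) := by
  have hs (a : Stack) : a.reg ≠ 1 ∧ a.reg ≠ 4 := by have := a.le_reg; omega
  have hc (c : Counter) : c.reg ≠ 1 ∧ c.reg ≠ 4 := by have := c.le_reg; omega
  obtain ⟨z, le, p, rm, i, cu, iv, sl, st, c⟩ := h
  constructor <;> simp_all

end Rep

/-! ### Weakest preconditions with time -/

variable {κ : Type} {O : κ → List ℕ → List ℕ}

/-- Started in any state that represents `E`, the program `p` halts within `t` steps in a state that
represents some `E'` with `Q E'`. -/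
def WP (O : κ → List ℕ → List ℕ) (p : Prog κ) (E : Env r) (t : ℕ) (Q : Env r → Prop) : Prop :=
  ∀ s, Rep s E → ∃ t' s' E', t' ≤ t ∧ Exec O p s t' s' ∧ Rep s' E' ∧ Q E'

/-- The test `b` has the meaning `c` in the abstract state `E`. -/
def Means (b : Test) (E : Env r) (c : Prop) : Prop :=
  ∀ s, Rep s E → (b.holds s ↔ c)

namespace WP

variable {p q : Prog κ} {E : Env r} {t t' : ℕ} {Q Q' : Env r → Prop} {b : Test} {c : Prop}

theorem mono (h : WP O p E t Q) (ht : t ≤ t') (hQ : ∀ E', Q E' → Q' E') : WP O p E t' Q' := by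
  intro s hs
  obtain ⟨k, s', E', hk, he, hr, hq⟩ := h s hs
  exact ⟨k, s', E', hk.trans ht, he, hr, hQ _ hq⟩

theorem le (h : WP O p E t Q) (ht : t ≤ t') : WP O p E t' Q := h.mono ht fun _ => id

theorem seq (h : WP O p E t fun E' => WP O q E' t' Q) : WP O (.seq p q) E (t + t') Q := by
  intro s hs
  obtain ⟨k, s', E', hk, he, hr, hq⟩ := h s hs
  obtain ⟨k', s'', E'', hk', he', hr', hq'⟩ := hq s' hr
  exact ⟨k + k', s'', E'', by omega, he.seq he', hr', hq'⟩

theorem skip (h : Q E) : WP O .skip E 1 Q :=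
  fun s hs => ⟨1, s, E, le_rfl, .skip s, hs, h⟩

theorem ite (hb : Means b E c) (hp : c → WP O p E t Q) (hq : ¬ c → WP O q E t' Q) :
    WP O (.ite b p q) E (t + t' + 1) Q := by
  intro s hs
  by_cases h : c
  · obtain ⟨k, s', E', hk, he, hr, hq⟩ := hp h s hs
    exact ⟨k + 1, s', E', by omega, .ite_true ((hb s hs).2 h) he, hr, hq⟩
  · obtain ⟨k, s', E', hk, he, hr, hq⟩ := hq h s hs
    exact ⟨k + 1, s', E', by omega, .ite_false (fun h' => h ((hb s hs).1 h')) he, hr, hq⟩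

/-- Loops are unrolled one round at a time; each application brings its own induction, and the time
of the remaining rounds belongs to the postcondition of the body. -/
theorem loop_step (hb : Means b E c) (h : c)
    (hp : WP O p E t fun E' => WP O (.loop b p) E' t' Q) :
    WP O (.loop b p) E (t + t' + 1) Q := by
  intro s hs
  obtain ⟨k, s', E', hk, he, hr, hq⟩ := hp s hs
  obtain ⟨k', s'', E'', hk', he', hr', hq'⟩ := hq s' hr
  exact ⟨k + k' + 1, s'', E'', by omega, .loop_true ((hb s hs).2 h) he he', hr', hq'⟩

theorem loop_done (hb : Means b E c) (h : ¬ c) (hQ : Q E) : WP O (.loop b p) E 1 Q :=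
  fun s hs => ⟨1, s, E, le_rfl, .loop_false fun h' => h ((hb s hs).1 h'), hs, hQ⟩

end WP

/-! ### Tests -/

def Stack.nonempty (a : Stack) : Test := .ne a.reg 5
def Stack.shorter (a b : Stack) : Test := .lt a.reg b.reg
def Stack.notLonger (a b : Stack) : Test := .le a.reg b.reg
def Counter.nonzero (c : Counter) : Test := .ne c.reg 5
def Counter.less (c d : Counter) : Test := .lt c.reg d.reg
def inputNonempty : Test := .lt 1 0
def atLetter : Test := .ne 4 5

theorem means_nonempty (a : Stack) (E : Env r) : Means a.nonempty E (E.stk a ≠ []) := by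
  intro s hs
  simp [Stack.nonempty, Test.holds, hs.stkLen, hs.zero]

theorem means_shorter (a b : Stack) (E : Env r) :
    Means (a.shorter b) E ((E.stk a).length < (E.stk b).length) := by
  intro s hs
  simp [Stack.shorter, Test.holds, hs.stkLen]

theorem means_notLonger (a b : Stack) (E : Env r) :
    Means (a.notLonger b) E ((E.stk a).length ≤ (E.stk b).length) := by
  intro s hs
  simp [Stack.notLonger, Test.holds, hs.stkLen]

theorem means_nonzero (c : Counter) (E : Env r) : Means c.nonzero E (E.cnt c ≠ 0) := by
  intro s hs
  simp [Counter.nonzero, Test.holds, hs.cnt, hs.zero]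

theorem means_less (c d : Counter) (E : Env r) : Means (c.less d) E (E.cnt c < E.cnt d) := by
  intro s hs
  simp [Counter.less, Test.holds, hs.cnt]

theorem means_inputNonempty (E : Env r) : Means inputNonempty E (E.rem ≠ []) := by
  intro s hs
  simp [inputNonempty, Test.holds, hs.rem, hs.len]

/-- Register `4` is `0` both at an end mark and past the end of the input, and letters have positive
codes. -/
theorem means_atLetter (E : Env r) : Means atLetter E (∃ x l, E.rem = some x :: l) := by
  intro s hs
  simp only [atLetter, Test.holds, hs.zero, hs.cur]
  rcases h : E.rem with _ | ⟨_ | x, l⟩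
  · simp
  · simp [encodeSymbol]
  · simp [encodeSymbol, encodeLetter_ne_zero]

/-! ### Instructions -/

/-- Load the top of the stack `a` into the register `x`. -/
def loadTop (x : ℕ) (a : Stack) : Prog κ :=
  .seq (.copy x a.reg) (.seq (.pred x) (.load x a.reg x))

/-- Push the letter in register `2`. -/
def pushScratch (a : Stack) : Prog κ := .seq (.store a.reg a.reg 2) (.succ a.reg)

/-- Push the top of the stack `b` onto the stack `a`. -/
def pushTop (a b : Stack) : Prog κ := .seq (loadTop 2 b) (pushScratch a)

/-- Push the inverse of the top of the stack `b` onto the stack `a`. -/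
def pushInvTop (a b : Stack) : Prog κ :=
  .seq (loadTop 2 b) (.seq (.load 2 1 2) (pushScratch a))

def pop (a : Stack) : Prog κ := .pred a.reg

def clear (a : Stack) : Prog κ := .const a.reg 0

def setCounter (c : Counter) (n : ℕ) : Prog κ := .const c.reg n

def incr (c : Counter) : Prog κ := .succ c.reg

def decr (c : Counter) : Prog κ := .pred c.reg

def copyCounter (c d : Counter) : Prog κ := .copy c.reg d.reg

/-- Set a counter to the height of a stack. -/
def height (c : Counter) (a : Stack) : Prog κ := .copy c.reg a.reg

/-- Branch on whether the tops of the two stacks agree. -/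
def ifTopEq (a b : Stack) (p q : Prog κ) : Prog κ :=
  .seq (loadTop 2 a) (.seq (loadTop 3 b) (.ite (.eq 2 3) p q))

/-- Branch on whether the top of the stack `a` is smaller than that of the stack `b`. -/
def ifTopLt (a b : Stack) (p q : Prog κ) : Prog κ :=
  .seq (loadTop 2 a) (.seq (loadTop 3 b) (.ite (.lt 2 3) p q))

/-- Branch on whether the tops of the two stacks are inverse to each other. -/
def ifTopInv (a b : Stack) (p q : Prog κ) : Prog κ :=
  .seq (loadTop 2 a) (.seq (.load 2 1 2) (.seq (loadTop 3 b) (.ite (.eq 2 3) p q)))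

/-- Read a symbol. -/
def advance : Prog κ := .seq (.succ 1) (.load 4 0 1)

/-- Read a letter and push it. -/
def readLetter (a : Stack) : Prog κ := .seq (.copy 2 4) (.seq (pushScratch a) advance)

/-- Return to the beginning of the input. -/
def rewind : Prog κ := .seq (.const 1 0) (.load 4 0 1)

theorem exec_loadTop {s : State} {E : Env r} (hs : Rep s E) {x : ℕ} {a : Stack} {y : Letter r}
    {l : List (Letter r)} (hl : E.stk a = y :: l) (hx : x = 2 ∨ x = 3) :
    ∃ s', Exec O (loadTop x a) s 3 s' ∧ Rep s' E ∧ s'.reg x = encodeLetter y ∧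
      ∀ z, z ≠ x → s'.reg z = s.reg z := by
  have hne : x ≠ a.reg := by have := a.le_reg; omega
  refine ⟨_, .seq (.copy s x a.reg) (.seq (.pred _ x) (.load _ x a.reg x)), ?_, ?_, ?_⟩
  · exact ((hs.setScratch hx _).setScratch hx _).setScratch hx _
  · simp [hs.top hl]
  · intro z hz
    simp [hz]

theorem exec_pushScratch {s : State} {E : Env r} (hs : Rep s E) (a : Stack) {x : Letter r}
    (hx : s.reg 2 = encodeLetter x) :
    ∃ s', Exec O (pushScratch a) s 2 s' ∧ Rep s' (E.setStk a (x :: E.stk a)) :=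
  ⟨_, .seq (.store s a.reg a.reg 2) (.succ _ _), by rw [hx]; exact hs.push a x⟩

theorem exec_advance {s : State} {E : Env r} (hs : Rep s E) {x : Option (Letter r)}
    {l : List (Option (Letter r))} (hl : E.rem = x :: l) :
    ∃ s', Exec O advance s 2 s' ∧ Rep s' (E.setRem l) := by
  refine ⟨_, .seq (.succ s 1) (.load _ 4 0 1), ?_⟩
  have hlt : s.reg 1 < E.inp.length := by
    by_contra h
    have := hs.rem
    rw [List.drop_eq_nil_of_le (by omega), hl] at this
    simp at this
  have h : l = E.inp.drop (s.reg 1 + 1) := by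
    rw [← List.tail_drop, ← hs.rem, hl]; rfl
  rw [h]
  simpa using hs.move (n := s.reg 1 + 1) hlt

namespace WP

variable {p q : Prog κ} {E : Env r} {t t' : ℕ} {Q : Env r → Prop} {a b : Stack} {c d : Counter}
  {x y : Letter r} {l l' : List (Letter r)}

theorem pushTop (hb : E.stk b = x :: l) (h : Q (E.setStk a (x :: E.stk a))) :
    WP O (pushTop a b) E 5 Q := by
  intro s hs
  obtain ⟨s₁, e₁, r₁, h₁, -⟩ := exec_loadTop (O := O) hs hb (Or.inl rfl)
  obtain ⟨s₂, e₂, r₂⟩ := exec_pushScratch (O := O) r₁ a h₁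
  exact ⟨5, s₂, _, le_rfl, e₁.seq e₂, r₂, h⟩

theorem pushInvTop (hb : E.stk b = x :: l) (h : Q (E.setStk a (x.inv :: E.stk a))) :
    WP O (pushInvTop a b) E 6 Q := by
  intro s hs
  obtain ⟨s₁, e₁, r₁, h₁, -⟩ := exec_loadTop (O := O) hs hb (Or.inl rfl)
  obtain ⟨s₂, e₂, r₂⟩ := exec_pushScratch (O := O) (r₁.setScratch (Or.inl rfl) (s₁.arr 1 (s₁.reg 2)))
    (x := x.inv) a (by simp [h₁, r₁.inv])
  exact ⟨6, s₂, _, le_rfl, e₁.seq (.seq (.load s₁ 2 1 2) e₂), r₂, h⟩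

theorem pop (h : Q (E.setStk a (E.stk a).tail)) : WP O (pop a) E 1 Q :=
  fun s hs => ⟨1, _, _, le_rfl, .pred s _, hs.pop a, h⟩

theorem clear (h : Q (E.setStk a [])) : WP O (clear a) E 1 Q :=
  fun s hs => ⟨1, _, _, le_rfl, .const s _ _, hs.clear a, h⟩

theorem setCounter {n : ℕ} (h : Q (E.setCnt c n)) : WP O (setCounter c n) E 1 Q :=
  fun s hs => ⟨1, _, _, le_rfl, .const s _ _, hs.setCnt c n, h⟩

theorem incr (h : Q (E.setCnt c (E.cnt c + 1))) : WP O (incr c) E 1 Q :=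
  fun s hs => ⟨1, _, _, le_rfl, .succ s _, by rw [hs.cnt]; exact hs.setCnt c _, h⟩

theorem decr (h : Q (E.setCnt c (E.cnt c - 1))) : WP O (decr c) E 1 Q :=
  fun s hs => ⟨1, _, _, le_rfl, .pred s _, by rw [hs.cnt]; exact hs.setCnt c _, h⟩

theorem copyCounter (h : Q (E.setCnt c (E.cnt d))) : WP O (copyCounter c d) E 1 Q :=
  fun s hs => ⟨1, _, _, le_rfl, .copy s _ _, by rw [hs.cnt]; exact hs.setCnt c _, h⟩

theorem height (h : Q (E.setCnt c (E.stk a).length)) : WP O (height c a) E 1 Q :=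
  fun s hs => ⟨1, _, _, le_rfl, .copy s _ _, by rw [hs.stkLen]; exact hs.setCnt c _, h⟩

theorem ifTopEq (ha : E.stk a = x :: l) (hb : E.stk b = y :: l') (hp : x = y → WP O p E t Q)
    (hq : x ≠ y → WP O q E t' Q) : WP O (ifTopEq a b p q) E (t + t' + 7) Q := by
  intro s hs
  obtain ⟨s₁, e₁, r₁, h₁, -⟩ := exec_loadTop (O := O) hs ha (Or.inl rfl)
  obtain ⟨s₂, e₂, r₂, h₂, k₂⟩ := exec_loadTop (O := O) r₁ hb (Or.inr rfl)
  rw [← k₂ 2 (by decide)] at h₁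
  by_cases h : x = y
  · obtain ⟨k, s', E', hk, he, hr, hQ⟩ := hp h s₂ r₂
    exact ⟨_, s', E', (by omega), e₁.seq (e₂.seq (.ite_true (by simp [Test.holds, h₁, h₂, h]) he)),
      hr, hQ⟩
  · obtain ⟨k, s', E', hk, he, hr, hQ⟩ := hq h s₂ r₂
    exact ⟨_, s', E', (by omega), e₁.seq (e₂.seq (.ite_false
      (by simp [Test.holds, h₁, h₂, encodeLetter_injective.eq_iff, h]) he)), hr, hQ⟩

theorem ifTopLt (ha : E.stk a = x :: l) (hb : E.stk b = y :: l')
    (hp : encodeLetter x < encodeLetter y → WP O p E t Q)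
    (hq : ¬ encodeLetter x < encodeLetter y → WP O q E t' Q) :
    WP O (ifTopLt a b p q) E (t + t' + 7) Q := by
  intro s hs
  obtain ⟨s₁, e₁, r₁, h₁, -⟩ := exec_loadTop (O := O) hs ha (Or.inl rfl)
  obtain ⟨s₂, e₂, r₂, h₂, k₂⟩ := exec_loadTop (O := O) r₁ hb (Or.inr rfl)
  rw [← k₂ 2 (by decide)] at h₁
  by_cases h : encodeLetter x < encodeLetter y
  · obtain ⟨k, s', E', hk, he, hr, hQ⟩ := hp h s₂ r₂
    exact ⟨_, s', E', (by omega), e₁.seq (e₂.seq (.ite_true (by simp [Test.holds, h₁, h₂, h]) he)),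
      hr, hQ⟩
  · obtain ⟨k, s', E', hk, he, hr, hQ⟩ := hq h s₂ r₂
    exact ⟨_, s', E', (by omega), e₁.seq (e₂.seq (.ite_false
      (by simpa [Test.holds, h₁, h₂] using h) he)), hr, hQ⟩

theorem ifTopInv (ha : E.stk a = x :: l) (hb : E.stk b = y :: l') (hp : x.inv = y → WP O p E t Q)
    (hq : x.inv ≠ y → WP O q E t' Q) : WP O (ifTopInv a b p q) E (t + t' + 8) Q := by
  intro s hs
  obtain ⟨s₁, e₁, r₁, h₁, -⟩ := exec_loadTop (O := O) hs ha (Or.inl rfl)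
  obtain ⟨s₂, e₂, r₂, h₂, k₂⟩ := exec_loadTop (O := O)
    (r₁.setScratch (Or.inl rfl) (s₁.arr 1 (s₁.reg 2))) hb (Or.inr rfl)
  have h₃ : s₂.reg 2 = encodeLetter x.inv := by
    rw [k₂ 2 (by decide)]; simp [h₁, r₁.inv]
  by_cases h : x.inv = y
  · obtain ⟨k, s', E', hk, he, hr, hQ⟩ := hp h s₂ r₂
    exact ⟨_, s', E', (by omega), e₁.seq (.seq (.load s₁ 2 1 2)
      (e₂.seq (.ite_true (by simp [Test.holds, h₃, h₂, h]) he))), hr, hQ⟩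
  · obtain ⟨k, s', E', hk, he, hr, hQ⟩ := hq h s₂ r₂
    exact ⟨_, s', E', (by omega), e₁.seq (.seq (.load s₁ 2 1 2) (e₂.seq (.ite_false
      (by simp [Test.holds, h₃, h₂, encodeLetter_injective.eq_iff, h]) he))), hr, hQ⟩

theorem advance {z : Option (Letter r)} {k : List (Option (Letter r))} (hl : E.rem = z :: k)
    (h : Q (E.setRem k)) : WP O advance E 2 Q := by
  intro s hs
  obtain ⟨s₁, e₁, r₁⟩ := exec_advance (O := O) hs hl
  exact ⟨2, _, _, le_rfl, e₁, r₁, h⟩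

theorem readLetter {k : List (Option (Letter r))} (hl : E.rem = some x :: k)
    (h : Q ((E.setStk a (x :: E.stk a)).setRem k)) : WP O (readLetter a) E 5 Q := by
  intro s hs
  obtain ⟨s₁, e₁, r₁⟩ := exec_pushScratch (O := O) (hs.setScratch (Or.inl rfl) (s.reg 4)) (x := x) a
    (by simp [hs.cur, hl, encodeSymbol])
  obtain ⟨s₂, e₂, r₂⟩ := exec_advance (O := O) r₁ (x := some x) (l := k) (by simpa using hl)
  exact ⟨_, _, _, (by omega), .seq (.copy s 2 4) (e₁.seq e₂), r₂, h⟩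

theorem rewind (h : Q (E.setRem E.inp)) : WP O rewind E 2 Q :=
  fun s hs => ⟨2, _, _, le_rfl, .seq (.const s 1 0) (.load _ 4 0 1),
    by simpa using hs.move (n := 0) (Nat.zero_le _), h⟩

end WP

/-! ### Procedures -/

/-- Move the letters of the stack `a` to the stack `b`, which reverses their order. -/
def moveAll (a b : Stack) : Prog κ := .loop a.nonempty (.seq (pushTop b a) (pop a))

/-- Multiply the word on `d` from the left by the top of `t`. -/
def mulTop (d t : Stack) : Prog κ :=
  .ite d.nonempty (ifTopInv t d (pop d) (pushTop d t)) (pushTop d t)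

/-- Multiply the word on `d` from the left by the inverse of the top of `t`. -/
def divTop (d t : Stack) : Prog κ :=
  .ite d.nonempty (ifTopEq t d (pop d) (pushInvTop d t)) (pushInvTop d t)

/-- Multiply the word on `d` from the left by the word on `s`. -/
def mulLeft (d s : Stack) : Prog κ :=
  .seq (moveAll s .tmp)
    (.loop Stack.tmp.nonempty (.seq (mulTop d .tmp) (.seq (pushTop s .tmp) (pop .tmp))))

/-- Multiply the word on `d` from the left by the inverse of the word on `s`. -/
def divLeft (d s : Stack) : Prog κ :=
  .seq (.loop s.nonempty (.seq (divTop d s) (.seq (pushTop .tmp s) (pop s)))) (moveAll .tmp s)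

/-- Copy the reduced word on `s` to `d`. -/
def copyWord (d s : Stack) : Prog κ := .seq (clear d) (mulLeft d s)

/-- Multiply the word on `d` from the left by the inverse of the next word of the input, and
count the letters that are read. -/
def readInv (d : Stack) : Prog κ :=
  .seq (.loop atLetter (.seq (readLetter .tmp) (.seq (divTop d .tmp) (.seq (pop .tmp) (incr .len)))))
    advance

/-! ### Free reduction on stacks -/

/-- A letter multiplied onto a reduced word from the left cancels at most the first letter. This
makes `mulTop` and `divTop` correct in constant time. -/
theorem toWord_letter_mul (x : Letter r) (d : FreeGroup (Fin r)) :
    (FreeGroup.mk [x] * d).toWord =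
      match d.toWord with
      | [] => [x]
      | y :: l => if x.inv = y then l else x :: y :: l := by
  rw [FreeGroup.toWord_mul, FreeGroup.toWord_mk, FreeGroup.reduce_singleton, List.singleton_append,
    FreeGroup.reduce.cons, FreeGroup.reduce_toWord]
  cases d.toWord with
  | nil => rfl
  | cons y l =>
    obtain ⟨i, b⟩ := x
    obtain ⟨j, c⟩ := y
    simp only [Letter.inv, Prod.mk.injEq]
    congr 1
    cases b <;> cases c <;> simp

theorem mk_cons (x : Letter r) (l : Word r) :
    FreeGroup.mk (x :: l) = FreeGroup.mk [x] * FreeGroup.mk l := by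
  simp [FreeGroup.mul_mk]

theorem Letter.inv_inv (x : Letter r) : x.inv.inv = x := by simp [Letter.inv]

theorem mk_inv_letter (x : Letter r) : FreeGroup.mk [x.inv] = (FreeGroup.mk [x])⁻¹ := by
  simp [Letter.inv, FreeGroup.inv_mk, FreeGroup.invRev]

namespace WP

variable {E : Env r} {t t' : ℕ} {Q : Env r → Prop} {a b : Stack} {x : Letter r}
  {l : List (Letter r)} {g : FreeGroup (Fin r)}

theorem moveAll (hab : a ≠ b)
    (h : Q ((E.setStk a []).setStk b ((E.stk a).reverse ++ E.stk b))) :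
    WP O (moveAll a b) E (7 * (E.stk a).length + 1) Q := by
  induction hl : E.stk a generalizing E with
  | nil =>
    refine loop_done (means_nonempty a E) (by simp [hl]) ?_
    convert h using 1
    refine Env.ext_stk rfl rfl (fun c => ?_) fun c => rfl
    by_cases hb : c = b <;> by_cases ha : c = a <;> simp_all
  | cons x l ih =>
    refine (loop_step (t := 5 + 1) (t' := 7 * l.length + 1) (means_nonempty a E) (by simp [hl])
      (.seq (.pushTop hl (.pop ?_)))).le (by simp; omega)
    refine ih ?_ (by simp [hab, hl])
    convert h using 1
    refine Env.ext_stk rfl rfl (fun c => ?_) fun c => rfl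
    by_cases hb : c = b <;> by_cases ha : c = a <;> simp_all [hab.symm]

theorem moveAll_eq {l l' : Word r} (ha : E.stk a = l) (hb : E.stk b = l')
    (h : Q ((E.setStk a []).setStk b (l.reverse ++ l'))) (hab : a ≠ b := by decide) :
    WP O (FreeConj.moveAll a b) E (7 * l.length + 1) Q := by
  subst ha hb
  exact moveAll hab h

theorem mulTop (hx : E.stk b = x :: l) (hg : E.stk a = g.toWord)
    (h : Q (E.setStk a (FreeGroup.mk [x] * g).toWord)) : WP O (mulTop a b) E 20 Q := by
  rw [toWord_letter_mul] at h
  refine WP.le (.ite (means_nonempty a E) (t := 1 + 5 + 8) (t' := 5) (fun hne => ?_) fun he => ?_)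
    (by omega)
  · obtain ⟨y, k, hy⟩ := List.exists_cons_of_ne_nil hne
    rw [← hg, hy] at h
    refine .ifTopInv hx hy (fun e => .pop ?_) fun e => .pushTop hx ?_
    · simpa [e, hy] using h
    · simpa [e, hy] using h
  · rw [not_not] at he
    rw [← hg, he] at h
    exact .pushTop hx (by simpa [he] using h)

theorem divTop (hx : E.stk b = x :: l) (hg : E.stk a = g.toWord)
    (h : Q (E.setStk a ((FreeGroup.mk [x])⁻¹ * g).toWord)) : WP O (divTop a b) E 21 Q := by
  rw [← mk_inv_letter, toWord_letter_mul, Letter.inv_inv] at h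
  refine WP.le (.ite (means_nonempty a E) (t := 1 + 6 + 7) (t' := 6) (fun hne => ?_) fun he => ?_)
    (by omega)
  · obtain ⟨y, k, hy⟩ := List.exists_cons_of_ne_nil hne
    rw [← hg, hy] at h
    refine .ifTopEq hx hy (fun e => .pop ?_) fun e => .pushInvTop hx ?_
    · simpa [e, hy] using h
    · simpa [e, hy] using h
  · rw [not_not] at he
    rw [← hg, he] at h
    exact .pushInvTop hx (by simpa [he] using h)

/-- The factor lies reversed on `tmp`, so its last letter is multiplied on first, as left
multiplication requires; passing each letter back to `b` restores the factor. -/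
theorem mulLeft_loop (hab : a ≠ b) (ha : a ≠ .tmp) (hb : b ≠ .tmp) (hg : E.stk a = g.toWord)
    (h : Q (((E.setStk .tmp []).setStk b ((E.stk .tmp).reverse ++ E.stk b)).setStk a
      (FreeGroup.mk (E.stk .tmp).reverse * g).toWord)) :
    WP O (.loop Stack.tmp.nonempty
      (.seq (FreeConj.mulTop a .tmp) (.seq (FreeConj.pushTop b .tmp) (FreeConj.pop .tmp)))) E
      (27 * (E.stk .tmp).length + 1) Q := by
  induction hl : E.stk .tmp generalizing E g with
  | nil =>
    refine loop_done (means_nonempty _ E) (by simp [hl]) ?_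
    convert h using 1
    refine Env.ext_stk rfl rfl (fun c => ?_) fun c => rfl
    by_cases hca : c = a
    · simp [hca, hl, hg, ← FreeGroup.one_eq_mk]
    by_cases hcb : c = b <;> by_cases hct : c = .tmp <;> simp_all
  | cons x l ih =>
    refine (loop_step (t := 20 + (5 + 1)) (t' := 27 * l.length + 1) (means_nonempty _ E)
      (by simp [hl]) (.seq (.mulTop hl hg
        (.seq (.pushTop (x := x) (l := l) (by simp [hl, ha.symm]) (.pop ?_)))))).le
      (by simp; omega)
    refine ih (g := FreeGroup.mk [x] * g) (by simp [ha, hab]) ?_ (by simp [hb.symm, hl, ha.symm])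
    convert h using 1
    refine Env.ext_stk rfl rfl (fun c => ?_) fun c => rfl
    by_cases hca : c = a
    · simp [hca, hl, hb.symm, ha.symm, ← mul_assoc, FreeGroup.mul_mk]
    by_cases hcb : c = b <;> by_cases hct : c = .tmp <;> simp_all [Ne.symm]

theorem mulLeft {k : FreeGroup (Fin r)} (hk : FreeGroup.mk (E.stk b) = k) (hg : E.stk a = g.toWord)
    (ht : E.stk .tmp = []) (h : Q (E.setStk a (k * g).toWord)) (hab : a ≠ b := by decide)
    (ha : a ≠ .tmp := by decide) (hb : b ≠ .tmp := by decide) :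
    WP O (mulLeft a b) E (40 * (E.stk b).length + 5) Q := by
  subst hk
  refine WP.le (.seq (t' := 27 * (E.stk b).length + 1) (.moveAll hb
    (WP.le (.mulLeft_loop hab ha hb (g := g) (by simp [hg, ha, hab]) ?_) ?_))) ?_
  · convert h using 1
    refine Env.ext_stk rfl rfl (fun c => ?_) fun c => rfl
    by_cases hca : c = a
    · simp [hca, ht]
    by_cases hcb : c = b <;> by_cases hct : c = .tmp <;> simp_all [Ne.symm]
  · simp [ht]
  · omega

/-- In `xₙ⁻¹ ⋯ x₁⁻¹ * g` the letter `x₁` acts first, and it is the top of the stack; hence the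
reversal is needed only afterwards, to restore `b`. -/
theorem divLeft_loop (hab : a ≠ b) (ha : a ≠ .tmp) (hb : b ≠ .tmp) (hg : E.stk a = g.toWord)
    (h : Q (((E.setStk b []).setStk .tmp ((E.stk b).reverse ++ E.stk .tmp)).setStk a
      ((FreeGroup.mk (E.stk b))⁻¹ * g).toWord)) :
    WP O (.loop b.nonempty
      (.seq (FreeConj.divTop a b) (.seq (FreeConj.pushTop .tmp b) (FreeConj.pop b)))) E
      (28 * (E.stk b).length + 1) Q := by
  induction hl : E.stk b generalizing E g with
  | nil =>
    refine loop_done (means_nonempty _ E) (by simp [hl]) ?_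
    convert h using 1
    refine Env.ext_stk rfl rfl (fun c => ?_) fun c => rfl
    by_cases hca : c = a
    · simp [hca, hl, hg, ← FreeGroup.one_eq_mk]
    by_cases hcb : c = b <;> by_cases hct : c = .tmp <;> simp_all
  | cons x l ih =>
    refine (loop_step (t := 21 + (5 + 1)) (t' := 28 * l.length + 1) (means_nonempty _ E)
      (by simp [hl]) (.seq (.divTop hl hg
        (.seq (.pushTop (x := x) (l := l) (by simp [hl, hab.symm]) (.pop ?_)))))).le
      (by simp; omega)
    refine ih (g := (FreeGroup.mk [x])⁻¹ * g) (by simp [ha, hab]) ?_ (by simp [hb, hl, hab.symm])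
    convert h using 1
    refine Env.ext_stk rfl rfl (fun c => ?_) fun c => rfl
    by_cases hca : c = a
    · rw [hca, hl, mk_cons x l, mul_inv_rev, mul_assoc]
      simp [hb, hab.symm, hl]
    by_cases hcb : c = b <;> by_cases hct : c = .tmp <;> simp_all [Ne.symm]

theorem divLeft {k : FreeGroup (Fin r)} (hk : FreeGroup.mk (E.stk b) = k) (hg : E.stk a = g.toWord)
    (ht : E.stk .tmp = []) (h : Q (E.setStk a (k⁻¹ * g).toWord)) (hab : a ≠ b := by decide)
    (ha : a ≠ .tmp := by decide) (hb : b ≠ .tmp := by decide) :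
    WP O (divLeft a b) E (40 * (E.stk b).length + 5) Q := by
  subst hk
  refine WP.le (.seq (t' := 7 * (E.stk b).length + 1) (.divLeft_loop hab ha hb (g := g) hg
    (WP.le (.moveAll hb.symm ?_) ?_))) ?_
  · convert h using 1
    refine Env.ext_stk rfl rfl (fun c => ?_) fun c => rfl
    by_cases hca : c = a
    · simp [hca, ha, hab]
    by_cases hcb : c = b <;> by_cases hct : c = .tmp <;> simp_all [Ne.symm]
  · simp [ht, ha.symm]
  · omega

theorem copyWord (hr : E.stk b = g.toWord) (ht : E.stk .tmp = [])
    (h : Q (E.setStk a g.toWord)) (hab : a ≠ b := by decide)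
    (ha : a ≠ .tmp := by decide) (hb : b ≠ .tmp := by decide) :
    WP O (copyWord a b) E (40 * (E.stk b).length + 6) Q := by
  refine WP.le (.seq (t' := 40 * (E.stk b).length + 5) (.clear
    (WP.le (.mulLeft (g := 1) rfl (by simp) (by simp [ht]) ?_ hab ha hb) ?_))) ?_
  · convert h using 1
    refine Env.ext_stk rfl rfl (fun c => ?_) fun c => rfl
    by_cases hca : c = a
    · simp [hca, hab.symm, hr]
    · simp [hca]
  · simp [hab.symm]
  · omega

/-- The letters act in the order of reading, each as an inverse from the left, so what accumulates
is the inverse of the word, already reduced. -/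
theorem readInv_loop (ha : a ≠ .tmp) {w : Word r} {k : List (Option (Letter r))}
    (hg : E.stk a = g.toWord) (ht : E.stk .tmp = []) (hw : E.rem = w.map some ++ none :: k)
    (h : Q (((E.setStk a ((FreeGroup.mk w)⁻¹ * g).toWord).setRem (none :: k)).setCnt .len
      (E.cnt .len + w.length))) :
    WP O (.loop atLetter (.seq (FreeConj.readLetter .tmp) (.seq (FreeConj.divTop a .tmp)
      (.seq (FreeConj.pop .tmp) (FreeConj.incr .len))))) E (29 * w.length + 1) Q := by
  induction w generalizing E g with
  | nil =>
    refine loop_done (means_atLetter E) (by simp [hw]) ?_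
    convert h using 1
    refine Env.ext_stk rfl (by simp [hw]) (fun c => ?_) fun c => ?_
    · by_cases hca : c = a <;> simp [hca, hg, ← FreeGroup.one_eq_mk]
    · simp +contextual
  | cons x w ih =>
    refine (loop_step (t := 5 + (21 + (1 + 1))) (t' := 29 * w.length + 1) (means_atLetter E)
      (by simp [hw]) (.seq (.readLetter (x := x) (k := w.map some ++ none :: k) (by simp [hw])
        (.seq (.divTop (x := x) (l := []) (g := g) (by simp [ht]) (by simp [hg, ha])
          (.seq (.pop (.incr ?_)))))))).le (by simp; omega)
    refine ih (g := (FreeGroup.mk [x])⁻¹ * g) (by simp [ha]) (by simp [ha.symm, ht]) (by simp) ?_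
    convert h using 1
    refine Env.ext_stk rfl (by simp) (fun c => ?_) fun c => ?_
    · by_cases hca : c = a
      · rw [hca, mk_cons x w, mul_inv_rev, mul_assoc]
        simp
      by_cases hct : c = .tmp <;> simp_all
    · by_cases hc : c = .len <;> simp [hc]; omega

theorem readInv {w : Word r} {k : List (Option (Letter r))}
    (hg : E.stk a = g.toWord) (ht : E.stk .tmp = []) (hw : E.rem = w.map some ++ none :: k)
    (h : Q (((E.setStk a ((FreeGroup.mk w)⁻¹ * g).toWord).setRem k).setCnt .len
      (E.cnt .len + w.length))) (ha : a ≠ .tmp := by decide) :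
    WP O (readInv a) E (30 * w.length + 3) Q := by
  refine WP.le (.seq (t' := 2) (.readInv_loop ha hg ht hw (.advance (z := none) (k := k) rfl ?_)))
    (by omega)
  exact h

end WP

end FreeConj

namespace FreeConj

open FreeGroup

/-! ## Words in free groups -/

section Words

variable {α : Type*}

theorem exists_common_prefix {β : Type*} [DecidableEq β] : ∀ u v : List β, ∃ p u' v', u = p ++ u' ∧
    v = p ++ v' ∧ ∀ x ∈ u'.head?, ∀ y ∈ v'.head?, x ≠ y
  | [], v => ⟨[], [], v, rfl, rfl, by simp⟩
  | u, [] => ⟨[], u, [], rfl, rfl, by simp⟩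
  | x :: u, y :: v => by
    by_cases h : x = y
    · obtain ⟨p, u', v', hu, hv, hh⟩ := exists_common_prefix u v
      exact ⟨x :: p, u', v', by simp [hu], by simp [hv, h], hh⟩
    · exact ⟨[], x :: u, y :: v, rfl, rfl, by simpa using h⟩

theorem invRev_ne_nil {L : List (α × Bool)} : invRev L ≠ [] ↔ L ≠ [] := by
  simp [invRev]

theorem isReduced_append {L₁ L₂ : List (α × Bool)} : FreeGroup.IsReduced (L₁ ++ L₂) ↔
    IsReduced L₁ ∧ IsReduced L₂ ∧
      ∀ x ∈ L₁.getLast?, ∀ y ∈ L₂.head?, x.1 = y.1 → x.2 = y.2 := by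
  exact List.isChain_append

theorem isCyclicallyReduced_iff_append_self {L : List (α × Bool)} :
    IsCyclicallyReduced L ↔ IsReduced (L ++ L) := by
  rw [isReduced_append, isCyclicallyReduced_iff]
  tauto

/-! ### Periodic words -/

/-- The hypothesis `S.drop d <+: S` expresses that `S` has period `d`: what follows the first `d`
letters is again the beginning of `S`. -/
theorem take_add_of_drop_prefix {β : Type*} {S : List β} {d n : ℕ} (h : S.drop d <+: S)
    (hn : d + n ≤ S.length) : S.take (d + n) = S.take d ++ S.take n := by
  rw [List.take_add]
  congr 1
  exact (h.take n).eq_of_length (by simp; omega)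

/-- A weak form of the Fine–Wilf theorem. The word `S = Y.drop q` has the periods `p - q` and `n`,
and at least `(p - q) + n` letters; splitting its beginning of that length in two ways shows that
its prefixes of lengths `p - q` and `n` commute. Conjugation by `Y.take q` turns them into the two
elements of the conclusion. -/
theorem commute_of_periodic {Y : List (α × Bool)} {n p q : ℕ} (hper : Y.drop n <+: Y)
    (hqp : q ≤ p) (hlen : p + n ≤ Y.length) (hpre : Y.drop p <+: Y.drop q) :
    Commute (mk (Y.take p) * (mk (Y.take q))⁻¹) (mk (Y.take n)) := by
  obtain ⟨d, rfl⟩ := Nat.exists_eq_add_of_le hqp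
  set X := Y.take q with hX
  set S := Y.drop q with hS
  have hSd : S.drop d <+: S := by rw [hS, List.drop_drop]; exact hpre
  have hSn : S.drop n <+: S := by
    rw [hS, List.drop_drop, add_comm, ← List.drop_drop]; exact hper.drop q
  have hl : S.length = Y.length - q := by simp [hS]
  have h₁ : mk (S.take d) * mk (S.take n) = mk (S.take n) * mk (S.take d) := by
    rw [mul_mk, mul_mk, ← take_add_of_drop_prefix hSd (by omega), add_comm,
      take_add_of_drop_prefix hSn (by omega)]
  have h₂ : mk (Y.take n) * mk X = mk X * mk (S.take n) := by
    rw [mul_mk, mul_mk, hX, ← take_add_of_drop_prefix hper (by omega), hS, ← List.take_add,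
      add_comm]
  have h₃ : mk (Y.take (q + d)) = mk X * mk (S.take d) := by
    rw [mul_mk, hX, hS, ← List.take_add]
  rw [h₃]
  have h₄ : mk (Y.take n) = mk X * mk (S.take n) * (mk X)⁻¹ := by rw [← h₂]; group
  rw [h₄]
  exact (Commute.conj_iff _).2 h₁

variable [DecidableEq α]

theorem isReduced_invRev {L : List (α × Bool)} : IsReduced (invRev L) ↔ IsReduced L := by
  rw [isReduced_iff_reduce_eq, isReduced_iff_reduce_eq, reduce_invRev, invRev_injective.eq_iff]

theorem isReduced_invRev_append {s t : List (α × Bool)} (hs : IsReduced s) (ht : IsReduced t)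
    (h : ∀ x ∈ s.head?, ∀ y ∈ t.head?, x ≠ y) : IsReduced (invRev s ++ t) := by
  refine isReduced_append.2 ⟨isReduced_invRev.2 hs, ht, ?_⟩
  intro x hx y hy hxy
  simp only [invRev, List.getLast?_reverse, List.head?_map, Option.mem_def,
    Option.map_eq_some_iff] at hx
  obtain ⟨z, hz, rfl⟩ := hx
  have := h z hz y hy
  obtain ⟨i, b⟩ := z
  obtain ⟨j, c⟩ := y
  simp_all
  cases b <;> cases c <;> simp_all

theorem toWord_mk_of_isReduced {L : List (α × Bool)} (h : IsReduced L) : (mk L).toWord = L := by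
  rw [toWord_mk, h.reduce_eq]

/-! ### Conjugation by long periodic words -/

/-- In `Y⁻¹ a Y`, cancel the longest prefix `P` that `a` shares with `Y`, then the longest suffix of
the rest that is the inverse of a prefix `R` of `Y`. As `Y` is long, parts of both copies of `Y`
remain. They could only vanish by cancelling against each other, and then periodicity would make `a`
commute with the period. -/
theorem toWord_conj_periodic {Y : List (α × Bool)} {n : ℕ} {a : FreeGroup α} (hY : IsReduced Y)
    (hn : 0 < n) (hper : Y.drop n <+: Y) (hlen : norm a + n ≤ Y.length)
    (hc : ¬ Commute a (mk (Y.take n))) :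
    ∃ s m t, s ≠ [] ∧ t ≠ [] ∧ s <:+ Y ∧ t <:+ Y ∧
      ((mk Y)⁻¹ * a * mk Y).toWord = invRev s ++ m ++ t := by
  have hw : IsReduced a.toWord := isReduced_toWord
  obtain ⟨P, w₁, Y₁, hP, hYP, h₁⟩ := exists_common_prefix a.toWord Y
  obtain ⟨R, w₂, Y₂, hR, hYR, h₂⟩ := exists_common_prefix (invRev w₁) Y
  have hw₁ : w₁ = invRev w₂ ++ invRev R := by
    rw [← invRev_append, ← hR, invRev_invRev]
  have hlw : norm a = P.length + (w₂.length + R.length) := by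
    rw [FreeGroup.norm, hP, hw₁]; simp
  have hlP : Y.length = P.length + Y₁.length := by rw [hYP]; simp
  have hlR : Y.length = R.length + Y₂.length := by rw [hYR]; simp
  -- As `n` is positive, `Y` is longer than `a`, so neither `P` nor `R` exhausts it.
  have hne₁ : Y₁ ≠ [] := by rintro rfl; simp at hlP; omega
  have hne₂ : Y₂ ≠ [] := by rintro rfl; simp at hlR; omega
  have hs₁ : Y₁ <:+ Y := ⟨P, hYP.symm⟩
  have hs₂ : Y₂ <:+ Y := ⟨R, hYR.symm⟩
  have hr₁ : IsReduced Y₁ := hY.infix hs₁.isInfix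
  have hr₂ : IsReduced Y₂ := hY.infix hs₂.isInfix
  have ha : a = mk P * (mk w₂)⁻¹ * (mk R)⁻¹ := by
    rw [← mk_toWord (x := a), hP, hw₁, inv_mk, inv_mk, mul_mk, mul_mk, List.append_assoc]
  have hconj : (mk Y)⁻¹ * a * mk Y = (mk Y₁)⁻¹ * (mk w₂)⁻¹ * mk Y₂ := by
    have e₁ : mk Y = mk P * mk Y₁ := by rw [mul_mk, ← hYP]
    have e₂ : mk Y = mk R * mk Y₂ := by rw [mul_mk, ← hYR]
    calc (mk Y)⁻¹ * a * mk Y = (mk P * mk Y₁)⁻¹ * a * (mk R * mk Y₂) := by rw [← e₁, ← e₂]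
      _ = _ := by rw [ha]; group
  -- If `w₂` is empty, then `a = P R⁻¹` and the conjugate is `Y₁⁻¹ Y₂`, where more can cancel. If
  -- this used up `Y₁` or `Y₂`, one would be a prefix of the other, and `commute_of_periodic` would
  -- contradict `hc`.
  by_cases hw₂ : w₂ = []
  · subst hw₂
    obtain ⟨e, s, t, hs, ht, hst⟩ := exists_common_prefix Y₁ Y₂
    have hconj' : (mk Y)⁻¹ * a * mk Y = mk (invRev s ++ t) := by
      rw [hconj, hs, ht, ← mul_mk, ← mul_mk, ← mul_mk, ← inv_mk]
      simp only [← one_eq_mk]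
      group
    have ha' : a = mk (Y.take P.length) * (mk (Y.take R.length))⁻¹ := by
      have e₁ : Y.take P.length = P := by rw [hYP]; simp
      have e₂ : Y.take R.length = R := by rw [hYR]; simp
      rw [e₁, e₂, ha, ← one_eq_mk]; simp
    have d₁ : Y.drop P.length = Y₁ := by rw [hYP]; simp
    have d₂ : Y.drop R.length = Y₂ := by rw [hYR]; simp
    have hls : Y₁.length = e.length + s.length := by rw [hs]; simp
    have hlt : Y₂.length = e.length + t.length := by rw [ht]; simp
    refine ⟨s, [], t, ?_, ?_, (?_ : s <:+ Y₁).trans hs₁, (?_ : t <:+ Y₂).trans hs₂, ?_⟩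
    · rintro rfl
      refine hc (ha' ▸ commute_of_periodic hper ?_ (by omega) ?_)
      · simp at hls; omega
      · rw [d₁, d₂, hs, ht]; simp
    · rintro rfl
      have := commute_of_periodic (p := R.length) (q := P.length) hper (by simp at hlt; omega)
        (by omega) (by rw [d₁, d₂, hs, ht]; simp)
      refine hc ?_
      rw [ha']
      simpa using this.inv_left
    · exact ⟨e, hs.symm⟩
    · exact ⟨e, ht.symm⟩
    · rw [hconj', toWord_mk_of_isReduced, List.append_nil]
      refine isReduced_invRev_append (hr₁.infix ⟨e, [], by simp [hs]⟩)
        (hr₂.infix ⟨e, [], by simp [ht]⟩) hst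
  -- The nonempty middle part separates `Y₁⁻¹` from `Y₂`, so it suffices that each of them is
  -- reduced together with it; this is the maximality of `P` and `R`.
  · refine ⟨Y₁, invRev w₂, Y₂, hne₁, hne₂, hs₁, hs₂, ?_⟩
    rw [hconj, inv_mk, inv_mk, mul_mk, mul_mk, toWord_mk_of_isReduced]
    have hw₂' : invRev w₂ ≠ [] := invRev_ne_nil.2 hw₂
    have hrw₁ : IsReduced w₁ := hw.infix ⟨P, [], by simp [hP]⟩
    have hrw₂ : IsReduced w₂ := isReduced_invRev.1 (hrw₁.infix ⟨[], invRev R, by simp [hw₁]⟩)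
    refine FreeGroup.IsReduced.append_overlap ?_ ?_ hw₂'
    · refine isReduced_invRev_append hr₁ (isReduced_invRev.2 hrw₂) ?_
      intro x hx y hy
      refine (h₁ y ?_ x hx).symm
      rw [hw₁, List.head?_append_of_ne_nil _ hw₂']
      exact hy
    · exact isReduced_invRev_append hrw₂ hr₂ h₂

end Words

end FreeConj

namespace FreeConj

open FreeGroup

section Centralizer

variable {α : Type*}

/-! ### Centralizers of cyclically reduced words -/

/-- The `k`-th power of a word. -/
def wordPow (z : List α) (k : ℕ) : List α := (List.replicate k z).flatten

theorem wordPow_succ (z : List α) (k : ℕ) : wordPow z (k + 1) = z ++ wordPow z k := by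
  simp [wordPow, List.replicate_succ]

theorem wordPow_succ' (z : List α) (k : ℕ) : wordPow z (k + 1) = wordPow z k ++ z := by
  simp [wordPow, List.replicate_succ']

@[simp] theorem length_wordPow (z : List α) (k : ℕ) : (wordPow z k).length = k * z.length := by
  simp [wordPow]

/-- A word that commutes with `z` in the free monoid either is a prefix of `z` or begins with `z`,
and removing that `z` leaves a shorter such word. Each removal costs at least one letter, so the
exponent `u.length` is enough. -/
theorem prefix_wordPow {z : List α} (hz : z ≠ []) : ∀ {k : ℕ} {u : List α},
    u ++ z = z ++ u → u.length ≤ k → u <+: wordPow z k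
  | 0, u, _, hk => by simp [List.length_eq_zero_iff.1 (Nat.le_zero.1 hk)]
  | k + 1, u, h, hk => by
    have hu : u <+: z ++ u := h ▸ List.prefix_append u z
    have hpos := List.length_pos_of_ne_nil hz
    rcases le_total u.length z.length with hl | hl
    · rw [wordPow_succ]
      exact (List.prefix_of_prefix_length_le hu (List.prefix_append z u) hl).trans
        (List.prefix_append _ _)
    · obtain ⟨u', rfl⟩ := List.prefix_of_prefix_length_le (List.prefix_append z u) hu hl
      rw [List.append_assoc] at h
      rw [wordPow_succ]
      refine (List.prefix_append_right_inj z).2 (prefix_wordPow hz (List.append_cancel_left h) ?_)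
      simp at hk; omega

/-- Both products commute with `z`, so they are prefixes of the same power of `z`, and they have the
same length. -/
theorem append_comm_of_append_comm {z u v : List α} (hz : z ≠ []) (hu : u ++ z = z ++ u)
    (hv : v ++ z = z ++ v) : u ++ v = v ++ u := by
  have key {u v : List α} (hu : u ++ z = z ++ u) (hv : v ++ z = z ++ v) :
      (u ++ v) <+: wordPow z (u.length + v.length) :=
    prefix_wordPow hz (by rw [List.append_assoc, hv, ← List.append_assoc, hu, List.append_assoc])
      (by simp)
  refine (List.prefix_of_prefix_length_le (key hu hv) (add_comm v.length u.length ▸ key hv hu)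
    (by simp [add_comm])).eq_of_length (by simp [add_comm])

theorem mk_wordPow (z : List (α × Bool)) (k : ℕ) : mk (wordPow z k) = mk z ^ k := by
  rw [pow_mk]; rfl

theorem isReduced_wordPow {z : List (α × Bool)} (hz : IsCyclicallyReduced z) (k : ℕ) :
    IsReduced (wordPow z k) := (hz.flatten_replicate k).isReduced

variable [DecidableEq α] {z : List (α × Bool)} {c d a b : FreeGroup α}

/-- The reduced word of `z * c` is a sublist of `z ++ c.toWord`. It equals `c.toWord ++ z`, which
has the same length, so no letter is lost. -/
theorem toWord_append_comm_of_isReduced (h : Commute c (mk z)) (hz : IsReduced z)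
    (hr : IsReduced (c.toWord ++ z)) :
    c.toWord ++ z = z ++ c.toWord := by
  have h₁ : (c * mk z).toWord = c.toWord ++ z := by
    rw [toWord_mul, toWord_mk_of_isReduced hz, hr.reduce_eq]
  have h₂ : (mk z * c).toWord.Sublist (z ++ c.toWord) := by
    have := toWord_mul_sublist (mk z) c
    rwa [toWord_mk_of_isReduced hz] at this
  rw [← h.eq, h₁] at h₂
  exact h₂.eq_of_length (by simp [add_comm])

/-- An element of the centralizer of a cyclically reduced word is a prefix of a positive or of a
negative power of that word. -/
theorem append_comm_of_commute (hz : IsCyclicallyReduced z) (h : Commute c (mk z)) :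
    (c.toWord ++ z = z ++ c.toWord ∧ IsReduced (c.toWord ++ z)) ∨
      (c⁻¹.toWord ++ z = z ++ c⁻¹.toWord ∧ IsReduced (c⁻¹.toWord ++ z)) := by
  by_cases hr : IsReduced (c.toWord ++ z)
  · exact Or.inl ⟨toWord_append_comm_of_isReduced h hz.isReduced hr, hr⟩
  right
  -- If `c` cancels against `z`, then `c⁻¹` begins with the first letter of `z`, and `z` may be
  -- followed by its own first letter because it is cyclically reduced.
  have hr' : IsReduced (c⁻¹.toWord ++ z) ∨ IsReduced (z ++ c⁻¹.toWord) := by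
    right
    refine isReduced_append.2 ⟨hz.isReduced, isReduced_toWord, ?_⟩
    intro x hx y hy hxy
    rw [isReduced_append] at hr
    simp only [isReduced_toWord, hz.isReduced, true_and, not_forall] at hr
    obtain ⟨p, hp, q, hq, hpq, hne⟩ := hr
    rw [toWord_inv, invRev, List.head?_reverse, List.getLast?_map] at hy
    rw [Option.mem_def] at hp hy
    rw [hp] at hy
    simp at hy
    subst hy
    have := hz.2 x hx q hq (by simpa [← hpq] using hxy)
    revert hne
    cases hb : p.2 <;> cases hb' : q.2 <;> simp_all
  have hz' := isReduced_invRev.2 hz.isReduced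
  have key : c⁻¹.toWord ++ z = z ++ c⁻¹.toWord := by
    rcases hr' with hr' | hr'
    · exact toWord_append_comm_of_isReduced h.inv_left hz.isReduced hr'
    · have hi : IsReduced (c.toWord ++ invRev z) := by
        rw [← isReduced_invRev, invRev_append, invRev_invRev, ← toWord_inv]; exact hr'
      have := toWord_append_comm_of_isReduced (z := invRev z) (c := c)
        (by rw [← inv_mk]; exact h.inv_right) hz' hi
      have := congrArg invRev this
      rw [invRev_append, invRev_append, invRev_invRev, ← toWord_inv] at this
      exact this.symm
  refine ⟨key, ?_⟩
  rcases hr' with hr' | hr'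
  · exact hr'
  · rw [key]; exact hr'

/-- Up to inversion, both elements are words that commute with `z` in the free monoid, hence with
each other. -/
theorem commute_of_commute (hz : IsCyclicallyReduced z) (hne : z ≠ []) (hc : Commute c (mk z))
    (hd : Commute d (mk z)) : Commute c d := by
  have key {c d : FreeGroup α} (hc : c.toWord ++ z = z ++ c.toWord)
      (hd : d.toWord ++ z = z ++ d.toWord) : Commute c d := by
    have := congrArg mk (append_comm_of_append_comm hne hc hd)
    rwa [← mul_mk, ← mul_mk, mk_toWord, mk_toWord] at this
  rcases append_comm_of_commute hz hc with ⟨h₁, -⟩ | ⟨h₁, -⟩ <;>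
    rcases append_comm_of_commute hz hd with ⟨h₂, -⟩ | ⟨h₂, -⟩
  · exact key h₁ h₂
  · exact Commute.inv_right_iff.1 (key h₁ h₂)
  · exact Commute.inv_left_iff.1 (key h₁ h₂)
  · exact Commute.inv_inv_iff.1 (key h₁ h₂)

/-- This is `toWord_conj_periodic` for the inverse of the power of `z`: it has period `z.length`,
and its suffixes are the inverses of the prefixes of the power. -/
theorem toWord_conj_wordPow {k : ℕ} (hz : IsCyclicallyReduced z) (hne : z ≠ [])
    (hlen : FreeGroup.norm a + z.length ≤ (wordPow z k).length) (hc : ¬ Commute a (mk z)) :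
    ∃ s m t, s ≠ [] ∧ t ≠ [] ∧ s <+: wordPow z k ∧ t <+: wordPow z k ∧
      (mk (wordPow z k) * a * (mk (wordPow z k))⁻¹).toWord = s ++ m ++ invRev t := by
  have hpos := List.length_pos_of_ne_nil hne
  have hk : 0 < k := by
    rw [Nat.pos_iff_ne_zero]; rintro rfl
    simp [wordPow] at hlen; exact hne hlen.2
  obtain ⟨j, rfl⟩ := Nat.exists_eq_succ_of_ne_zero hk.ne'
  obtain ⟨s, m, t, hs, ht, hsY, htY, h⟩ := toWord_conj_periodic (Y := invRev (wordPow z (j + 1)))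
    (n := z.length) (a := a) (isReduced_invRev.2 (isReduced_wordPow hz _)) hpos
    (by
      rw [wordPow_succ', invRev_append, List.drop_left' (by simp), ← invRev_append, ← wordPow_succ',
        wordPow_succ, invRev_append]
      exact List.prefix_append _ _)
    (by simpa using hlen)
    (by
      rw [wordPow_succ', invRev_append, List.take_left' (by simp), ← inv_mk, Commute.inv_right_iff]
      exact hc)
  have hpre {s : List (α × Bool)} (h : s <:+ invRev (wordPow z (j + 1))) :
      invRev s <+: wordPow z (j + 1) := by
    obtain ⟨e, he⟩ := h
    refine ⟨invRev e, ?_⟩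
    rw [← invRev_append, he, invRev_invRev]
  refine ⟨invRev s, m, invRev t, invRev_ne_nil.2 hs, invRev_ne_nil.2 ht, hpre hsY, hpre htY, ?_⟩
  rw [invRev_invRev, ← h, ← inv_mk, inv_inv]

/-- With `N` the power of `z`, `c` commutes with `N`, so `N a N⁻¹ = c (N b N⁻¹) c⁻¹`. The word of `N
b N⁻¹` begins with a nonempty prefix of `N` and ends with the inverse of one. Since `c` followed by
`N` is reduced, nothing cancels at either joint. -/
theorem toWord_conj_of_append_comm {k : ℕ} (hz : IsCyclicallyReduced z) (hne : z ≠ [])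
    (hlen : FreeGroup.norm b + z.length ≤ (wordPow z k).length) (hb : ¬ Commute b (mk z))
    (hc : c.toWord ++ z = z ++ c.toWord) (hr : IsReduced (c.toWord ++ z)) (h : a * c = c * b) :
    (mk (wordPow z k) * a * (mk (wordPow z k))⁻¹).toWord =
      c.toWord ++ (mk (wordPow z k) * b * (mk (wordPow z k))⁻¹).toWord ++ invRev c.toWord := by
  obtain ⟨s, m, t, hs, ht, hsY, htY, hB⟩ := toWord_conj_wordPow hz hne hlen hb
  have hcz : Commute c (mk z) := by
    have := congrArg mk hc
    rwa [← mul_mk, ← mul_mk, mk_toWord] at this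
  have hcN : Commute c (mk (wordPow z k)) := by rw [mk_wordPow]; exact hcz.pow_right k
  have hred : IsReduced (c.toWord ++ wordPow z k) := by
    cases k with
    | zero => simpa [wordPow] using isReduced_toWord
    | succ k =>
      rw [wordPow_succ, ← List.append_assoc]
      refine FreeGroup.IsReduced.append_overlap hr ?_ hne
      rw [← wordPow_succ]; exact isReduced_wordPow hz _
  have hpre {s : List (α × Bool)} (h : s <+: wordPow z k) : IsReduced (c.toWord ++ s) := by
    obtain ⟨e, he⟩ := h
    refine hred.infix ⟨[], e, ?_⟩
    simp [← he]
  have hA : mk (wordPow z k) * a * (mk (wordPow z k))⁻¹ =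
      c * (mk (wordPow z k) * b * (mk (wordPow z k))⁻¹) * c⁻¹ := by
    have ha : a = c * b * c⁻¹ := by rw [← h]; group
    rw [ha]
    have : mk (wordPow z k) * c = c * mk (wordPow z k) := hcN.eq.symm
    calc _ = (mk (wordPow z k) * c) * b * (mk (wordPow z k) * c)⁻¹ := by group
      _ = _ := by rw [this]; group
  have hred' : IsReduced (c.toWord ++ (s ++ m ++ invRev t) ++ invRev c.toWord) := by
    have h₁ : IsReduced (c.toWord ++ s ++ (m ++ invRev t)) := by
      refine FreeGroup.IsReduced.append_overlap (hpre hsY) ?_ hs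
      rw [← List.append_assoc, ← hB]; exact isReduced_toWord
    have h₂ := isReduced_invRev.2 (hpre htY)
    rw [invRev_append] at h₂
    have := FreeGroup.IsReduced.append_overlap (L₁ := c.toWord ++ s ++ m) (L₂ := invRev t)
      (by simpa using h₁) h₂ (invRev_ne_nil.2 ht)
    simpa using this
  rw [hA, hB, ← toWord_mk_of_isReduced hred', ← hB, ← mul_mk, ← mul_mk, ← inv_mk, mk_toWord,
    mk_toWord]

/-- An element of the centralizer of `z` that conjugates `a` to `b` can be read off from the words
for the conjugates of `a` and `b` by a high power of `z`. -/
theorem conjugator_eq_take {k : ℕ} (hz : IsCyclicallyReduced z) (hne : z ≠ [])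
    (hla : FreeGroup.norm a + z.length ≤ (wordPow z k).length)
    (hlb : FreeGroup.norm b + z.length ≤ (wordPow z k).length)
    (ha : ¬ Commute a (mk z)) (hc : Commute c (mk z)) (h : a * c = c * b)
    {A B : List (α × Bool)} (hA : A = (mk (wordPow z k) * a * (mk (wordPow z k))⁻¹).toWord)
    (hB : B = (mk (wordPow z k) * b * (mk (wordPow z k))⁻¹).toWord) :
    (∃ i, A.length = B.length + 2 * i ∧ mk (A.take i) = c) ∨
      (∃ i, B.length = A.length + 2 * i ∧ mk (B.take i) = c⁻¹) := by
  have hb : ¬ Commute b (mk z) := by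
    intro hb
    have : a = c * b * c⁻¹ := by rw [← h]; group
    exact ha (this ▸ (hc.mul_left hb).mul_left hc.inv_left)
  -- According to the sign of `c`, either `A` is the word `c B c⁻¹` or `B` is the word `c⁻¹ A c`.
  -- Without cancellation, the lengths differ by twice the length of `c`.
  rcases append_comm_of_commute hz hc with ⟨h₁, h₂⟩ | ⟨h₁, h₂⟩
  · left
    have := toWord_conj_of_append_comm hz hne hlb hb h₁ h₂ h
    rw [← hA, ← hB] at this
    refine ⟨c.toWord.length, ?_, ?_⟩
    · rw [this]; simp; ring
    · rw [this, List.append_assoc, List.take_left' rfl, mk_toWord]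
  · right
    have := toWord_conj_of_append_comm (a := b) (b := a) hz hne hla ha h₁ h₂
      (by rw [← mul_left_inj c, mul_assoc, mul_assoc, inv_mul_cancel, mul_one, ← mul_right_inj c,
        h]; group)
    rw [← hA, ← hB] at this
    refine ⟨c⁻¹.toWord.length, ?_, ?_⟩
    · rw [this]; simp; ring
    · rw [this, List.append_assoc, List.take_left' rfl, mk_toWord]

/-! ### Conjugate cyclically reduced words -/

omit [DecidableEq α] in
theorem isCyclicallyReduced_append_comm {u v : List (α × Bool)}
    (h : IsCyclicallyReduced (u ++ v)) : IsCyclicallyReduced (v ++ u) := by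
  rw [isCyclicallyReduced_iff_append_self]
  -- The square of `v ++ u` is a segment of the cube of `u ++ v`.
  refine (isReduced_wordPow h 3).infix ⟨u, v, ?_⟩
  simp [wordPow, List.replicate_succ]

omit [DecidableEq α] in
theorem not_isReduced_of_inv {x : α} {b : Bool} {u v : List (α × Bool)} :
    ¬ IsReduced (u ++ [(x, b), (x, !b)] ++ v) := by
  intro h
  have : IsReduced [(x, b), (x, !b)] := h.infix ⟨u, v, rfl⟩
  simp at this

/-- If `z` begins with the first letter of `x` or ends with its inverse, conjugation by this letter
rotates `z` and shortens `x`. Otherwise, for nonempty `z`, the word `x⁻¹ z x` is reduced as it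
stands. It is then equal to `z'`, but its last letter is inverse to its first, so `z'` would not be
cyclically reduced. -/
theorem isRotated_of_conj {z' : List (α × Bool)} (hz' : IsCyclicallyReduced z') :
    ∀ {x z : List (α × Bool)}, IsReduced x → IsCyclicallyReduced z →
      mk z' = (mk x)⁻¹ * mk z * mk x → z ~r z'
  | [], z, _, hz, h => by
    have : z' = z := by
      rw [← toWord_mk_of_isReduced hz'.isReduced, h, ← toWord_mk_of_isReduced hz.isReduced,
        ← one_eq_mk]
      simp
    exact this ▸ List.IsRotated.refl _
  | (i, b) :: x, z, hx, hz, h => by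
    have hx' : IsReduced x := hx.infix ⟨[(i, b)], [], by simp⟩
    have hxe : mk ((i, b) :: x) = mk [(i, b)] * mk x := by simp [mul_mk]
    have hinv : mk [(i, !b)] = (mk [(i, b)])⁻¹ := by simp [inv_mk, invRev]
    by_cases h₁ : ∃ z₀, z = (i, b) :: z₀
    · obtain ⟨z₀, rfl⟩ := h₁
      refine List.IsRotated.trans ⟨1, by simp⟩ (isRotated_of_conj hz' (z := z₀ ++ [(i, b)]) hx'
        (isCyclicallyReduced_append_comm (u := [(i, b)]) hz) ?_)
      have : mk ((i, b) :: z₀) = mk [(i, b)] * mk z₀ := by simp [mul_mk]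
      rw [h, hxe, this, ← mul_mk]; group
    by_cases h₂ : ∃ z₀, z = z₀ ++ [(i, !b)]
    · obtain ⟨z₀, rfl⟩ := h₂
      refine List.IsRotated.trans List.isRotated_append (isRotated_of_conj hz'
        (z := [(i, !b)] ++ z₀) hx' (isCyclicallyReduced_append_comm hz) ?_)
      rw [h, hxe, ← mul_mk, ← mul_mk, hinv]; group
    by_cases hne : z = []
    · subst hne
      have : z' = [] := by
        rw [← toWord_mk_of_isReduced hz'.isReduced, h, ← one_eq_mk, mul_one, inv_mul_cancel,
          toWord_one]
      exact this ▸ List.IsRotated.refl _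
    exfalso
    have hr : IsReduced (invRev ((i, b) :: x) ++ z ++ (i, b) :: x) := by
      refine FreeGroup.IsReduced.append_overlap ?_ ?_ hne
      · refine isReduced_invRev_append hx hz.isReduced ?_
        rintro _ hx' y hy rfl
        simp at hx'; subst hx'
        obtain ⟨w, hw⟩ := List.exists_cons_of_ne_nil hne
        exact h₁ ⟨z.tail, (List.cons_head?_tail hy).symm⟩
      · rw [← isReduced_invRev, invRev_append]
        refine isReduced_invRev_append hx (isReduced_invRev.2 hz.isReduced) ?_
        rintro _ hx' y hy rfl
        simp at hx'; subst hx'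
        obtain ⟨w, y, rfl⟩ := List.eq_nil_or_concat z |>.resolve_left hne
        simp [invRev] at hy
        refine h₂ ⟨w, ?_⟩
        simp [← hy.1, ← hy.2]
    have hz'' : z' = invRev ((i, b) :: x) ++ z ++ (i, b) :: x := by
      rw [← toWord_mk_of_isReduced hz'.isReduced, h, ← toWord_mk_of_isReduced hr, ← mul_mk, ← mul_mk,
        ← inv_mk]
    obtain ⟨x₀, ⟨j, d⟩, hx₀⟩ : ∃ x₀ p, (i, b) :: x = x₀ ++ [p] :=
      ⟨_, _, (List.dropLast_append_getLast (by simp)).symm⟩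
    rw [isCyclicallyReduced_iff_append_self, hz'', hx₀] at hz'
    refine not_isReduced_of_inv (x := j) (b := d)
      (u := invRev (x₀ ++ [(j, d)]) ++ z ++ x₀) (v := invRev x₀ ++ z ++ (x₀ ++ [(j, d)])) ?_
    simpa [invRev] using hz'

/-! ### Cyclic reduction -/

omit [DecidableEq α] in
theorem common_prefix_unique {p q u v s t : List α} (hu : p ++ u = q ++ s) (hv : p ++ v = q ++ t)
    (huv : ∀ x ∈ u.head?, ∀ y ∈ v.head?, x ≠ y) (hs : s ≠ []) (ht : t ≠ [])
    (hst : ∀ x ∈ s.head?, ∀ y ∈ t.head?, x ≠ y) : p = q := by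
  induction p generalizing q with
  | nil =>
    cases q with
    | nil => rfl
    | cons y q =>
      simp only [List.nil_append, List.cons_append] at hu hv
      subst hu hv
      simp at huv
  | cons x p ih =>
    cases q with
    | nil =>
      simp only [List.nil_append, List.cons_append] at hu hv
      subst hu hv
      simp at hst
    | cons y q =>
      simp only [List.cons_append, List.cons.injEq] at hu hv
      rw [hu.1, ih hu.2 hv.2]

/-- If `a` is the reduced word `g z g⁻¹` with `z` cyclically reduced, then `a⁻¹` is `g z⁻¹ g⁻¹`. The
words `z` and `z⁻¹` differ in the first letter, as otherwise the last letter of `z` would be inverse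
to its first. Hence the longest common prefix is exactly `g`. -/
theorem isCyclicallyReduced_of_common_prefix (ha : a ≠ 1) {p u v : List (α × Bool)}
    (hu : a.toWord = p ++ u) (hv : a⁻¹.toWord = p ++ v)
    (huv : ∀ x ∈ u.head?, ∀ y ∈ v.head?, x ≠ y) :
    IsCyclicallyReduced ((mk p)⁻¹ * a * mk p).toWord := by
  set g := reduceCyclically.conjugator a.toWord
  set z := reduceCyclically a.toWord
  have h : g ++ z ++ invRev g = a.toWord :=
    reduceCyclically.conj_conjugator_reduceCyclically a.toWord
  have hz : IsCyclicallyReduced z := reduceCyclically.isCyclicallyReduced isReduced_toWord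
  have hne : z ≠ [] := by
    intro hz
    rw [hz, List.append_nil] at h
    refine ha ?_
    rw [← mk_toWord (x := a), ← h, ← mul_mk, ← inv_mk, mul_inv_cancel]
  have h' : g ++ invRev z ++ invRev g = a⁻¹.toWord := by
    rw [toWord_inv, ← h]; simp
  have hp : p = g := by
    refine common_prefix_unique (s := z ++ invRev g) (t := invRev z ++ invRev g)
      (by rw [← hu, ← h, List.append_assoc]) (by rw [← hv, ← h', List.append_assoc]) huv
      (by simp [hne]) (by simp [invRev_ne_nil.2 hne]) ?_
    rw [List.head?_append_of_ne_nil _ hne, List.head?_append_of_ne_nil _ (invRev_ne_nil.2 hne)]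
    rintro x hx _ hy rfl
    rw [invRev, List.head?_reverse, List.getLast?_map, Option.mem_def, Option.map_eq_some_iff] at hy
    obtain ⟨y, hy, rfl⟩ := hy
    simpa using hz.2 y hy _ hx rfl
  have : (mk p)⁻¹ * a * mk p = mk z := by
    rw [hp, ← mk_toWord (x := a), ← h, ← mul_mk, ← mul_mk, ← inv_mk]; group
  rw [this, toWord_mk_of_isReduced hz.isReduced]
  exact hz

end Centralizer

end FreeConj

namespace FreeConj

/-! ### Matching cyclic words -/

section Matching

variable {β : Type*} {key : β → ℕ} {z z' u v m : List β} {x y : β}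

/-- The `i`-th rotation of a word, continued periodically, with the lexicographic order. -/
def rotation (key : β → ℕ) (z : List β) (i : ℕ) : Lex (ℕ → ℕ) :=
  toLex fun t => (z[(i + t) % z.length]?.map key).getD 0

/-- The `i`-th rotation of `z` is not a least rotation if `z'` is a rotation of `z`. -/
def Beaten (key : β → ℕ) (z z' : List β) (i : ℕ) : Prop :=
  ∃ j, rotation key z' j < rotation key z i

theorem rotation_mod (i : ℕ) : rotation key z (i % z.length) = rotation key z i := by
  simp [rotation]

theorem ofLex_rotation {i t : ℕ} (h : (z ++ z)[i + t]? = some x) :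
    ofLex (rotation key z i) t = key x := by
  have : z[(i + t) % z.length]? = some x := by
    rcases lt_or_ge (i + t) z.length with hl | hl
    · rw [Nat.mod_eq_of_lt hl, ← h, List.getElem?_append_left hl]
    · rw [List.getElem?_append_right hl] at h
      rw [Nat.mod_eq_sub_mod hl, Nat.mod_eq_of_lt (List.getElem?_eq_some_iff.1 h).1, h]
  simp [rotation, this]

/-- The rotations of a rotation of `z` are rotations of `z`, and none of them beats a least one. -/
theorem not_isRotated_of_beaten (hz : z ≠ []) (h : ∀ i < z.length, Beaten key z z' i) :
    ¬ z ~r z' := by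
  rintro ⟨s, rfl⟩
  have hpos := List.length_pos_of_ne_nil hz
  have hrot (j : ℕ) : rotation key (z.rotate s) j = rotation key z (j + s) := by
    unfold rotation
    congr 1
    funext t
    rw [List.length_rotate, List.getElem?_rotate (Nat.mod_lt _ hpos), Nat.mod_add_mod]
    congr 4
    ring
  obtain ⟨i, hi, hmin⟩ := Finset.exists_min_image (Finset.range z.length) (rotation key z)
    ⟨0, by simpa using hpos⟩
  obtain ⟨j, hj⟩ := h i (by simpa using hi)
  rw [hrot, ← rotation_mod] at hj
  exact absurd hj (not_lt.2 (hmin _ (by simpa using Nat.mod_lt _ hpos)))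

/-- The invariant of the search for a common rotation of `z` and `z'`: the words `m.reverse` of
`z ++ z` and `z' ++ z'` in front of `u` and `v` agree, and no earlier place can be the beginning of
a common least rotation. -/
def MatchInv (key : β → ℕ) (z z' u v m : List β) : Prop :=
  ∃ p p', z ++ z = p ++ (m.reverse ++ u) ∧ z' ++ z' = p' ++ (m.reverse ++ v) ∧
    (∀ i < p.length, Beaten key z z' i) ∧ ∀ i < p'.length, Beaten key z' z i

theorem MatchInv.init : MatchInv key z z' (z ++ z) (z' ++ z') [] :=
  ⟨[], [], rfl, rfl, by simp, by simp⟩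

theorem MatchInv.symm (h : MatchInv key z z' u v m) : MatchInv key z' z v u m := by
  obtain ⟨p, p', h₁, h₂, h₃, h₄⟩ := h
  exact ⟨p', p, h₂, h₁, h₄, h₃⟩

theorem MatchInv.eq (h : MatchInv key z z' (x :: u) (x :: v) m) :
    MatchInv key z z' u v (x :: m) := by
  obtain ⟨p, p', h₁, h₂, h₃⟩ := h
  exact ⟨p, p', by simp [h₁], by simp [h₂], h₃⟩

/-- For every `t ≤ m.length`, the rotations that begin `t` letters into the two matched segments
agree until the mismatch, where that of `z'` is smaller. One mismatch thus excludes `m.length + 1`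
beginnings in `z`, and only `z'` has to be read again from the start of its segment. -/
theorem MatchInv.gt (h : MatchInv key z z' (x :: u) (y :: v) m) (hxy : key y < key x) :
    MatchInv key z z' u (m.reverse ++ y :: v) [] := by
  obtain ⟨p, p', h₁, h₂, h₃, h₄⟩ := h
  refine ⟨p ++ m.reverse ++ [x], p', by simp [h₁], by simp [h₂], fun i hi => ?_, h₄⟩
  rcases lt_or_ge i p.length with hp | hp
  · exact h₃ i hp
  obtain ⟨t, rfl⟩ := Nat.exists_eq_add_of_le hp
  have ht : t ≤ m.length := by simp at hi; omega
  have e₁ (s : ℕ) : (z ++ z)[p.length + t + s]? = (m.reverse ++ x :: u)[t + s]? := by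
    rw [h₁, List.getElem?_append_right (by omega)]; congr 1; omega
  have e₂ (s : ℕ) : (z' ++ z')[p'.length + t + s]? = (m.reverse ++ y :: v)[t + s]? := by
    rw [h₂, List.getElem?_append_right (by omega)]; congr 1; omega
  have hkey : ∃ k, (∀ s < k, ofLex (rotation key z' (p'.length + t)) s =
      ofLex (rotation key z (p.length + t)) s) ∧ ofLex (rotation key z' (p'.length + t)) k <
      ofLex (rotation key z (p.length + t)) k := by
    refine ⟨m.length - t, fun s hs => ?_, ?_⟩
    · have hl : t + s < m.reverse.length := by simp; omega
      have g₁ := e₁ s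
      have g₂ := e₂ s
      rw [List.getElem?_append_left hl, List.getElem?_eq_getElem hl] at g₁ g₂
      exact (ofLex_rotation g₂).trans (ofLex_rotation g₁).symm
    · have g₁ := e₁ (m.length - t)
      have g₂ := e₂ (m.length - t)
      have h0 (l : List β) (c : β) : (m.reverse ++ c :: l)[t + (m.length - t)]? = some c := by
        rw [Nat.add_sub_cancel' ht, ← List.length_reverse (as := m),
          List.getElem?_append_right le_rfl]
        simp
      rw [h0] at g₁ g₂
      have k₁ := ofLex_rotation (key := key) g₁
      have k₂ := ofLex_rotation (key := key) g₂
      exact (k₂.trans_lt hxy).trans_eq k₁.symm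
  exact ⟨_, hkey⟩

theorem MatchInv.lt (h : MatchInv key z z' (x :: u) (y :: v) m) (hxy : key x < key y) :
    MatchInv key z z' (m.reverse ++ x :: u) v [] := (h.symm.gt hxy).symm

/-- The excluded beginnings and the matched letters together fill `z ++ z`. With fewer than
`z.length` letters matched, every rotation of `z` is excluded. -/
theorem MatchInv.not_isRotated (h : MatchInv key z z' [] v m) (hm : m.length < z.length) :
    ¬ z ~r z' := by
  obtain ⟨p, p', h₁, -, h₃, -⟩ := h
  refine not_isRotated_of_beaten (by rintro rfl; simp at hm) fun i hi => h₃ i ?_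
  have := congrArg List.length h₁
  simp at this
  omega

/-- Writing `z = p s` gives `w = s p` and `u = s`, so both sides are `s p s`. The unread rest `u` of
the square thus conjugates `z` to `w`, and the search yields a conjugator at no extra cost. -/
theorem append_eq_of_rotation {p w : List β} (h : z ++ z = p ++ (w ++ u))
    (hw : w.length = z.length) : u ++ z = w ++ u ∧ z ~r w := by
  have hlen := congrArg List.length h
  simp only [List.length_append] at hlen
  have hp : p <+: z := List.prefix_of_prefix_length_le (h ▸ List.prefix_append p _)
    (List.prefix_append z z) (by omega)
  obtain ⟨s, rfl⟩ := hp
  simp only [List.length_append] at hlen hw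
  have h' : (s ++ p) ++ s = w ++ u := by
    rw [List.append_assoc] at h
    simpa using List.append_cancel_left h
  obtain ⟨rfl, rfl⟩ := List.append_inj h' (by simp; omega)
  exact ⟨by simp, List.isRotated_append⟩

theorem MatchInv.append_eq (h : MatchInv key z z' u v m) (hm : m.length = z.length) :
    u ++ z = m.reverse ++ u ∧ z ~r m.reverse := by
  obtain ⟨p, p', h₁, -⟩ := h
  exact append_eq_of_rotation h₁ (by simpa using hm)

end Matching

end FreeConj

/-! ### Programs for the steps of the algorithm, with correctness and running time -/

namespace FreeConj

open RAM

variable {r : ℕ} {κ : Type} {O : κ → List ℕ → List ℕ}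

/-- `E` and `E'` differ at most in the unread input, the stacks `as` and the counters `cs`. -/
structure SameUpTo (as : List Stack) (cs : List Counter) (E E' : Env r) : Prop where
  inp : E'.inp = E.inp
  stk : ∀ a, a ∉ as → E'.stk a = E.stk a
  cnt : ∀ c, c ∉ cs → E'.cnt c = E.cnt c

theorem SameUpTo.refl {as : List Stack} {cs : List Counter} (E : Env r) : SameUpTo as cs E E :=
  ⟨rfl, fun _ _ => rfl, fun _ _ => rfl⟩

theorem SameUpTo.trans {as : List Stack} {cs : List Counter} {E₁ E₂ E₃ : Env r}
    (h : SameUpTo as cs E₁ E₂) (h' : SameUpTo as cs E₂ E₃) : SameUpTo as cs E₁ E₃ :=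
  ⟨h'.inp.trans h.inp, fun a ha => (h'.stk a ha).trans (h.stk a ha),
    fun c hc => (h'.cnt c hc).trans (h.cnt c hc)⟩

theorem SameUpTo.mono {as as' : List Stack} {cs cs' : List Counter} {E E' : Env r}
    (h : SameUpTo as cs E E') (ha : as ⊆ as') (hc : cs ⊆ cs') : SameUpTo as' cs' E E' :=
  ⟨h.inp, fun a h' => h.stk a fun h => h' (ha h), fun c h' => h.cnt c fun h => h' (hc h)⟩

theorem length_toWord_mul_le (g h : FreeGroup (Fin r)) :
    (g * h).toWord.length ≤ g.toWord.length + h.toWord.length :=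
  FreeGroup.norm_mul_le g h

theorem length_toWord_inv (g : FreeGroup (Fin r)) : g⁻¹.toWord.length = g.toWord.length :=
  FreeGroup.norm_inv_eq

theorem length_toWord_mk_le (w : Word r) : (FreeGroup.mk w).toWord.length ≤ w.length :=
  FreeGroup.norm_mk_le

/-! ### Cyclic reduction -/

/-- Split off the common prefix of the words on `x` and `y`, which is moved to `mat`. -/
def splitPrefix : Prog κ :=
  .seq (setCounter .go 1) (.loop Counter.go.nonzero
    (.ite Stack.x.nonempty
      (.ite Stack.y.nonempty
        (ifTopEq .x .y (.seq (pushTop .mat .x) (.seq (pop .x) (pop .y))) (setCounter .go 0))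
        (setCounter .go 0))
      (setCounter .go 0)))

/-- Write the word on `c` as a conjugate of a cyclically reduced word. -/
def cyclicReduce : Prog κ :=
  .seq (copyWord .x .c) (.seq (clear .y) (.seq (divLeft .y .c) (.seq (clear .mat) (.seq splitPrefix
    (.seq (clear .conj) (.seq (moveAll .mat .conj) (.seq (clear .core)
      (.seq (mulLeft .core .conj) (.seq (mulLeft .core .c) (divLeft .core .conj))))))))))

namespace WP

variable {E : Env r} {Q : Env r → Prop}

theorem splitPrefix_loop {p u v : Word r} (hgo : E.cnt .go = 1) (hx : E.stk .x = p ++ u)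
    (hy : E.stk .y = p ++ v) (huv : ∀ x ∈ u.head?, ∀ y ∈ v.head?, x ≠ y)
    (h : Q ((((E.setStk .x u).setStk .y v).setStk .mat (p.reverse ++ E.stk .mat)).setCnt .go 0)) :
    WP O (.loop Counter.go.nonzero
      (.ite Stack.x.nonempty
        (.ite Stack.y.nonempty
          (FreeConj.ifTopEq .x .y (.seq (FreeConj.pushTop .mat .x)
            (.seq (FreeConj.pop .x) (FreeConj.pop .y))) (FreeConj.setCounter .go 0))
          (FreeConj.setCounter .go 0))
        (FreeConj.setCounter .go 0))) E (20 * p.length + 21) Q := by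
  induction p generalizing E with
  | nil =>
    refine (loop_step (means_nonzero _ E) (by simp [hgo]) (t := 19) (t' := 1) ?_).le (by simp)
    have hQ : WP O (FreeConj.setCounter .go 0) E 1 fun E' => WP O (.loop Counter.go.nonzero
        (.ite Stack.x.nonempty
          (.ite Stack.y.nonempty
            (FreeConj.ifTopEq .x .y (.seq (FreeConj.pushTop .mat .x)
              (.seq (FreeConj.pop .x) (FreeConj.pop .y))) (FreeConj.setCounter .go 0))
            (FreeConj.setCounter .go 0))
          (FreeConj.setCounter .go 0))) E' 1 Q := by
      refine .setCounter (loop_done (means_nonzero _ _) (by simp) ?_)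
      convert h using 1
      refine Env.ext_stk rfl rfl (fun c => ?_) fun c => rfl
      by_cases h₁ : c = .x <;> by_cases h₂ : c = .y <;> by_cases h₃ : c = .mat <;> simp_all
    refine WP.le (.ite (means_nonempty _ _) (t := 1 + 1 + 14) (t' := 1) (fun h₁ => ?_) fun _ => hQ)
      (by omega)
    refine WP.le (.ite (means_nonempty _ _) (t := 5 + (1 + 1) + 1 + 7 - 1) (t' := 1)
      (fun h₂ => ?_) fun _ => hQ) (by omega)
    obtain ⟨a, l, ha⟩ := List.exists_cons_of_ne_nil h₁
    obtain ⟨b, l', hb⟩ := List.exists_cons_of_ne_nil h₂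
    have hab : a ≠ b := by
      have hu : u = a :: l := hx.symm.trans ha
      have hv : v = b :: l' := hy.symm.trans hb
      exact huv a (by simp [hu]) b (by simp [hv])
    exact (WP.ifTopEq (t := 1) (t' := 1) ha hb (fun h => absurd h hab) fun _ => hQ).le (by omega)
  | cons a p ih =>
    refine (loop_step (means_nonzero _ E) (by simp [hgo]) (t := 19) (t' := 20 * p.length + 21)
      ?_).le (by simp; omega)
    refine WP.le (.ite (means_nonempty _ _) (t := 17) (t' := 1) (fun h₁ => ?_)
      fun h => absurd hx (by simp [not_not.1 h])) (by omega)
    refine WP.le (.ite (means_nonempty _ _) (t := 15) (t' := 1) (fun h₁ => ?_)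
      fun h => absurd hy (by simp [not_not.1 h])) (by omega)
    refine WP.le (.ifTopEq hx hy (t := 5 + (1 + 1)) (t' := 1) (fun _ => ?_)
      fun h => absurd rfl h) (by omega)
    refine .seq (.pushTop hx (.seq (.pop (.pop ?_))))
    refine ih (by simp [hgo]) (by simp [hx]) (by simp [hy]) ?_
    convert h using 1
    refine Env.ext_stk rfl rfl (fun c => ?_) fun c => rfl
    by_cases h₁ : c = .x <;> by_cases h₂ : c = .y <;> by_cases h₃ : c = .mat <;> simp_all

theorem splitPrefix {p u v : Word r} (hx : E.stk .x = p ++ u)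
    (hy : E.stk .y = p ++ v) (huv : ∀ x ∈ u.head?, ∀ y ∈ v.head?, x ≠ y)
    (h : Q ((((E.setStk .x u).setStk .y v).setStk .mat (p.reverse ++ E.stk .mat)).setCnt .go 0)) :
    WP O splitPrefix E (20 * p.length + 22) Q := by
  refine WP.le (.seq (t' := 20 * p.length + 21) (.setCounter (.splitPrefix_loop (by simp) hx hy huv
    ?_))) (by omega)
  convert h using 1
  refine Env.ext_stk rfl rfl (fun c => rfl) fun c => ?_
  by_cases hc : c = .go <;> simp [hc]

theorem cyclicReduce {a : FreeGroup (Fin r)} (ht : E.stk .tmp = []) (hc : E.stk .c = a.toWord) :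
    WP O cyclicReduce E (500 * a.toWord.length + 100) fun E' =>
      SameUpTo [.x, .y, .mat, .conj, .core] [.go] E E' ∧
        ∃ p u v, a.toWord = p ++ u ∧ a⁻¹.toWord = p ++ v ∧
          (∀ x ∈ u.head?, ∀ y ∈ v.head?, x ≠ y) ∧ E'.stk .conj = p ∧
          E'.stk .core = ((FreeGroup.mk p)⁻¹ * a * FreeGroup.mk p).toWord := by
  obtain ⟨p, u, v, hu, hv, huv⟩ := exists_common_prefix a.toWord a⁻¹.toWord
  have hlen : p.length ≤ a.toWord.length := by simp [hu]
  have ha : FreeGroup.mk a.toWord = a := FreeGroup.mk_toWord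
  have hp : p = (FreeGroup.mk p).toWord := (toWord_mk_of_isReduced
    ((FreeGroup.isReduced_toWord (x := a)).infix ⟨[], u, by simp [hu]⟩)).symm
  refine WP.le (.seq <| .copyWord (g := a) hc ht <| .seq <| .clear <|
    .seq <| .divLeft (k := a) (g := 1) (by simp [hc, ha]) (by simp) (by simp [ht]) <| .seq <| .clear <|
    .seq <| .splitPrefix (p := p) (u := u) (v := v) (by simpa using hu) (by simpa using hv) huv <|
    .seq <| .clear <| .seq <| .moveAll_eq (l := p.reverse) (l' := []) (by simp) (by simp) <|
    .seq <| .clear <|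
    .seq <| .mulLeft (k := .mk p) (g := 1) (by simp) (by simp) (by simp [ht]) <|
    .seq <| .mulLeft (k := a) (g := .mk p * 1) (by simp [hc, ha]) (by simp) (by simp [ht]) <|
    .divLeft (k := .mk p) (g := a * (.mk p * 1)) (by simp) (by simp) (by simp [ht]) ?_) ?_
  · refine ⟨⟨by simp, fun b hb => ?_, fun c hc => ?_⟩, p, u, v, hu, hv, huv, by simp, ?_⟩
    · simp at hb
      simp [hb]
    · simp at hc
      simp [hc]
    · simp only [Env.setStk_stk, if_true, mul_one, mul_assoc]
  · simp [hc]
    omega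

end WP

/-! ### Matching cyclic words -/

/-- One step of the search for a common rotation. -/
def matchStep : Prog κ :=
  .ite (Stack.mat.shorter .zu)
    (.ite Stack.al.nonempty
      (.ite Stack.be.nonempty
        (ifTopEq .al .be (.seq (pushTop .mat .al) (.seq (pop .al) (pop .be)))
          (ifTopLt .be .al (.seq (pop .al) (moveAll .mat .be)) (.seq (pop .be) (moveAll .mat .al))))
        (.seq (setCounter .fail 1) (setCounter .go 0)))
      (.seq (setCounter .fail 1) (setCounter .go 0)))
    (setCounter .go 0)

/-- Search for a common rotation of the words whose squares are on `al` and `be`. -/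
def matchWords : Prog κ :=
  .seq (clear .mat) (.seq (setCounter .go 1) (.loop Counter.go.nonzero matchStep))

namespace WP

variable {E : Env r} {Q : Env r → Prop}

/-- The result of the search for a common rotation of `z` and `z'`. -/
def MatchResult (z z' : Word r) (E E' : Env r) : Prop :=
  SameUpTo [.al, .be, .mat] [.go, .fail] E E' ∧
    ((E'.cnt .fail = 1 ∧ ¬ z ~r z') ∨ (E'.cnt .fail = 0 ∧ (E'.stk .mat).length = z.length ∧
      z.length = z'.length ∧
      MatchInv encodeLetter z z' (E'.stk .al) (E'.stk .be) (E'.stk .mat)))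

/-- The total height of `al`, `be` and `mat` drops in every round that continues the search: a match
removes two letters and adds one to `mat`, and a mismatch discards one letter and only moves the
others. Moving `mat` back takes time proportional to its height; the term `7 * (E.stk .mat).length`
saves up for it. -/
theorem matchWords_loop {z z' : Word r} {n : ℕ} (hz : E.stk .zu = z) (hzz : z.length = z'.length)
    (hgo : E.cnt .go = 1) (hf : E.cnt .fail = 0) (hm : (E.stk .mat).length ≤ z.length)
    (hinv : MatchInv encodeLetter z z' (E.stk .al) (E.stk .be) (E.stk .mat))
    (hn : (E.stk .al).length + (E.stk .be).length + (E.stk .mat).length ≤ n) :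
    WP O (.loop Counter.go.nonzero matchStep) E (60 * n + 7 * (E.stk .mat).length + 60)
      (MatchResult z z' E) := by
  induction n using Nat.strong_induction_on generalizing E with
  | _ n ih =>
  have hleave {E₁ : Env r} (h : E₁.cnt .go = 0) (hr : MatchResult z z' E E₁) :
      WP O (.loop Counter.go.nonzero matchStep) E₁ 1 (MatchResult z z' E) :=
    loop_done (means_nonzero _ _) (by simp [h]) hr
  have hfail (h : ¬ z ~r z') : WP O (.seq (FreeConj.setCounter .fail 1)
      (FreeConj.setCounter .go 0)) E 2 fun E' =>
        WP O (.loop Counter.go.nonzero matchStep) E' 1 (MatchResult z z' E) := by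
    refine .seq (t := 1) (t' := 1) (.setCounter (.setCounter (hleave (by simp) ⟨⟨rfl, ?_, ?_⟩, ?_⟩)))
    · simp
    · intro c hc; simp at hc; simp [hc]
    · exact Or.inl ⟨by simp, h⟩
  by_cases hlt : (E.stk .mat).length < (E.stk .zu).length
  swap
  · refine (loop_step (means_nonzero _ E) (by simp [hgo]) (t := 3) (t' := 1) ?_).le (by omega)
    refine WP.le (.ite (means_shorter _ _ _) (t := 1) (t' := 1) (fun h => absurd h hlt) fun _ => ?_)
      (by omega)
    refine .setCounter (hleave (by simp) ⟨⟨rfl, by simp, ?_⟩, Or.inr ⟨by simpa using hf, ?_, ?_⟩⟩)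
    · intro c hc; simp at hc; simp [hc]
    · rw [hz] at hlt
      simp only [Env.setCnt_stk]; omega
    · exact ⟨hzz, hinv⟩
  rw [hz] at hlt
  cases ha : E.stk .al with
  | nil =>
    refine (loop_step (means_nonzero _ E) (by simp [hgo]) (t := 6) (t' := 1) ?_).le (by omega)
    refine WP.le (.ite (means_shorter _ _ _) (t := 4) (t' := 1) (fun _ => ?_)
      fun h => absurd (hz ▸ hlt) h) (by omega)
    refine WP.le (.ite (means_nonempty _ _) (t := 1) (t' := 2) (fun h => absurd ha h) fun _ => ?_)
      (by omega)
    rw [ha] at hinv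
    exact hfail (hinv.not_isRotated hlt)
  | cons x u =>
  cases hb : E.stk .be with
  | nil =>
    refine (loop_step (means_nonzero _ E) (by simp [hgo]) (t := 8) (t' := 1) ?_).le (by omega)
    refine WP.le (.ite (means_shorter _ _ _) (t := 6) (t' := 1) (fun _ => ?_)
      fun h => absurd (hz ▸ hlt) h) (by omega)
    refine WP.le (.ite (means_nonempty _ _) (t := 4) (t' := 1) (fun _ => ?_)
      fun h => absurd (not_not.1 h) (by simp [ha])) (by omega)
    refine WP.le (.ite (means_nonempty _ _) (t := 1) (t' := 2) (fun h => absurd hb h) fun _ => ?_)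
      (by omega)
    rw [hb] at hinv
    exact hfail fun h => hinv.symm.not_isRotated (hzz ▸ hlt) h.symm
  | cons y v =>
  rw [ha, hb] at hinv hn
  simp only [List.length_cons] at hn
  have hcont {E₁ : Env r} (hsame : SameUpTo [.al, .be, .mat] [.go, .fail] E E₁)
      (hgo₁ : E₁.cnt .go = 1) (hf₁ : E₁.cnt .fail = 0) (hm₁ : (E₁.stk .mat).length ≤ z.length)
      (hinv₁ : MatchInv encodeLetter z z' (E₁.stk .al) (E₁.stk .be) (E₁.stk .mat))
      (hn₁ : (E₁.stk .al).length + (E₁.stk .be).length + (E₁.stk .mat).length + 1 ≤ n) :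
      WP O (.loop Counter.go.nonzero matchStep) E₁ (60 * (n - 1) + 7 * (E₁.stk .mat).length + 60)
        (MatchResult z z' E) := by
    refine (ih (n - 1) (by omega) (E := E₁) ?_ hgo₁ hf₁ hm₁ hinv₁ (by omega)).mono le_rfl ?_
    · rw [hsame.stk _ (by decide), hz]
    · exact fun E' h => ⟨hsame.trans h.1, h.2⟩
  have hpre {t t' : ℕ} (h : WP O (FreeConj.ifTopEq .al .be
      (.seq (FreeConj.pushTop .mat .al) (.seq (FreeConj.pop .al) (FreeConj.pop .be)))
      (FreeConj.ifTopLt .be .al (.seq (FreeConj.pop .al) (FreeConj.moveAll .mat .be))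
        (.seq (FreeConj.pop .be) (FreeConj.moveAll .mat .al)))) E t
      fun E' => WP O (.loop Counter.go.nonzero matchStep) E' t' (MatchResult z z' E)) :
      WP O (.loop Counter.go.nonzero matchStep) E (t + t' + 10) (MatchResult z z' E) := by
    refine (loop_step (means_nonzero _ E) (by simp [hgo]) (t := t + 9) (t' := t') ?_).le (by omega)
    refine WP.le (.ite (means_shorter _ _ _) (t := t + 7) (t' := 1) (fun _ => ?_)
      fun h => absurd (hz ▸ hlt) h) (by omega)
    refine WP.le (.ite (means_nonempty _ _) (t := t + 4) (t' := 2) (fun _ => ?_)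
      fun h => absurd (not_not.1 h) (by simp [ha])) (by omega)
    exact WP.le (.ite (means_nonempty _ _) (t := t) (t' := 1) (fun _ => h)
      fun h => absurd (not_not.1 h) (by simp [hb])) (by omega)
  by_cases hxy : x = y
  · refine (hpre (t' := 60 * (n - 1) + 7 * ((E.stk .mat).length + 1) + 60)
      (.ifTopEq ha hb (t := 5 + (1 + 1)) (t' := 1) (fun _ => ?_) fun h => absurd hxy h)).le ?_
    · refine .seq (.pushTop ha (.seq (.pop (.pop ?_))))
      subst hxy
      refine WP.le (hcont ⟨rfl, fun c hc => ?_, fun _ _ => rfl⟩ hgo hf ?_ ?_ ?_) ?_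
      · simp at hc; simp [hc]
      · simp; omega
      · simpa [ha, hb] using hinv.eq
      · simp [ha, hb]; omega
      · simp
    · omega
  have hne : encodeLetter x ≠ encodeLetter y := fun h => hxy (encodeLetter_injective h)
  refine (hpre (t' := 60 * (n - 1) + 60)
    (.ifTopEq ha hb (t := 1) (t' := 20 + 14 * (E.stk .mat).length / 2) (fun h => absurd h hxy)
      fun _ => WP.le ?_ le_rfl)).le ?_
  · by_cases hlt' : encodeLetter y < encodeLetter x
    · refine WP.le (.ifTopLt hb ha (t := 1 + (7 * (E.stk .mat).length + 1)) (t' := 1) (fun _ => ?_)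
        fun h => absurd hlt' h) (by omega)
      refine .seq (.pop (.moveAll_eq (l := E.stk .mat) (l' := y :: v) (by simp) (by simp [hb]) ?_))
      refine WP.le (hcont ⟨rfl, fun c hc => ?_, fun _ _ => rfl⟩ hgo hf ?_ ?_ ?_) ?_
      · simp at hc; simp [hc]
      · simp
      · simpa [ha, hb] using hinv.gt hlt'
      · simp [ha]; omega
      · simp
    · refine WP.le (.ifTopLt hb ha (t := 1) (t' := 1 + (7 * (E.stk .mat).length + 1))
        (fun h => absurd h hlt') fun _ => ?_) (by omega)
      refine .seq (.pop (.moveAll_eq (l := E.stk .mat) (l' := x :: u) (by simp) (by simp [ha]) ?_))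
      refine WP.le (hcont ⟨rfl, fun c hc => ?_, fun _ _ => rfl⟩ hgo hf ?_ ?_ ?_) ?_
      · simp at hc; simp [hc]
      · simp
      · simpa [ha, hb] using hinv.lt (by omega)
      · simp [hb]; omega
      · simp
  · omega

theorem matchWords {z z' : Word r} (hz : E.stk .zu = z) (hzz : z.length = z'.length)
    (hf : E.cnt .fail = 0) (ha : E.stk .al = z ++ z) (hb : E.stk .be = z' ++ z') :
    WP O matchWords E (240 * z.length + 100) (MatchResult z z' E) := by
  have hsame : SameUpTo [.al, .be, .mat] [.go, .fail] E ((E.setStk .mat []).setCnt .go 1) := by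
    refine ⟨rfl, fun c hc => ?_, fun c hc => ?_⟩ <;> simp at hc <;> simp [hc]
  refine WP.le (.seq <| .clear <| .seq <| .setCounter <|
    -- The squares of two words of equal length have `4 * z.length` letters together, and `mat` is
    -- empty.
    (matchWords_loop (n := 4 * z.length) (z := z) (z' := z') (by simpa using hz) hzz (by simp)
      (by simpa using hf) (by simp) ?_ ?_).mono le_rfl fun E' h => ⟨hsame.trans h.1, h.2⟩) ?_
  · simpa [ha, hb] using MatchInv.init
  · simp [ha, hb]; omega
  · simp; omega

end WP

/-! ### Conjugating a pair of elements to a common cyclically reduced word -/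

/-- Write the word on `a` as a conjugate of a cyclically reduced word. -/
def splitCore (a g z : Stack) : Prog κ :=
  .seq (copyWord .c a) (.seq cyclicReduce (.seq (copyWord g .conj) (copyWord z .core)))

/-- Every rotation of a word is a segment of its square. The squares are formed by free
multiplication, where nothing cancels for cyclically reduced cores. -/
def squareCores : Prog κ :=
  .seq (clear .al) (.seq (mulLeft .al .zu) (.seq (mulLeft .al .zu)
    (.seq (clear .be) (.seq (mulLeft .be .zv) (mulLeft .be .zv)))))

def matchCores : Prog κ :=
  .ite (Stack.zu.notLonger .zv)
    (.ite (Stack.zv.notLonger .zu) matchWords (setCounter .fail 1)) (setCounter .fail 1)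

/-- After a successful search `mat` holds the common rotation reversed, and the rests on `al` and
`be` conjugate the cores to it. The inverses of these rests, multiplied by `gu` and `gv`, are the
conjugators. -/
def setConjugators : Prog κ :=
  .seq (clear .z) (.seq (moveAll .mat .z)
    (.seq (clear .g) (.seq (divLeft .g .al) (.seq (mulLeft .g .gu)
      (.seq (clear .h) (.seq (divLeft .h .be) (mulLeft .h .gv)))))))

/-- Conjugate the words on `u` and `v` to a common cyclically reduced word, if possible. -/
def normalize : Prog κ :=
  .seq (splitCore .u .gu .zu) (.seq (splitCore .v .gv .zv) (.seq squareCores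
    (.seq matchCores (.ite Counter.fail.nonzero .skip setConjugators))))

/-- The stacks that `normalize` changes. -/
def normalizeStacks : List Stack :=
  [.x, .y, .mat, .conj, .core, .c, .gu, .gv, .zu, .zv, .al, .be, .z, .g, .h]

/-- The result of writing `a` as a conjugate of a cyclically reduced word. -/
def CoreResult (a g : FreeGroup (Fin r)) (z : Word r) : Prop :=
  a = g * FreeGroup.mk z * g⁻¹ ∧ z.length ≤ 3 * a.toWord.length ∧
    g.toWord.length ≤ a.toWord.length ∧ (a ≠ 1 → FreeGroup.IsCyclicallyReduced z ∧ z ≠ []) ∧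
    (FreeGroup.mk z).toWord = z

/-- The result of conjugating `a` and `b` to the common cyclically reduced word on `z`. -/
def NormalizeResult (a b : FreeGroup (Fin r)) (E : Env r) : Prop :=
  (E.cnt .fail = 1 ∧ ¬ ∃ x, x⁻¹ * a * x = b) ∨
    (E.cnt .fail = 0 ∧ ∃ g h : FreeGroup (Fin r), ∃ w, FreeGroup.IsCyclicallyReduced w ∧ w ≠ [] ∧
      E.stk .z = w ∧ E.stk .g = g.toWord ∧ E.stk .h = h.toWord ∧
      g⁻¹ * a * g = FreeGroup.mk w ∧ h⁻¹ * b * h = FreeGroup.mk w ∧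
      g.toWord.length ≤ 4 * a.toWord.length ∧ h.toWord.length ≤ 4 * b.toWord.length ∧
      w.length ≤ 3 * a.toWord.length)

namespace WP

variable {E : Env r} {Q : Env r → Prop}

theorem splitCore {a : FreeGroup (Fin r)} {s g z : Stack} (ht : E.stk .tmp = [])
    (hs : E.stk s = a.toWord) (hsc : .c ≠ s := by decide) (hst : s ≠ .tmp := by decide)
    (hg : g ∉ [Stack.tmp, .conj, .core] := by decide)
    (hz : z ∉ [Stack.tmp, .conj, .core, g] := by decide) :
    WP O (splitCore s g z) E (800 * a.toWord.length + 200) fun E' =>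
      SameUpTo [.x, .y, .mat, .conj, .core, .c, g, z] [.go] E E' ∧
        ∃ k w, CoreResult a k w ∧ E'.stk g = k.toWord ∧ E'.stk z = w := by
  simp only [List.mem_cons, List.not_mem_nil, or_false, not_or] at hg hz
  refine WP.le (.seq (t' := 700 * a.toWord.length + 150) <| .copyWord hs ht ?_ hsc (by decide) hst)
    (by rw [hs]; omega)
  refine WP.le (.seq (t' := 200 * a.toWord.length + 50) <|
    (cyclicReduce (a := a) (by simpa using ht) (by simp)).mono le_rfl ?_) (by omega)
  rintro E₁ ⟨hsame, p, u, v, hu, hv, huv, hconj, hcore⟩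
  have hp : (FreeGroup.mk p).toWord = p := toWord_mk_of_isReduced
    ((FreeGroup.isReduced_toWord (x := a)).infix ⟨[], u, by simp [hu]⟩)
  have ht₁ : E₁.stk .tmp = [] := by rw [hsame.stk _ (by decide)]; simpa using ht
  have hplen : p.length ≤ a.toWord.length := by simp [hu]
  have hl : ((FreeGroup.mk p)⁻¹ * a * FreeGroup.mk p).toWord.length ≤ 3 * a.toWord.length := by
    have h₁ := length_toWord_mul_le ((FreeGroup.mk p)⁻¹ * a) (FreeGroup.mk p)
    have h₂ := length_toWord_mul_le (FreeGroup.mk p)⁻¹ a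
    rw [length_toWord_inv] at h₂
    rw [hp] at h₁ h₂
    omega
  refine WP.le (.seq <| .copyWord (g := .mk p) (by rw [hconj, hp]) ht₁ (.copyWord
    (g := (FreeGroup.mk p)⁻¹ * a * FreeGroup.mk p) (by simpa [Ne.symm hg.2.2] using hcore)
    (by simpa [Ne.symm hg.1] using ht₁) ?_ hz.2.2.1 hz.1 (by decide)) hg.2.1 hg.1 (by decide)) ?_
  · refine ⟨⟨hsame.inp, fun b hb => ?_, fun c hc => ?_⟩, .mk p, _, ⟨?_, hl, ?_, ?_, ?_⟩,
      ?_, by simp⟩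
    · simp only [List.mem_cons, List.not_mem_nil, or_false, not_or] at hb
      have := hsame.stk b (by simp [hb])
      simp [hb, this]
    · simpa using hsame.cnt c hc
    · rw [FreeGroup.mk_toWord]; group
    · rwa [hp]
    · intro ha
      refine ⟨isCyclicallyReduced_of_common_prefix ha hu hv huv, fun h => ha ?_⟩
      rw [FreeGroup.toWord_eq_nil_iff] at h
      have : a = FreeGroup.mk p * ((FreeGroup.mk p)⁻¹ * a * FreeGroup.mk p) * (FreeGroup.mk p)⁻¹ := by
        group
      rw [this, h]; group
    · rw [FreeGroup.mk_toWord]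
    · simp [Ne.symm hz.2.2.2]
  · have h' : ((E₁.setStk g (FreeGroup.mk p).toWord).stk .core).length ≤ 3 * a.toWord.length := by
      rw [Env.setStk_stk, if_neg (Ne.symm hg.2.2), hcore]; exact hl
    rw [hconj]
    omega

theorem squareCores {z z' : Word r} (ht : E.stk .tmp = []) (hz : E.stk .zu = z)
    (hz' : E.stk .zv = z') (hc : FreeGroup.IsCyclicallyReduced z)
    (hc' : FreeGroup.IsCyclicallyReduced z') (hQ : Q ((E.setStk .al (z ++ z)).setStk .be (z' ++ z'))) :
    WP O squareCores E (80 * z.length + 80 * z'.length + 50) Q := by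
  have h₁ : (FreeGroup.mk z * (FreeGroup.mk z * 1)).toWord = z ++ z := by
    rw [mul_one, FreeGroup.mul_mk,
      toWord_mk_of_isReduced (isCyclicallyReduced_iff_append_self.1 hc)]
  have h₂ : (FreeGroup.mk z' * (FreeGroup.mk z' * 1)).toWord = z' ++ z' := by
    rw [mul_one, FreeGroup.mul_mk,
      toWord_mk_of_isReduced (isCyclicallyReduced_iff_append_self.1 hc')]
  refine WP.le (.seq <| .clear <|
    .seq <| .mulLeft (k := .mk z) (g := 1) (by simp [hz]) (by simp) (by simp [ht]) <|
    .seq <| .mulLeft (k := .mk z) (g := .mk z * 1) (by simp [hz]) (by simp) (by simp [ht]) <|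
    .seq <| .clear <|
    .seq <| .mulLeft (k := .mk z') (g := 1) (by simp [hz']) (by simp) (by simp [ht]) <|
    .mulLeft (k := .mk z') (g := .mk z' * 1) (by simp [hz']) (by simp) (by simp [ht]) ?_) ?_
  · rw [h₁, h₂]
    convert hQ using 1
    refine Env.ext_stk rfl rfl (fun c => ?_) fun c => rfl
    by_cases h₃ : c = .be <;> by_cases h₄ : c = .al <;> simp [h₃, h₄]
  · simp [hz, hz']; omega

theorem matchCores {z z' : Word r} (hz : E.stk .zu = z) (hz' : E.stk .zv = z')
    (hf : E.cnt .fail = 0) (ha : E.stk .al = z ++ z) (hb : E.stk .be = z' ++ z') :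
    WP O matchCores E (240 * z.length + 110) (MatchResult z z' E) := by
  have hfail (h : z.length ≠ z'.length) :
      WP O (FreeConj.setCounter .fail 1) E 1 (MatchResult z z' E) := by
    refine .setCounter ⟨⟨rfl, fun _ _ => rfl, fun c hc => ?_⟩, Or.inl ⟨by simp, fun h' => ?_⟩⟩
    · simp at hc; simp [hc]
    · exact h h'.perm.length_eq
  refine WP.le (.ite (means_notLonger _ _ _) (t := 240 * z.length + 105) (t' := 1) (fun h₁ => ?_)
    fun h₁ => hfail fun h => h₁ (by rw [hz, hz', h])) (by omega)
  refine WP.le (.ite (means_notLonger _ _ _) (t := 240 * z.length + 100) (t' := 1) (fun h₂ => ?_)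
    fun h₁ => hfail fun h => h₁ (by rw [hz, hz', h])) (by omega)
  rw [hz, hz'] at h₁ h₂
  exact matchWords hz (le_antisymm h₁ h₂) hf ha hb

theorem setConjugators {w α β : Word r} {g h : FreeGroup (Fin r)} (ht : E.stk .tmp = [])
    (hw : E.stk .mat = w.reverse) (hα : E.stk .al = α) (hβ : E.stk .be = β)
    (hg : E.stk .gu = g.toWord) (hh : E.stk .gv = h.toWord)
    (hQ : Q ((((E.setStk .mat []).setStk .z w).setStk .g (g * (FreeGroup.mk α)⁻¹).toWord).setStk .h
      (h * (FreeGroup.mk β)⁻¹).toWord)) :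
    WP O setConjugators E (7 * w.length + 40 * (α.length + β.length + g.toWord.length +
      h.toWord.length) + 50) Q := by
  refine WP.le (.seq <| .clear <| .seq <| .moveAll_eq (l := w.reverse) (l' := []) (by simp [hw])
      (by simp) <| .seq <| .clear <|
    .seq <| .divLeft (k := .mk α) (g := 1) (by simp [hα]) (by simp) (by simp [ht]) <|
    .seq <| .mulLeft (k := g) (g := (.mk α)⁻¹ * 1) (by simp [hg, FreeGroup.mk_toWord]) (by simp)
      (by simp [ht]) <| .seq <| .clear <|
    .seq <| .divLeft (k := .mk β) (g := 1) (by simp [hβ]) (by simp) (by simp [ht]) <|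
    .mulLeft (k := h) (g := (.mk β)⁻¹ * 1) (by simp [hh, FreeGroup.mk_toWord]) (by simp)
      (by simp [ht]) ?_) ?_
  · convert hQ using 1
    refine Env.ext_stk rfl rfl (fun c => ?_) fun c => rfl
    by_cases h₁ : c = .h
    · simp only [h₁, Env.setStk_stk, if_true, mul_one]
    by_cases h₂ : c = .g
    · simp only [h₂, Env.setStk_stk, if_true, mul_one]; simp
    by_cases h₃ : c = .z <;> by_cases h₄ : c = .mat <;> simp_all
  · simp [hα, hβ, hg, hh]; omega

end WP

theorem exists_conj_iff_isRotated {a b g h : FreeGroup (Fin r)} {z z' : Word r}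
    (ha : a = g * FreeGroup.mk z * g⁻¹) (hb : b = h * FreeGroup.mk z' * h⁻¹)
    (hz : FreeGroup.IsCyclicallyReduced z) (hz' : FreeGroup.IsCyclicallyReduced z')
    (hx : ∃ x, x⁻¹ * a * x = b) : z ~r z' := by
  obtain ⟨x, hx⟩ := hx
  refine isRotated_of_conj hz' (x := (g⁻¹ * x * h).toWord) FreeGroup.isReduced_toWord hz ?_
  have : FreeGroup.mk z' = h⁻¹ * b * h := by rw [hb]; group
  rw [FreeGroup.mk_toWord, this, ← hx, ha]; group

theorem isCyclicallyReduced_of_isRotated {z w : Word r} (h : z ~r w)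
    (hz : FreeGroup.IsCyclicallyReduced z) : FreeGroup.IsCyclicallyReduced w := by
  obtain ⟨n, rfl⟩ := h
  rw [List.rotate_eq_drop_append_take_mod]
  exact isCyclicallyReduced_append_comm (by rwa [List.take_append_drop])

theorem WP.normalize {E : Env r} {a b : FreeGroup (Fin r)} (ht : E.stk .tmp = [])
    (hu : E.stk .u = a.toWord) (hv : E.stk .v = b.toWord) (ha : a ≠ 1) (hb : b ≠ 1)
    (hf : E.cnt .fail = 0) :
    WP O normalize E (3000 * (a.toWord.length + b.toWord.length) + 1000) fun E' =>
      SameUpTo normalizeStacks [.go, .fail] E E' ∧ NormalizeResult a b E' := by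
  refine WP.le (.seq (t' := 2200 * (a.toWord.length + b.toWord.length) + 800) <|
    (splitCore ht hu).mono le_rfl ?_) (by omega)
  rintro E₁ ⟨hs₁, g, z, ⟨hag, hzl, hgl, hz, hzr⟩, hg₁, hz₁⟩
  obtain ⟨hz, hzne⟩ := hz ha
  refine WP.le (.seq (t' := 1400 * (a.toWord.length + b.toWord.length) + 600) <|
    (splitCore (a := b) (by rw [hs₁.stk _ (by decide), ht])
      (by rw [hs₁.stk _ (by decide), hv])).mono le_rfl ?_) (by omega)
  rintro E₂ ⟨hs₂, h, z', ⟨hbh, hzl', hhl, hz', hzr'⟩, hg₂, hz₂⟩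
  obtain ⟨hz', hzne'⟩ := hz' hb
  have ht₂ : E₂.stk .tmp = [] := by
    rw [hs₂.stk _ (by decide), hs₁.stk _ (by decide), ht]
  have hz₁₂ : E₂.stk .zu = z := by rw [hs₂.stk _ (by decide), hz₁]
  have hg₁₂ : E₂.stk .gu = g.toWord := by rw [hs₂.stk _ (by decide), hg₁]
  refine WP.le (.seq (t' := 1100 * (a.toWord.length + b.toWord.length) + 550) <|
    .squareCores ht₂ hz₁₂ hz₂ hz hz' ?_) (by omega)
  refine WP.le (.seq (t' := 300 * (a.toWord.length + b.toWord.length) + 400) <|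
    (matchCores (z := z) (z' := z') (by simpa using hz₁₂) (by simpa using hz₂) ?_ (by simp)
      (by simp)).mono le_rfl ?_) (by omega)
  · simp [hs₂.cnt .fail (by decide), hs₁.cnt .fail (by decide), hf]
  rintro E₃ ⟨hs₃, hres⟩
  have hs₂₃ : SameUpTo normalizeStacks [.go, .fail] E₂
      ((E₂.setStk .al (z ++ z)).setStk .be (z' ++ z')) := by
    refine ⟨rfl, fun c hc => ?_, fun _ _ => rfl⟩
    have h₁ : c ≠ .al := fun h => hc (h ▸ by decide)
    have h₂ : c ≠ .be := fun h => hc (h ▸ by decide)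
    simp [h₁, h₂]
  have hsame : SameUpTo normalizeStacks [.go, .fail] E E₃ :=
    (hs₁.mono (by decide) (by decide)).trans ((hs₂.mono (by decide) (by decide)).trans
      (hs₂₃.trans (hs₃.mono (by decide) (by decide))))
  refine WP.le (.ite (means_nonzero _ _) (t := 1)
    (t' := 300 * (a.toWord.length + b.toWord.length) + 390) (fun hne => .skip ⟨hsame, ?_⟩)
    fun he => ?_) (by omega)
  · rcases hres with ⟨h₁, h₂⟩ | ⟨h₁, -⟩
    · exact Or.inl ⟨h₁, fun hx => h₂ (exists_conj_iff_isRotated hag hbh hz hz' hx)⟩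
    · exact absurd h₁ hne
  · rcases hres with ⟨h₁, -⟩ | ⟨h₁, hlen, hzz, hinv⟩
    · exact absurd (h₁.symm.trans (not_not.1 he)) one_ne_zero
    obtain ⟨hα, hrot⟩ := hinv.append_eq hlen
    obtain ⟨hβ, -⟩ := hinv.symm.append_eq (hlen.trans hzz)
    -- Since a full rotation is matched, the rest of each square is no longer than its core, which
    -- has at most three times the length of `a` or `b`. This is the source of the factor `4` in
    -- `NormalizeResult`.
    obtain ⟨p, p', hp, hp', -⟩ := hinv
    replace hp := congrArg List.length hp
    replace hp' := congrArg List.length hp'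
    simp only [List.length_append, List.length_reverse] at hp hp'
    have hconj {u z w : Word r} {a g : FreeGroup (Fin r)} (hag : a = g * FreeGroup.mk z * g⁻¹)
        (hu : u ++ z = w ++ u) : (g * (FreeGroup.mk u)⁻¹)⁻¹ * a * (g * (FreeGroup.mk u)⁻¹) =
          FreeGroup.mk w := by
      have := congrArg FreeGroup.mk hu
      rw [← FreeGroup.mul_mk, ← FreeGroup.mul_mk] at this
      calc _ = FreeGroup.mk u * FreeGroup.mk z * (FreeGroup.mk u)⁻¹ := by rw [hag]; group
        _ = _ := by rw [this]; group
    have hlen' {g : FreeGroup (Fin r)} (u : Word r) : (g * (FreeGroup.mk u)⁻¹).toWord.length ≤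
        g.toWord.length + u.length := by
      refine (length_toWord_mul_le _ _).trans ?_
      rw [length_toWord_inv]
      exact Nat.add_le_add_left (length_toWord_mk_le u) _
    have hstk (s : Stack) (h : s ∉ [Stack.al, .be, .mat]) : E₃.stk s = E₂.stk s := by
      rw [hs₃.stk _ h]
      simp only [List.mem_cons, List.not_mem_nil, or_false, not_or] at h
      simp [h]
    have hne : (E₃.stk .mat).reverse ≠ [] := by
      intro h
      rw [← List.length_eq_zero_iff, List.length_reverse, hlen, List.length_eq_zero_iff] at h
      exact hzne h
    have hl₁ := hlen' (g := g) (E₃.stk .al)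
    have hl₂ := hlen' (g := h) (E₃.stk .be)
    have hl₃ : (E₃.stk .mat).reverse.length = z.length := by rw [List.length_reverse, hlen]
    refine WP.le (setConjugators (g := g) (h := h) (w := (E₃.stk .mat).reverse)
      (by rw [hstk _ (by decide), ht₂]) (by simp) rfl rfl
      (by rw [hstk _ (by decide), hg₁₂]) (by rw [hstk _ (by decide), hg₂])
      ⟨hsame.trans ⟨rfl, fun c hc => ?_, fun _ _ => rfl⟩,
        Or.inr ⟨h₁, g * (FreeGroup.mk (E₃.stk .al))⁻¹, h * (FreeGroup.mk (E₃.stk .be))⁻¹,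
          (E₃.stk .mat).reverse, isCyclicallyReduced_of_isRotated hrot hz, hne, by simp, by simp,
          by simp, hconj hag hα, hconj hbh hβ, by omega, by omega, by omega⟩⟩) (by omega)
    have h₁ : c ≠ .mat := fun h => hc (h ▸ by decide)
    have h₂ : c ≠ .z := fun h => hc (h ▸ by decide)
    have h₃ : c ≠ .g := fun h => hc (h ▸ by decide)
    have h₄ : c ≠ .h := fun h => hc (h ▸ by decide)
    simp [h₁, h₂, h₃, h₄]

/-! ### Reading off the conjugator of a pair -/

/-- Put the conjugate of the word on `a` by the word on `g` on `d`. -/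
def conjugate (d a g : Stack) : Prog κ :=
  .seq (copyWord d g) (.seq (mulLeft d a) (divLeft d g))

/-- Multiply the word on `n` by the word on `z` until it is longer than the word on `a`. -/
def growPower (a : Stack) : Prog κ := .loop (Stack.n.notLonger a) (mulLeft .n .z)

/-- Put the conjugate of the word on `a` by the inverse of the word on `n` on `d`. -/
def conjugateByPower (d a : Stack) : Prog κ :=
  .seq (clear d) (.seq (divLeft d .n) (.seq (mulLeft d a) (mulLeft d .n)))

/-- Move half of the difference of `i` and `j` many letters from `a` to `mat`. -/
def moveHalf (i j : Counter) (a : Stack) : Prog κ :=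
  .loop (j.less i) (.seq (decr i) (.seq (decr i) (.seq (pushTop .mat a) (pop a))))

/-- The two loops make `n` longer than both words; the last factor `z` supplies the further
`z.length` letters that `conjugator_eq_take` requires. -/
def powers : Prog κ :=
  .seq (copyWord .n .z) (.seq (growPower .ca) (.seq (growPower .cb) (.seq (mulLeft .n .z)
    (.seq (conjugateByPower .p .ca) (conjugateByPower .q .cb)))))

/-- Half of the excess length is cut from the front of the longer word, rounded up. If a conjugator
exists, the excess is even and at most one of the two cuts is nonempty; in all other cases the
result is meaningless and is left to `verify`. -/
def halves : Prog κ :=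
  .seq (height .i .p) (.seq (height .j .q) (.seq (clear .mat) (.seq (moveHalf .i .j .p)
    (.seq (clear .c₁) (.seq (moveAll .mat .c₁) (.seq (moveHalf .j .i .q) (.seq (clear .c₂)
      (.seq (moveAll .mat .c₂) (.seq (clear .c) (.seq (divLeft .c .c₂) (mulLeft .c .c₁)))))))))))

/-- Find the only possible conjugator in the centralizer of the word on `z` for the words on `ca`
and `cb`. -/
def candidate : Prog κ := .seq powers halves

namespace WP

variable {E : Env r} {Q : Env r → Prop}

theorem conjugate {d a g : Stack} {x y : FreeGroup (Fin r)} (ht : E.stk .tmp = [])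
    (ha : E.stk a = x.toWord) (hg : E.stk g = y.toWord)
    (h : Q (E.setStk d (y⁻¹ * x * y).toWord)) (hda : d ≠ a := by decide) (hdg : d ≠ g := by decide)
    (hd : d ≠ .tmp := by decide) (hat : a ≠ .tmp := by decide) (hgt : g ≠ .tmp := by decide) :
    WP O (conjugate d a g) E (80 * y.toWord.length + 40 * x.toWord.length + 20) Q := by
  refine WP.le (.seq <| .copyWord hg ht (.seq <|
    .mulLeft (k := x) (g := y) (by simp [hda.symm, ha, FreeGroup.mk_toWord]) (by simp)
      (by simp [hd.symm, ht])
    (.divLeft (k := y) (g := x * y) (by simp [hdg.symm, hg, FreeGroup.mk_toWord]) (by simp)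
      (by simp [hd.symm, ht]) ?_ hdg hd hgt) hda hd hat) hdg hd hgt) ?_
  · convert h using 1
    refine Env.ext_stk rfl rfl (fun c => ?_) fun c => rfl
    by_cases hc : c = d
    · simp only [hc, Env.setStk_stk, if_true, mul_assoc]
    · simp [hc]
  · simp [hda.symm, hdg.symm, ha, hg]; omega

theorem growPower {a : Stack} {w l : Word r} {k : ℕ} (ht : E.stk .tmp = [])
    (hw : FreeGroup.IsCyclicallyReduced w) (hne : w ≠ []) (hz : E.stk .z = w)
    (hn : E.stk .n = wordPow w k) (ha : E.stk a = l) (han : a ≠ .n)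
    (h : ∀ k', l.length < k' * w.length →
      k' * w.length ≤ max (k * w.length) (l.length + w.length) →
      k * w.length ≤ k' * w.length → Q (E.setStk .n (wordPow w k'))) :
    WP O (growPower a) E (50 * (l.length + w.length - k * w.length) + 1) Q := by
  have hpos := List.length_pos_of_ne_nil hne
  induction hm : l.length + w.length - k * w.length using Nat.strong_induction_on
    generalizing E k with
  | _ m ih =>
  by_cases hl : k * w.length ≤ l.length
  · have hk : (k + 1) * w.length = k * w.length + w.length := by ring
    refine (loop_step (means_notLonger _ _ _) (by simpa [hn, ha] using hl)
      (t := 40 * w.length + 5)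
      (t' := 50 * (l.length + w.length - (k + 1) * w.length) + 1) ?_).le (by omega)
    refine WP.le (.mulLeft (k := .mk w) (g := .mk (wordPow w k)) (by rw [hz])
      (by rw [hn, toWord_mk_of_isReduced (isReduced_wordPow hw k)]) ht ?_) (by rw [hz])
    rw [FreeGroup.mul_mk, ← wordPow_succ, toWord_mk_of_isReduced (isReduced_wordPow hw _)]
    refine ih _ (by omega) (by simpa using ht) (by simpa using hz) (by simp)
      (by simpa [han] using ha) (fun k' h₁ h₂ h₃ => ?_) rfl
    convert h k' h₁ (by omega) (by omega) using 1
    refine Env.ext_stk rfl rfl (fun c => ?_) fun c => rfl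
    by_cases hc : c = .n <;> simp [hc]
  · refine (loop_done (means_notLonger _ _ _) (by simpa [hn, ha] using hl) ?_).le (by omega)
    convert h k (by omega) (by omega) le_rfl using 1
    refine Env.ext_stk rfl rfl (fun c => ?_) fun c => rfl
    by_cases hc : c = .n <;> simp [hc, hn]

theorem conjugateByPower {d a : Stack} {x y : FreeGroup (Fin r)} (ht : E.stk .tmp = [])
    (ha : E.stk a = x.toWord) (hn : E.stk .n = y.toWord)
    (h : Q (E.setStk d (y * x * y⁻¹).toWord)) (hda : d ≠ a := by decide)
    (hdn : d ≠ .n := by decide) (hd : d ≠ .tmp := by decide) (hat : a ≠ .tmp := by decide) :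
    WP O (conjugateByPower d a) E (80 * y.toWord.length + 40 * x.toWord.length + 20) Q := by
  refine WP.le (.seq <| .clear <| .seq <|
    .divLeft (k := y) (g := 1) (by simp [hdn.symm, hn, FreeGroup.mk_toWord]) (by simp)
      (by simp [hd.symm, ht]) (.seq <|
    .mulLeft (k := x) (g := y⁻¹ * 1) (by simp [hda.symm, ha, FreeGroup.mk_toWord]) (by simp)
      (by simp [hd.symm, ht])
    (.mulLeft (k := y) (g := x * (y⁻¹ * 1)) (by simp [hdn.symm, hn, FreeGroup.mk_toWord]) (by simp)
      (by simp [hd.symm, ht]) ?_ hdn hd) hda hd hat) hdn hd) ?_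
  · convert h using 1
    refine Env.ext_stk rfl rfl (fun c => ?_) fun c => rfl
    by_cases hc : c = d
    · simp only [hc, Env.setStk_stk, if_true, mul_assoc, mul_one]
    · simp [hc]
  · simp [hda.symm, hdn.symm, ha, hn]; omega

theorem moveHalf {i j : Counter} {a : Stack} {l l' : Word r} {m n k : ℕ} (hij : i ≠ j)
    (ham : a ≠ .mat) (hi : E.cnt i = m) (hj : E.cnt j = n) (ha : E.stk a = l)
    (hm : E.stk .mat = l') (hl : m ≤ l.length) (hk : k = (m - n + 1) / 2)
    (h : Q (((E.setStk a (l.drop k)).setStk .mat ((l.take k).reverse ++ l')).setCnt i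
      (m - 2 * k))) : WP O (moveHalf i j a) E (10 * k + 1) Q := by
  induction k generalizing E l l' m with
  | zero =>
    refine loop_done (means_less _ _ _) (by rw [hi, hj]; omega) ?_
    convert h using 1
    refine Env.ext_stk rfl rfl (fun c => ?_) fun c => ?_
    · by_cases h₁ : c = .mat
      · simp [h₁, hm]
      by_cases h₂ : c = a
      · simp [h₂, ham, ha]
      · simp [h₁, h₂]
    · by_cases h₁ : c = i
      · simp [h₁, hi]
      · simp [h₁]
  | succ k ih =>
    obtain ⟨x, l, rfl⟩ := List.exists_cons_of_ne_nil (l := l) (by rintro rfl; simp at hl; omega)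
    refine (loop_step (means_less _ _ _) (by rw [hi, hj]; omega) (t := 1 + (1 + (5 + 1)))
      (t' := 10 * k + 1) ?_).le (by omega)
    refine .seq (.decr (.seq (.decr (.seq (.pushTop (x := x) (l := l) (by simp [ha]) (.pop ?_))))))
    refine ih (l := l) (l' := x :: l') (m := m - 2) ?_ ?_ ?_ ?_ ?_ ?_ ?_
    · simp [hi]; omega
    · simp [hij.symm, hj]
    · simp [ham, ha]
    · simp [ham.symm, hm]
    · simp at hl; omega
    · omega
    · convert h using 1
      refine Env.ext_stk rfl rfl (fun c => ?_) fun c => ?_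
      · by_cases h₁ : c = .mat
        · simp [h₁]
        by_cases h₂ : c = a
        · simp [h₂, ham, ha]
        · simp [h₁, h₂]
      · by_cases h₁ : c = i
        · simp [h₁]; omega
        · simp [h₁]

theorem powers {w : Word r} {a b : FreeGroup (Fin r)} (ht : E.stk .tmp = [])
    (hw : FreeGroup.IsCyclicallyReduced w) (hne : w ≠ []) (hz : E.stk .z = w)
    (ha : E.stk .ca = a.toWord) (hb : E.stk .cb = b.toWord) :
    WP O powers E (1000 * (a.toWord.length + b.toWord.length + w.length) + 300) fun E' =>
      ∃ k, a.toWord.length + w.length ≤ (wordPow w k).length ∧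
        b.toWord.length + w.length ≤ (wordPow w k).length ∧
        (wordPow w k).length ≤ a.toWord.length + b.toWord.length + 3 * w.length ∧
        E' = ((E.setStk .n (wordPow w k)).setStk .p
          (FreeGroup.mk (wordPow w k) * a * (FreeGroup.mk (wordPow w k))⁻¹).toWord).setStk .q
          (FreeGroup.mk (wordPow w k) * b * (FreeGroup.mk (wordPow w k))⁻¹).toWord := by
  have hr (k : ℕ) : (FreeGroup.mk (wordPow w k)).toWord = wordPow w k :=
    toWord_mk_of_isReduced (isReduced_wordPow hw k)
  have hw₁ : (FreeGroup.mk w).toWord = wordPow w 1 := by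
    rw [toWord_mk_of_isReduced hw.isReduced]; simp [wordPow]
  refine WP.le (.seq (t := 40 * w.length + 6)
    (t' := 950 * (a.toWord.length + b.toWord.length + w.length) + 280) <|
    WP.le (.copyWord (g := .mk w) (by rw [hz, toWord_mk_of_isReduced hw.isReduced]) ht ?_)
      (by rw [hz])) (by omega)
  rw [hw₁]
  refine WP.le (.seq (t := 50 * (a.toWord.length + w.length) + 1)
    (t' := 900 * (a.toWord.length + b.toWord.length + w.length) + 270) <|
    WP.le (.growPower (w := w) (l := a.toWord) (k := 1) (by simpa using ht) hw hne
      (by simpa using hz) (by simp) (by simpa using ha) (by decide) fun k h₁ h₂ h₃ => ?_)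
      (by omega)) (by omega)
  refine WP.le (.seq (t := 50 * (b.toWord.length + w.length) + 1)
    (t' := 850 * (a.toWord.length + b.toWord.length + w.length) + 260) <|
    WP.le (.growPower (w := w) (l := b.toWord) (k := k) (by simpa using ht) hw hne
      (by simpa using hz) (by simp) (by simpa using hb) (by decide) fun k' h₄ h₅ h₆ => ?_)
      (by omega)) (by omega)
  have hk : (k' + 1) * w.length = k' * w.length + w.length := by ring
  rw [one_mul] at h₂ h₃
  refine WP.le (.seq (t := 40 * w.length + 5)
    (t' := 800 * (a.toWord.length + b.toWord.length + w.length) + 250) <|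
    WP.le (.mulLeft (k := .mk w) (g := .mk (wordPow w k')) (by simp [hz])
      (by rw [hr]; simp) (by simpa using ht) ?_) (by simp [hz])) (by omega)
  rw [FreeGroup.mul_mk, ← wordPow_succ]
  have hlen : (FreeGroup.mk (wordPow w (k' + 1))).toWord.length ≤
      a.toWord.length + b.toWord.length + 3 * w.length := by
    rw [hr, length_wordPow]; omega
  refine WP.le (.seq <| .conjugateByPower (x := a) (y := .mk (wordPow w (k' + 1)))
    (by simpa using ht) (by simpa using ha) (by simp only [Env.setStk_stk, if_true]) <|
    .conjugateByPower (x := b) (y := .mk (wordPow w (k' + 1)))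
    (by simpa using ht) (by simpa using hb) (by simp only [Env.setStk_stk, if_true]; simp) ?_) ?_
  · refine ⟨k' + 1, ?_, ?_, ?_, ?_⟩
    · rw [length_wordPow]; omega
    · rw [length_wordPow]; omega
    · rw [length_wordPow]; omega
    · refine Env.ext_stk rfl rfl (fun c => ?_) fun c => rfl
      by_cases h₁ : c = .q
      · simp only [h₁, Env.setStk_stk, if_true]
      by_cases h₂ : c = .p
      · simp [h₂]
      by_cases h₃ : c = .n
      · simp [h₃, hr]
      · simp [h₁, h₂, h₃]
  · omega

theorem halves {P R : Word r} {k l : ℕ} (ht : E.stk .tmp = []) (hp : E.stk .p = P)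
    (hq : E.stk .q = R) (hk : k = (P.length - R.length + 1) / 2)
    (hl : l = (R.length - (P.length - 2 * k) + 1) / 2) :
    WP O halves E (150 * (P.length + R.length) + 200) fun E' =>
      E'.rem = E.rem ∧ SameUpTo [.p, .q, .mat, .c, .c₁, .c₂] [.i, .j] E E' ∧
        E'.stk .c = (FreeGroup.mk (P.take k) * (FreeGroup.mk (R.take l))⁻¹).toWord := by
  refine WP.le (.seq <| .height <| .seq <| .height <| .seq <| .clear <|
    .seq <| .moveHalf (l := P) (l' := []) (m := P.length) (n := R.length) (k := k) (by decide)
      (by decide) (by simp [hp]) (by simp [hq]) (by simp [hp]) (by simp) le_rfl hk <|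
    .seq <| .clear <| .seq <| .moveAll_eq (l := (P.take k).reverse) (l' := []) (by simp) (by simp) <|
    .seq <| .moveHalf (l := R) (l' := []) (m := R.length) (n := P.length - 2 * k) (k := l) (by decide)
      (by decide) (by simp [hq]) (by simp [hp]) (by simp [hq]) (by simp) le_rfl hl <|
    .seq <| .clear <| .seq <| .moveAll_eq (l := (R.take l).reverse) (l' := []) (by simp) (by simp) <|
    .seq <| .clear <|
    .seq <| .divLeft (k := .mk (R.take l)) (g := 1) (by simp) (by simp) (by simp [ht]) <|
    .mulLeft (k := .mk (P.take k)) (g := (.mk (R.take l))⁻¹ * 1) (by simp) (by simp)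
      (by simp [ht]) ?_) ?_
  · refine ⟨by simp, ⟨by simp, fun c hc => ?_, fun c hc => ?_⟩, ?_⟩
    · simp at hc
      simp [hc]
    · simp at hc
      simp [hc]
    · simp only [Env.setStk_stk, if_true, mul_one]
  · simp; omega

/-- Only uniqueness is asserted: a suitable `c'` equals the computed `c`, while its existence is
tested later. By `conjugator_eq_take`, one of the two cuts is empty and the other gives `c'` or its
inverse. -/
theorem candidate {w : Word r} {a b : FreeGroup (Fin r)} (ht : E.stk .tmp = [])
    (hw : FreeGroup.IsCyclicallyReduced w) (hne : w ≠ []) (hz : E.stk .z = w)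
    (ha : E.stk .ca = a.toWord) (hb : E.stk .cb = b.toWord) (hc : ¬ Commute a (FreeGroup.mk w)) :
    WP O candidate E (4000 * (a.toWord.length + b.toWord.length + w.length) + 1000) fun E' =>
      E'.rem = E.rem ∧ SameUpTo [.n, .p, .q, .mat, .c, .c₁, .c₂] [.i, .j] E E' ∧
        ∃ c, E'.stk .c = c.toWord ∧
          c.toWord.length ≤ 20 * (a.toWord.length + b.toWord.length + w.length) ∧
          ∀ c', Commute c' (FreeGroup.mk w) → a * c' = c' * b → c' = c := by
  refine WP.le (.seq (t' := 3000 * (a.toWord.length + b.toWord.length + w.length) + 700) <|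
    (powers ht hw hne hz ha hb).mono le_rfl ?_) (by omega)
  rintro _ ⟨k, h₁, h₂, h₃, rfl⟩
  set N := FreeGroup.mk (wordPow w k) with hN
  have hr : N.toWord = wordPow w k := toWord_mk_of_isReduced (isReduced_wordPow hw k)
  have hlen (x : FreeGroup (Fin r)) : (N * x * N⁻¹).toWord.length ≤
      x.toWord.length + 2 * (wordPow w k).length := by
    have h₁ := length_toWord_mul_le (N * x) N⁻¹
    have h₂ := length_toWord_mul_le N x
    rw [length_toWord_inv] at h₁
    rw [hr] at h₁ h₂
    omega
  have hla := hlen a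
  have hlb := hlen b
  have hlast (x y : Word r) (i j : ℕ) : (FreeGroup.mk (x.take i) *
      (FreeGroup.mk (y.take j))⁻¹).toWord.length ≤ x.length + y.length := by
    refine (length_toWord_mul_le _ _).trans ?_
    rw [length_toWord_inv]
    have h₁ := length_toWord_mk_le (x.take i)
    have h₂ := length_toWord_mk_le (y.take j)
    simp only [List.length_take] at h₁ h₂
    omega
  refine WP.le ((halves (P := (N * a * N⁻¹).toWord) (R := (N * b * N⁻¹).toWord)
    (by simpa using ht) (by simp only [Env.setStk_stk, if_true]; simp)
    (by simp only [Env.setStk_stk, if_true]) rfl rfl).mono le_rfl ?_) (by omega)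
  rintro E₂ ⟨hrem, hs, hc₂⟩
  have hs₁ : SameUpTo [.n, .p, .q, .mat, .c, .c₁, .c₂] [.i, .j] E
      (((E.setStk .n (wordPow w k)).setStk .p (N * a * N⁻¹).toWord).setStk .q
        (N * b * N⁻¹).toWord) := by
    refine ⟨rfl, fun c hc => ?_, fun _ _ => rfl⟩
    simp only [List.mem_cons, List.not_mem_nil, or_false, not_or] at hc
    simp [hc]
  refine ⟨hrem, hs₁.trans (hs.mono (by decide) (by decide)),
    _, hc₂, (hlast _ _ _ _).trans (by omega), fun c hcw hac => ?_⟩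
  rcases conjugator_eq_take hw hne h₁ h₂ hc hcw hac rfl rfl with ⟨i, hi, hci⟩ | ⟨i, hi, hci⟩
  · rw [← hN] at hi hci
    rw [show ((N * a * N⁻¹).toWord.length - (N * b * N⁻¹).toWord.length + 1) / 2 = i by omega,
      hci, show ((N * b * N⁻¹).toWord.length - ((N * a * N⁻¹).toWord.length - 2 * i) + 1) / 2 = 0
        by omega]
    simp [← FreeGroup.one_eq_mk]
  · rw [← hN] at hi hci
    rw [show ((N * a * N⁻¹).toWord.length - (N * b * N⁻¹).toWord.length + 1) / 2 = 0 by omega,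
      show ((N * b * N⁻¹).toWord.length - ((N * a * N⁻¹).toWord.length - 2 * 0) + 1) / 2 = i
        by omega, hci]
    simp [← FreeGroup.one_eq_mk]

end WP

/-! ### Processing a pair -/

/-- Report failure if the stack `a` is not empty. -/
def failIf (a : Stack) : Prog κ := .ite a.nonempty (setCounter .fail 1) .skip

/-- Put the commutator of the words on `a` and `b` on `d`. -/
def commutator (d a b : Stack) : Prog κ :=
  .seq (clear d) (.seq (divLeft d b) (.seq (divLeft d a) (.seq (mulLeft d b) (mulLeft d a))))

/-- Compare the words on `ca` and `cb`. -/
def compareConjugates : Prog κ := .seq (copyWord .d .cb) (.seq (divLeft .d .ca) (failIf .d))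

/-- Check that the word on `c` commutes with that on `z` and conjugates that on `ca` to that on
`cb`. -/
def verify : Prog κ :=
  .seq (commutator .d .c .z) (.seq (failIf .d) (.seq (clear .d) (.seq (mulLeft .d .cb)
    (.seq (mulLeft .d .c) (.seq (divLeft .d .ca) (.seq (divLeft .d .c) (failIf .d)))))))

/-- Compare the word on `c` with the solution on `s`, if there is one, and else store it. -/
def record : Prog κ :=
  .ite Counter.seen.nonzero
    (.ite (Stack.s.notLonger .c) (.seq (copyWord .d .s) (.seq (divLeft .d .c) (failIf .d)))
      (setCounter .fail 1))
    (.seq (copyWord .s .c) (setCounter .seen 1))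

/-- Let `a` and `b` be on `ca` and `cb`. If `a` commutes with `z`, the condition is `a = b`,
whatever `c` is; otherwise at most one `c` is possible. -/
def processCores : Prog κ :=
  .seq (commutator .d .ca .z)
    (.ite Stack.d.nonempty (.seq candidate (.seq verify record)) compareConjugates)

def process : Prog κ :=
  .seq (conjugate .ca .wa .g) (.seq (conjugate .cb .wb .h) processCores)

/-- The value `f'` of the failure flag after a test of `p`, with the value `f` before. -/
def FailUnless (p : Prop) (f f' : ℕ) : Prop := (p ∧ f' = f) ∨ (¬ p ∧ f' = 1)

theorem FailUnless.and {p q : Prop} {f f' f'' : ℕ} (h : FailUnless p f f')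
    (h' : FailUnless q f' f'') : FailUnless (p ∧ q) f f'' := by
  rcases h with ⟨hp, rfl⟩ | ⟨hp, rfl⟩
  · rcases h' with ⟨hq, rfl⟩ | ⟨hq, rfl⟩
    · exact Or.inl ⟨⟨hp, hq⟩, rfl⟩
    · exact Or.inr ⟨fun h => hq h.2, rfl⟩
  · exact Or.inr ⟨fun h => hp h.1, by rcases h' with ⟨-, h⟩ | ⟨-, h⟩ <;> exact h⟩

theorem FailUnless.congr {p q : Prop} {f f' : ℕ} (h : FailUnless p f f') (hpq : p ↔ q) :
    FailUnless q f f' := by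
  simpa only [FailUnless, hpq] using h

/-- The elements of the centralizer of `w` that satisfy `sol`: there is none if `fail` is nonzero,
else all of them do if `seen` is zero, and only `c₀` if `seen` is nonzero. -/
structure Status (w : Word r) (sol : FreeGroup (Fin r) → Prop) (fail seen : ℕ)
    (c₀ : FreeGroup (Fin r)) : Prop where
  failed : fail ≠ 0 → ∀ c, Commute c (FreeGroup.mk w) → ¬ sol c
  unseen : fail = 0 → seen = 0 → c₀ = 1 ∧ ∀ c, Commute c (FreeGroup.mk w) → sol c
  seen : fail = 0 → seen ≠ 0 →
    Commute c₀ (FreeGroup.mk w) ∧ ∀ c, Commute c (FreeGroup.mk w) → (sol c ↔ c = c₀)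

namespace Status

variable {w : Word r} {sol sol' : FreeGroup (Fin r) → Prop} {f f' n : ℕ}
  {c₀ c a b : FreeGroup (Fin r)}

theorem congr (h : Status w sol f n c₀)
    (hs : ∀ c, Commute c (FreeGroup.mk w) → (sol c ↔ sol' c)) : Status w sol' f n c₀ where
  failed hf c hc h' := h.failed hf c hc ((hs c hc).2 h')
  unseen hf hn := ⟨(h.unseen hf hn).1, fun c hc => (hs c hc).1 ((h.unseen hf hn).2 c hc)⟩
  seen hf hn := ⟨(h.seen hf hn).1, fun c hc => (hs c hc).symm.trans ((h.seen hf hn).2 c hc)⟩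

/-- A condition that all elements or no element of the centralizer satisfies. -/
theorem all {p : Prop} (h : Status w sol f n c₀) (hf : FailUnless p f f') :
    Status w (fun c => sol c ∧ p) f' n c₀ := by
  rcases hf with ⟨hp, rfl⟩ | ⟨hp, rfl⟩
  · exact h.congr fun c _ => by simp [hp]
  · exact ⟨fun _ c _ h => hp h.2, fun h => absurd h one_ne_zero, fun h => absurd h one_ne_zero⟩

/-- A condition that only `c` satisfies, when none was seen before. -/
theorem first {p : FreeGroup (Fin r) → Prop} (h : Status w sol f 0 c₀)
    (hu : ∀ c', Commute c' (FreeGroup.mk w) → p c' → c' = c)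
    (hf : FailUnless (Commute c (FreeGroup.mk w) ∧ p c) f f') :
    Status w (fun c => sol c ∧ p c) f' 1 c := by
  rcases hf with ⟨⟨hc, hp⟩, rfl⟩ | ⟨hp, rfl⟩
  · refine ⟨fun hf c hc h' => h.failed hf c hc h'.1, fun _ h => absurd h one_ne_zero, fun hf _ =>
      ⟨hc, fun c' hc' => ⟨fun h' => hu c' hc' h'.2, ?_⟩⟩⟩
    rintro rfl
    exact ⟨(h.unseen hf rfl).2 _ hc, hp⟩
  · refine ⟨fun _ c' hc' h' => hp ?_, fun h => absurd h one_ne_zero, fun h => absurd h one_ne_zero⟩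
    obtain rfl := hu c' hc' h'.2
    exact ⟨hc', h'.2⟩

/-- A condition that only `c` satisfies, when one was seen before. -/
theorem again {p : FreeGroup (Fin r) → Prop} (h : Status w sol f n c₀) (hn : n ≠ 0)
    (hu : ∀ c', Commute c' (FreeGroup.mk w) → p c' → c' = c)
    (hf : FailUnless ((Commute c (FreeGroup.mk w) ∧ p c) ∧ c₀ = c) f f') :
    Status w (fun c => sol c ∧ p c) f' n c₀ := by
  rcases hf with ⟨⟨⟨hc, hp⟩, rfl⟩, rfl⟩ | ⟨hp, rfl⟩
  · refine ⟨fun hf c hc h' => h.failed hf c hc h'.1, fun _ h => absurd h hn, fun hf _ =>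
      ⟨hc, fun c' hc' => ⟨fun h' => hu c' hc' h'.2, ?_⟩⟩⟩
    rintro rfl
    exact ⟨((h.seen hf hn).2 _ hc).2 rfl, hp⟩
  · by_cases hf : f = 0
    · refine ⟨fun _ c' hc' h' => hp ?_, fun h => absurd h one_ne_zero,
        fun h => absurd h one_ne_zero⟩
      obtain rfl := hu c' hc' h'.2
      exact ⟨⟨hc', h'.2⟩, (((h.seen hf hn).2 _ hc').1 h'.1).symm⟩
    · exact ⟨fun _ c hc h' => h.failed hf c hc h'.1, fun h => absurd h one_ne_zero,
        fun h => absurd h one_ne_zero⟩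

end Status

namespace WP

variable {E : Env r} {Q : Env r → Prop}

theorem failIf {a : Stack} {x : FreeGroup (Fin r)} (ha : E.stk a = x.toWord)
    (h : ∀ f, FailUnless (x = 1) (E.cnt .fail) f → Q (E.setCnt .fail f)) :
    WP O (failIf a) E 3 Q := by
  refine .ite (means_nonempty a E) (t := 1) (t' := 1) (fun hne => .setCounter ?_) fun he => .skip ?_
  · rw [ha, Ne, FreeGroup.toWord_eq_nil_iff] at hne
    exact h 1 (Or.inr ⟨hne, rfl⟩)
  · rw [not_not, ha, FreeGroup.toWord_eq_nil_iff] at he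
    convert h _ (Or.inl ⟨he, rfl⟩) using 1
    exact Env.ext_stk rfl rfl (fun _ => rfl) fun c => by simp +contextual

theorem commutator {d a b : Stack} {x y : FreeGroup (Fin r)} (ht : E.stk .tmp = [])
    (ha : E.stk a = x.toWord) (hb : FreeGroup.mk (E.stk b) = y)
    (h : Q (E.setStk d (x * y * x⁻¹ * y⁻¹).toWord)) (hda : d ≠ a := by decide)
    (hdb : d ≠ b := by decide) (hd : d ≠ .tmp := by decide) (hat : a ≠ .tmp := by decide)
    (hbt : b ≠ .tmp := by decide) :
    WP O (commutator d a b) E (80 * x.toWord.length + 80 * (E.stk b).length + 30) Q := by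
  refine WP.le (.seq <| .clear <| .seq <|
    .divLeft (k := y) (g := 1) (by simp [hdb.symm, hb]) (by simp) (by simp [hd.symm, ht])
    (.seq <| .divLeft (k := x) (g := y⁻¹ * 1) (by simp [hda.symm, ha, FreeGroup.mk_toWord])
      (by simp) (by simp [hd.symm, ht])
    (.seq <| .mulLeft (k := y) (g := x⁻¹ * (y⁻¹ * 1)) (by simp [hdb.symm, hb])
      (by simp) (by simp [hd.symm, ht])
    (.mulLeft (k := x) (g := y * (x⁻¹ * (y⁻¹ * 1)))
      (by simp [hda.symm, ha, FreeGroup.mk_toWord]) (by simp) (by simp [hd.symm, ht]) ?_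
    hda hd hat) hdb hd hbt) hda hd hat) hdb hd hbt) ?_
  · convert h using 1
    refine Env.ext_stk rfl rfl (fun c => ?_) fun c => rfl
    by_cases hc : c = d
    · simp only [hc, Env.setStk_stk, if_true, mul_assoc, mul_one]
    · simp [hc]
  · simp [hda.symm, hdb.symm, ha]; omega

variable {a b c : FreeGroup (Fin r)} {w : Word r}

theorem compareConjugates (ht : E.stk .tmp = []) (ha : E.stk .ca = a.toWord)
    (hb : E.stk .cb = b.toWord) :
    WP O compareConjugates E (100 * (a.toWord.length + b.toWord.length) + 50) fun E' =>
      E'.rem = E.rem ∧ SameUpTo [.d] [.fail] E E' ∧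
        FailUnless (a = b) (E.cnt .fail) (E'.cnt .fail) := by
  refine WP.le (.seq <| .copyWord hb ht <| .seq <|
    .divLeft (k := a) (g := b) (by simp [ha, FreeGroup.mk_toWord]) (by simp) (by simp [ht]) <|
    .failIf (x := a⁻¹ * b) (by simp only [Env.setStk_stk, if_true]) fun f hf => ?_) ?_
  · refine ⟨rfl, ⟨rfl, fun c hc => ?_, fun c hc => ?_⟩, ?_⟩
    · simp at hc; simp [hc]
    · simp at hc; simp [hc]
    · simpa using hf.congr inv_mul_eq_one
  · simp [ha, hb]; omega

theorem verify (ht : E.stk .tmp = []) (ha : E.stk .ca = a.toWord)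
    (hb : E.stk .cb = b.toWord) (hc : E.stk .c = c.toWord) (hz : E.stk .z = w) :
    WP O verify E (200 * (a.toWord.length + b.toWord.length + c.toWord.length + w.length) + 100)
      fun E' => E'.rem = E.rem ∧ SameUpTo [.d] [.fail] E E' ∧
        FailUnless (Commute c (FreeGroup.mk w) ∧ a * c = c * b) (E.cnt .fail) (E'.cnt .fail) := by
  refine WP.le (.seq <| .commutator (x := c) (y := .mk w) ht hc (by rw [hz]) <| .seq <|
    .failIf (x := c * .mk w * c⁻¹ * (.mk w)⁻¹) (by simp only [Env.setStk_stk, if_true])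
    fun f hf => .seq (t' := 200 * a.toWord.length + 50 * b.toWord.length + 85 * c.toWord.length + 40)
    <| .clear <| WP.le (.seq <|
    .mulLeft (k := b) (g := 1) (by simp [hb, FreeGroup.mk_toWord]) (by simp) (by simp [ht]) <| .seq <|
    .mulLeft (k := c) (g := b * 1) (by simp [hc, FreeGroup.mk_toWord]) (by simp) (by simp [ht]) <|
    .seq <| .divLeft (k := a) (g := c * (b * 1)) (by simp [ha, FreeGroup.mk_toWord]) (by simp)
      (by simp [ht]) <|
    .seq <| .divLeft (k := c) (g := a⁻¹ * (c * (b * 1))) (by simp [hc, FreeGroup.mk_toWord])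
      (by simp) (by simp [ht]) <|
    .failIf (x := c⁻¹ * (a⁻¹ * (c * (b * 1)))) (by simp only [Env.setStk_stk, if_true])
    fun f' hf' => ?_) ?_) ?_
  · refine ⟨rfl, ⟨rfl, fun c hc => ?_, fun c hc => ?_⟩, ?_⟩
    · simp at hc; simp [hc]
    · simp at hc; simp [hc]
    · refine ((hf.and (f'' := f') (by simpa using hf')).congr (and_congr ?_ ?_))
      · rw [mul_inv_eq_one, mul_inv_eq_iff_eq_mul]; rfl
      · rw [inv_mul_eq_one, eq_inv_mul_iff_mul_eq]
  · simp [ha, hb, hc]; omega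
  · simp [hz]; omega

/-- The stored solution may be much longer than the current pair. Comparing the heights first bounds
the cost by the length of `c`: a longer stored word cannot equal `c`. -/
theorem record {c₀ : FreeGroup (Fin r)} (ht : E.stk .tmp = []) (hc : E.stk .c = c.toWord)
    (hs : E.stk .s = c₀.toWord) :
    WP O record E (200 * c.toWord.length + 100) fun E' =>
      E'.rem = E.rem ∧ SameUpTo [.d, .s] [.fail, .seen] E E' ∧
        ((E.cnt .seen ≠ 0 ∧ E'.stk .s = c₀.toWord ∧ E'.cnt .seen = E.cnt .seen ∧
          FailUnless (c₀ = c) (E.cnt .fail) (E'.cnt .fail)) ∨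
        (E.cnt .seen = 0 ∧ E'.stk .s = c.toWord ∧ E'.cnt .seen = 1 ∧
          E'.cnt .fail = E.cnt .fail)) := by
  refine WP.le (.ite (means_nonzero _ _) (t := 100 * c.toWord.length + 50)
    (t' := 50 * c.toWord.length + 20) (fun h => ?_) fun h => ?_) (by omega)
  · refine WP.le (.ite (means_notLonger _ _ _) (t := 80 * c.toWord.length + 40) (t' := 1)
      (fun hl => ?_) fun hl => .setCounter ?_) (by omega)
    · rw [hs, hc] at hl
      refine WP.le (.seq <| .copyWord hs ht <| .seq <|
        .divLeft (k := c) (g := c₀) (by simp [hc, FreeGroup.mk_toWord]) (by simp) (by simp [ht]) <|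
        .failIf (x := c⁻¹ * c₀) (by simp only [Env.setStk_stk, if_true]) fun f hf => ?_) ?_
      · refine ⟨rfl, ⟨rfl, fun c hc => ?_, fun c hc => ?_⟩,
          Or.inl ⟨h, by simp [hs], by simp, ?_⟩⟩
        · simp at hc; simp [hc]
        · simp at hc; simp [hc]
        · simpa using hf.congr (inv_mul_eq_one.trans eq_comm)
      · simp [hs, hc]; omega
    · rw [hs, hc] at hl
      refine ⟨rfl, ⟨rfl, fun c hc => rfl, fun c hc => ?_⟩,
          Or.inl ⟨h, by simp [hs], by simp, Or.inr ⟨?_, by simp⟩⟩⟩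
      · simp at hc; simp [hc]
      · rintro rfl; exact hl le_rfl
  · refine WP.le (.seq <| .copyWord hc ht <| .setCounter ?_) ?_
    · refine ⟨rfl, ⟨rfl, fun c hc => ?_, fun c hc => ?_⟩, Or.inr ⟨not_not.1 h, by simp⟩⟩
      · simp at hc; simp [hc]
      · simp at hc; simp [hc]
    · simp [hc]; omega

/-- The stacks that `process` changes. -/
def processStacks : List Stack := [.n, .p, .q, .mat, .c, .c₁, .c₂, .d, .s, .ca, .cb]

theorem processCores {c₀ : FreeGroup (Fin r)} {sol : FreeGroup (Fin r) → Prop}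
    (ht : E.stk .tmp = []) (hw : FreeGroup.IsCyclicallyReduced w) (hne : w ≠ [])
    (hz : E.stk .z = w) (ha : E.stk .ca = a.toWord) (hb : E.stk .cb = b.toWord)
    (hs : E.stk .s = c₀.toWord) (hsol : Status w sol (E.cnt .fail) (E.cnt .seen) c₀) :
    WP O processCores E (20000 * (a.toWord.length + b.toWord.length + w.length) + 3000) fun E' =>
      E'.rem = E.rem ∧ SameUpTo processStacks [.i, .j, .fail, .seen] E E' ∧
        ∃ c₁, E'.stk .s = c₁.toWord ∧ c₁.toWord.length ≤ c₀.toWord.length +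
            20 * (a.toWord.length + b.toWord.length + w.length) ∧
          Status w (fun c => sol c ∧ a * c = c * b) (E'.cnt .fail) (E'.cnt .seen) c₁ := by
  refine WP.le (.seq (t' := 19000 * (a.toWord.length + b.toWord.length + w.length) + 2500) <|
    .commutator (x := a) (y := .mk w) ht ha (by rw [hz]) ?_) (by rw [hz]; omega)
  have hs₀ : SameUpTo processStacks [.i, .j, .fail, .seen] E
      (E.setStk .d (a * .mk w * a⁻¹ * (.mk w)⁻¹).toWord) := by
    refine ⟨rfl, fun c hc => ?_, fun _ _ => rfl⟩
    have h : c ≠ .d := fun h => hc (h ▸ by decide)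
    simp [h]
  have hcomm : a * .mk w * a⁻¹ * (.mk w)⁻¹ = 1 ↔ Commute a (.mk w) := by
    rw [mul_inv_eq_one, mul_inv_eq_iff_eq_mul]; rfl
  generalize hE : E.setStk .d (a * .mk w * a⁻¹ * (.mk w)⁻¹).toWord = E₀ at hs₀
  have ht₀ : E₀.stk .tmp = [] := by simp [← hE, ht]
  have hz₀ : E₀.stk .z = w := by simp [← hE, hz]
  have ha₀ : E₀.stk .ca = a.toWord := by simp [← hE, ha]
  have hb₀ : E₀.stk .cb = b.toWord := by simp [← hE, hb]
  have hc₀ : E₀.stk .s = c₀.toWord := by simp [← hE, hs]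
  have hd₀ : E₀.stk .d ≠ [] ↔ ¬ Commute a (.mk w) := by
    rw [← hE, ← hcomm]
    simp only [Env.setStk_stk, if_true, Ne, FreeGroup.toWord_eq_nil_iff]
  have hf₀ : E₀.cnt = E.cnt := by simp [← hE]
  have hr₀ : E₀.rem = E.rem := by simp [← hE]
  refine WP.le (.ite (means_nonempty _ _)
    (t := 15000 * (a.toWord.length + b.toWord.length + w.length) + 2000)
    (t' := 100 * (a.toWord.length + b.toWord.length) + 50) (fun h => ?_) fun h => ?_) (by omega)
  · rw [hd₀] at h
    refine WP.le (.seq (t' := 10000 * (a.toWord.length + b.toWord.length + w.length) + 500) <|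
      (candidate ht₀ hw hne hz₀ ha₀ hb₀ h).mono le_rfl ?_) (by omega)
    rintro E₁ ⟨hr₁, hs₁, c, hc₁, hcl, hu⟩
    have ht₁ : E₁.stk .tmp = [] := by rw [hs₁.stk _ (by decide), ht₀]
    refine WP.le (.seq (t' := 4000 * (a.toWord.length + b.toWord.length + w.length) + 100) <|
      (verify (a := a) (b := b) (c := c) (w := w) ht₁ (by rw [hs₁.stk _ (by decide), ha₀])
        (by rw [hs₁.stk _ (by decide), hb₀]) hc₁ (by rw [hs₁.stk _ (by decide), hz₀])).mono
        le_rfl ?_) (by omega)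
    rintro E₂ ⟨hr₂, hs₂, hf₂⟩
    refine WP.le ((record (c := c) (c₀ := c₀) (by rw [hs₂.stk _ (by decide), ht₁])
      (by rw [hs₂.stk _ (by decide), hc₁])
      (by rw [hs₂.stk _ (by decide), hs₁.stk _ (by decide), hc₀])).mono le_rfl ?_) (by omega)
    rintro E₃ ⟨hr₃, hs₃, h₃⟩
    have hseen : E₂.cnt .seen = E.cnt .seen := by
      rw [hs₂.cnt _ (by decide), hs₁.cnt _ (by decide), hf₀]
    rw [hs₁.cnt .fail (by decide), hf₀] at hf₂
    refine ⟨by rw [hr₃, hr₂, hr₁, hr₀], hs₀.trans ((hs₁.mono (by decide) (by decide)).trans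
      ((hs₂.mono (by decide) (by decide)).trans (hs₃.mono (by decide) (by decide)))), ?_⟩
    rw [hseen] at h₃
    rcases h₃ with ⟨hn, hs', hn', hf⟩ | ⟨hn, hs', hn', hf⟩
    · rw [hn']
      exact ⟨c₀, hs', Nat.le_add_right _ _, hsol.again hn hu (hf₂.and hf)⟩
    · rw [hn', hf]
      rw [hn] at hsol
      exact ⟨c, hs', by omega, hsol.first hu hf₂⟩
  · rw [hd₀, not_not] at h
    refine (compareConjugates ht₀ ha₀ hb₀).mono le_rfl ?_
    rintro E₁ ⟨hr₁, hs₁, hf₁⟩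
    refine ⟨by rw [hr₁, hr₀], hs₀.trans (hs₁.mono (by decide) (by decide)), c₀,
      by rw [hs₁.stk _ (by decide), hc₀], Nat.le_add_right _ _, ?_⟩
    rw [hs₁.cnt .seen (by decide), hf₀]
    rw [hf₀] at hf₁
    refine (hsol.all hf₁).congr fun c hc => and_congr_right fun _ => ?_
    -- Here `a` commutes with all of the centralizer, so `a * c = c * b` amounts to `a = b`.
    rw [(commute_of_commute hw hne h hc).eq, mul_right_inj]

theorem process {c₀ A B G H : FreeGroup (Fin r)} {sol : FreeGroup (Fin r) → Prop}
    (ht : E.stk .tmp = []) (hw : FreeGroup.IsCyclicallyReduced w) (hne : w ≠ [])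
    (hz : E.stk .z = w) (ha : E.stk .wa = A.toWord) (hb : E.stk .wb = B.toWord)
    (hg : E.stk .g = G.toWord) (hh : E.stk .h = H.toWord)
    (hs : E.stk .s = c₀.toWord) (hsol : Status w sol (E.cnt .fail) (E.cnt .seen) c₀) :
    WP O process E (50000 * (A.toWord.length + B.toWord.length + G.toWord.length + H.toWord.length +
        w.length) + 4000) fun E' =>
      E'.rem = E.rem ∧ SameUpTo processStacks [.i, .j, .fail, .seen] E E' ∧
        ∃ c₁, E'.stk .s = c₁.toWord ∧ c₁.toWord.length ≤ c₀.toWord.length + 40 * (A.toWord.length +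
            B.toWord.length + G.toWord.length + H.toWord.length + w.length) ∧
          Status w (fun c => sol c ∧ G⁻¹ * A * G * c = c * (H⁻¹ * B * H))
            (E'.cnt .fail) (E'.cnt .seen) c₁ := by
  have hlen (x y : FreeGroup (Fin r)) : (y⁻¹ * x * y).toWord.length ≤
      x.toWord.length + 2 * y.toWord.length := by
    have h₁ := length_toWord_mul_le (y⁻¹ * x) y
    have h₂ := length_toWord_mul_le y⁻¹ x
    rw [length_toWord_inv] at h₂
    omega
  have hla := hlen A G
  have hlb := hlen B H
  refine WP.le (.seq <| .conjugate (x := A) (y := G) ht ha hg <| .seq <|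
    .conjugate (x := B) (y := H) (by simp [ht]) (by simp [hb]) (by simp [hh]) ?_)
      (t := (80 * G.toWord.length + 40 * A.toWord.length + 20) +
        ((80 * H.toWord.length + 40 * B.toWord.length + 20) + (20000 * ((G⁻¹ * A * G).toWord.length +
      (H⁻¹ * B * H).toWord.length + w.length) + 3000))) (by omega)
  refine (processCores (a := G⁻¹ * A * G) (b := H⁻¹ * B * H) (w := w) (c₀ := c₀) (sol := sol)
      (by simp [ht]) hw hne (by simp [hz]) (by simp only [Env.setStk_stk, if_true]; simp)
      (by simp only [Env.setStk_stk, if_true]) (by simp [hs]) (by exact hsol)).mono le_rfl ?_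
  rintro E₁ ⟨hr, hs₁, c₁, h₁, h₂, h⟩
  refine ⟨hr, SameUpTo.trans (E₂ := (E.setStk .ca (G⁻¹ * A * G).toWord).setStk .cb
    (H⁻¹ * B * H).toWord) ⟨rfl, fun c hc => ?_, fun _ _ => rfl⟩ hs₁, c₁, h₁, by omega, h⟩
  have h₁ : c ≠ .ca := fun h => hc (h ▸ by decide)
  have h₂ : c ≠ .cb := fun h => hc (h ▸ by decide)
  simp [h₁, h₂]

end WP

/-! ### Passing through the input -/

/-- The symbols of the input that describes a system. -/
def symbols (S : List (Word r × Word r)) : List (Option (Letter r)) :=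
  S.flatMap fun e => e.1.map some ++ none :: (e.2.map some ++ [none])

theorem symbols_cons (e : Word r × Word r) (S : List (Word r × Word r)) :
    symbols (e :: S) = e.1.map some ++ none :: (e.2.map some ++ none :: symbols S) := by
  simp [symbols]

theorem length_symbols_cons (e : Word r × Word r) (S : List (Word r × Word r)) :
    (symbols (e :: S)).length = e.1.length + e.2.length + 2 + (symbols S).length := by
  simp [symbols_cons]; omega

theorem encodeSystem_eq (S : List (Word r × Word r)) :
    encodeSystem S = (symbols S).map encodeSymbol := by
  induction S with
  | nil => rfl
  | cons e S ih =>
    rw [symbols_cons]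
    simp only [encodeSystem, encodeWords, encodeWord, List.flatMap_cons, List.flatMap_append,
      List.flatMap_nil, List.map_append, List.map_cons, List.map_map, ← ih, encodeSymbol]
    simp [Function.comp_def, encodeSymbol]

/-- The element `x` of the free group solves the system `S`. -/
def Solves (S : List (Word r × Word r)) (x : FreeGroup (Fin r)) : Prop :=
  ∀ e ∈ S, x⁻¹ * FreeGroup.mk e.1 * x = FreeGroup.mk e.2

/-- Put the inverses of the next two words on `wa` and `wb`. -/
def readPair : Prog κ :=
  .seq (setCounter .len 0) (.seq (clear .wa) (.seq (readInv .wa) (.seq (clear .wb) (readInv .wb))))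

/-- Keep the pair on `wa` and `wb`. -/
def keepPair : Prog κ :=
  .seq (copyWord .u .wa) (.seq (copyWord .v .wb) (copyCounter .best .len))

/-- An empty `u` means that no pair is kept yet, since kept words are nontrivial. Pairs are compared
by `len`, the number of letters before reduction, as the input size counts these. -/
def selectStep : Prog κ :=
  .seq readPair (.ite Stack.wa.nonempty
    (.ite Stack.wb.nonempty
      (.ite Stack.u.nonempty (.ite (Counter.len.less .best) keepPair .skip) keepPair)
      (setCounter .fail 1))
    (failIf .wb))

/-- Put the inverses of a shortest pair of nontrivial words on `u` and `v`. -/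
def selectPair : Prog κ := .loop inputNonempty selectStep

/-- Process all pairs of nontrivial words. -/
def processAll : Prog κ :=
  .loop inputNonempty (.seq readPair (.ite Stack.wa.nonempty process .skip))

/-- The result of `selectPair`. -/
def Selected (S : List (Word r × Word r)) (E : Env r) : Prop :=
  (E.cnt .fail ≠ 0 ∧ ∃ e ∈ S, ¬ (FreeGroup.mk e.1 = 1 ↔ FreeGroup.mk e.2 = 1)) ∨
  (E.cnt .fail = 0 ∧ (∀ e ∈ S, FreeGroup.mk e.1 = 1 ↔ FreeGroup.mk e.2 = 1) ∧
    ((E.stk .u = [] ∧ ∀ e ∈ S, FreeGroup.mk e.1 = 1) ∨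
      ∃ e ∈ S, FreeGroup.mk e.1 ≠ 1 ∧ E.stk .u = (FreeGroup.mk e.1)⁻¹.toWord ∧
        E.stk .v = (FreeGroup.mk e.2)⁻¹.toWord ∧ E.cnt .best = e.1.length + e.2.length ∧
        ∀ e' ∈ S, FreeGroup.mk e'.1 ≠ 1 → E.cnt .best ≤ e'.1.length + e'.2.length))

theorem inv_toWord_eq_nil {x : FreeGroup (Fin r)} : x⁻¹.toWord = [] ↔ x = 1 := by
  rw [FreeGroup.toWord_eq_nil_iff, inv_eq_one]

theorem length_inv_mk_le (w : Word r) : (FreeGroup.mk w)⁻¹.toWord.length ≤ w.length := by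
  rw [length_toWord_inv]; exact length_toWord_mk_le w

/-- This passes between the equation for `x = G * c * H⁻¹` and the equation for `c` that `process`
treats, with the inverses `u⁻¹` and `v⁻¹` that the stacks hold. -/
theorem conj_eq_iff {G H c u v : FreeGroup (Fin r)} :
    G⁻¹ * u⁻¹ * G * c = c * (H⁻¹ * v⁻¹ * H) ↔ (G * c * H⁻¹)⁻¹ * u * (G * c * H⁻¹) = v := by
  constructor
  · intro h
    have hv : v⁻¹ = H * c⁻¹ * (c * (H⁻¹ * v⁻¹ * H)) * H⁻¹ := by group
    rw [← inv_inj, hv, ← h]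
    group
  · rintro rfl
    group

namespace WP

variable {E : Env r} {Q : Env r → Prop} {e : Word r × Word r} {S D : List (Word r × Word r)}

theorem readPair (ht : E.stk .tmp = []) (hr : E.rem = symbols (e :: S))
    (h : ∀ E', SameUpTo [.wa, .wb] [.len] E E' → E'.rem = symbols S →
      E'.stk .wa = (FreeGroup.mk e.1)⁻¹.toWord → E'.stk .wb = (FreeGroup.mk e.2)⁻¹.toWord →
      E'.cnt .len = e.1.length + e.2.length → Q E') :
    WP O readPair E (30 * (e.1.length + e.2.length) + 9) Q := by
  rw [symbols_cons] at hr
  refine WP.le (.seq <| .setCounter <| .seq <| .clear <| .seq <|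
    .readInv (g := 1) (w := e.1) (k := e.2.map some ++ none :: symbols S) (by simp) (by simp [ht])
      (by simp [hr]) <| .seq <| .clear <|
    .readInv (g := 1) (w := e.2) (k := symbols S) (by simp) (by simp [ht]) (by simp) ?_) (by omega)
  refine h _ ⟨rfl, fun c hc => ?_, fun c hc => ?_⟩ rfl ?_ ?_ (by simp)
  · simp at hc; simp [hc]
  · simp at hc; simp [hc]
  · simp only [mul_one, Env.setCnt_stk, Env.setRem_stk, Env.setStk_stk, if_true]; simp
  · simp only [mul_one, Env.setCnt_stk, Env.setRem_stk, Env.setStk_stk, if_true]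

theorem keepPair {a b : FreeGroup (Fin r)} (ht : E.stk .tmp = []) (ha : E.stk .wa = a.toWord)
    (hb : E.stk .wb = b.toWord)
    (h : Q (((E.setStk .u a.toWord).setStk .v b.toWord).setCnt .best (E.cnt .len))) :
    WP O keepPair E (40 * (a.toWord.length + b.toWord.length) + 13) Q :=
  WP.le (.seq <| .copyWord ha ht <| .seq <| .copyWord (g := b) (by simp [hb]) (by simp [ht]) <|
    .copyCounter h) (by simp [ha, hb]; omega)

theorem selectStep (ht : E.stk .tmp = []) (hr : E.rem = symbols (e :: S)) (hD : Selected D E) :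
    WP O selectStep E (200 * (e.1.length + e.2.length) + 100) fun E' => E'.rem = symbols S ∧
      SameUpTo [.wa, .wb, .u, .v] [.len, .best, .fail] E E' ∧ Selected (D ++ [e]) E' := by
  refine WP.le (.seq (t' := 100 * (e.1.length + e.2.length) + 60) <| .readPair ht hr
    fun E' hs hr' ha hb hl => ?_) (by omega)
  have ht' : E'.stk .tmp = [] := by rw [hs.stk _ (by decide), ht]
  have hD' : Selected D E' := by
    simpa only [Selected, hs.cnt .fail (by decide), hs.cnt .best (by decide), hs.stk .u (by decide),
      hs.stk .v (by decide)] using hD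
  have hs' : SameUpTo [.wa, .wb, .u, .v] [.len, .best, .fail] E E' :=
    hs.mono (by decide) (by decide)
  have hfail (h : ¬ (FreeGroup.mk e.1 = 1 ↔ FreeGroup.mk e.2 = 1)) :
      Selected (D ++ [e]) (E'.setCnt .fail 1) :=
    Or.inl ⟨by simp, e, by simp, h⟩
  have hsf : SameUpTo [.wa, .wb, .u, .v] [.len, .best, .fail] E (E'.setCnt .fail 1) := by
    refine hs'.trans ⟨rfl, fun _ _ => rfl, fun c hc => ?_⟩
    simp only [List.mem_cons, List.not_mem_nil, or_false, not_or] at hc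
    simp [hc]
  have hiff (h : ∀ e ∈ D, FreeGroup.mk e.1 = 1 ↔ FreeGroup.mk e.2 = 1)
      (he : FreeGroup.mk e.1 = 1 ↔ FreeGroup.mk e.2 = 1) :
      ∀ e' ∈ D ++ [e], FreeGroup.mk e'.1 = 1 ↔ FreeGroup.mk e'.2 = 1 :=
    List.forall_mem_append.2 ⟨h, List.forall_mem_singleton.2 he⟩
  have hfailed (h : E'.cnt .fail ≠ 0) (E'' : Env r) (h'' : E''.cnt .fail = E'.cnt .fail) :
      Selected (D ++ [e]) E'' := by
    rcases hD' with ⟨-, e', he', h'⟩ | ⟨h', -⟩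
    · exact Or.inl ⟨by rwa [h''], e', by simp [he'], h'⟩
    · exact absurd h' h
  refine WP.le (.ite (means_nonempty _ _) (t := 90 * (e.1.length + e.2.length) + 40) (t' := 3)
    (fun h₁ => ?_) fun h₁ => ?_) (by omega)
  · rw [ha, Ne, inv_toWord_eq_nil] at h₁
    refine WP.le (.ite (means_nonempty _ _) (t := 80 * (e.1.length + e.2.length) + 30) (t' := 1)
      (fun h₂ => ?_) fun h₂ => .setCounter ⟨hr', hsf, hfail fun h => ?_⟩) (by omega)
    · rw [hb, Ne, inv_toWord_eq_nil] at h₂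
      have hkeep (hmin : E'.cnt .fail = 0 → ∀ e' ∈ D, FreeGroup.mk e'.1 ≠ 1 →
          e.1.length + e.2.length ≤ e'.1.length + e'.2.length) :
          WP O FreeConj.keepPair E' (40 * (e.1.length + e.2.length) + 13) fun E' =>
            E'.rem = symbols S ∧ SameUpTo [.wa, .wb, .u, .v] [.len, .best, .fail] E E' ∧
              Selected (D ++ [e]) E' := by
        have hl₁ := length_inv_mk_le e.1
        have hl₂ := length_inv_mk_le e.2
        refine WP.le (.keepPair ht' ha hb ⟨hr', hs'.trans ⟨rfl, fun c hc => ?_, fun c hc => ?_⟩, ?_⟩)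
          (by omega)
        · simp only [List.mem_cons, List.not_mem_nil, or_false, not_or] at hc
          simp [hc]
        · simp only [List.mem_cons, List.not_mem_nil, or_false, not_or] at hc
          simp [hc]
        by_cases hf : E'.cnt .fail = 0
        · rcases hD' with ⟨h, -⟩ | ⟨-, h, -⟩
          · exact absurd hf h
          refine Or.inr ⟨by simp [hf], ?_, Or.inr ⟨e, by simp, h₁, by simp, by simp, by simp [hl], ?_⟩⟩
          · exact hiff h (by simp [h₁, h₂])
          · rw [List.forall_mem_append, List.forall_mem_singleton]
            simpa [hl] using hmin hf
        · exact hfailed hf _ (by simp)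
      refine WP.le (.ite (means_nonempty _ _) (t := 40 * (e.1.length + e.2.length) + 15)
        (t' := 40 * (e.1.length + e.2.length) + 13)
        (fun h₃ => ?_) fun h₃ => hkeep fun hf e' he' hne => ?_) ?_
      · refine WP.le (.ite (means_less _ _ _) (t' := 1) (fun h₄ => hkeep fun hf e' he' hne => ?_)
          fun h₄ => .skip ⟨hr', hs', ?_⟩) (by omega)
        · rcases hD' with ⟨h, -⟩ | ⟨-, -, ⟨h, -⟩ | ⟨-, -, -, -, -, -, h⟩⟩
          · exact absurd hf h
          · exact absurd h h₃
          · have := h e' he' hne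
            omega
        · by_cases hf : E'.cnt .fail = 0
          · rcases hD' with ⟨h, -⟩ | ⟨-, h, ⟨h', -⟩ | ⟨e', he', k₁, k₂, k₃, k₄, k₅⟩⟩
            · exact absurd hf h
            · exact absurd h' h₃
            · refine Or.inr ⟨hf, ?_, Or.inr ⟨e', by simp [he'], k₁, k₂, k₃, k₄, ?_⟩⟩
              · exact hiff h (by simp [h₁, h₂])
              · rw [List.forall_mem_append, List.forall_mem_singleton]
                exact ⟨k₅, fun _ => by omega⟩
          · exact hfailed hf _ rfl
      · rw [not_not] at h₃
        rcases hD' with ⟨h, -⟩ | ⟨-, -, ⟨-, h⟩ | ⟨e₁, -, h, h', -⟩⟩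
        · exact absurd hf h
        · exact absurd (h e' he') hne
        · exact absurd (inv_toWord_eq_nil.1 (h'.symm.trans h₃)) h
      · omega
    · rw [not_not, hb, inv_toWord_eq_nil] at h₂
      exact h₁ (h.2 h₂)
  · rw [not_not, ha, inv_toWord_eq_nil] at h₁
    refine .failIf hb fun f hf => ?_
    rcases hf with ⟨h₂, rfl⟩ | ⟨h₂, rfl⟩
    · rw [inv_eq_one] at h₂
      have : E'.setCnt .fail (E'.cnt .fail) = E' :=
        Env.ext_stk rfl rfl (fun _ => rfl) fun c => by simp +contextual
      rw [this]
      refine ⟨hr', hs', ?_⟩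
      by_cases hf : E'.cnt .fail = 0
      · rcases hD' with ⟨h, -⟩ | ⟨-, h, h'⟩
        · exact absurd hf h
        refine Or.inr ⟨hf, hiff h (by simp [h₁, h₂]), h'.imp ?_ ?_⟩
        · rintro ⟨k₁, k₂⟩
          exact ⟨k₁, List.forall_mem_append.2 ⟨k₂, List.forall_mem_singleton.2 h₁⟩⟩
        · rintro ⟨e', he', k₁, k₂, k₃, k₄, k₅⟩
          refine ⟨e', by simp [he'], k₁, k₂, k₃, k₄, ?_⟩
          rw [List.forall_mem_append, List.forall_mem_singleton]
          exact ⟨k₅, fun h => absurd h₁ h⟩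
      · exact hfailed hf _ rfl
    · rw [inv_eq_one] at h₂
      exact ⟨hr', hsf, hfail fun h => h₂ (h.1 h₁)⟩

theorem selectPair (ht : E.stk .tmp = []) (hr : E.rem = symbols S) (hD : Selected D E) :
    WP O selectPair E (200 * (symbols S).length + 1) fun E' =>
      SameUpTo [.wa, .wb, .u, .v] [.len, .best, .fail] E E' ∧ Selected (D ++ S) E' := by
  induction S generalizing E D with
  | nil =>
    refine loop_done (means_inputNonempty _) (by simp [hr, symbols]) ⟨.refl _, by simpa using hD⟩
  | cons e S ih =>
    refine (loop_step (means_inputNonempty _) (by simp [hr, symbols_cons])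
      (t' := 200 * (symbols S).length + 1)
      ((selectStep ht hr hD).mono le_rfl ?_)).le (by rw [length_symbols_cons]; omega)
    rintro E' ⟨hr', hs, hD'⟩
    refine (ih (by rw [hs.stk _ (by decide), ht]) hr' hD').mono le_rfl ?_
    rintro E'' ⟨hs', hD''⟩
    exact ⟨hs.trans hs', by simpa using hD''⟩

/-- The bound `hl` comes from the minimality of the chosen pair; the factor `7` adds `4` for the
conjugator and `3` for `w`. Without it every pair could cost as much as the whole input. The stored
word grows by at most a multiple of the size of each pair, so its length stays linear too. -/
theorem processAll {w : Word r} {c₀ G H : FreeGroup (Fin r)} {sol : FreeGroup (Fin r) → Prop}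
    (ht : E.stk .tmp = []) (hr : E.rem = symbols S)
    (hw : FreeGroup.IsCyclicallyReduced w) (hne : w ≠ [])
    (hz : E.stk .z = w) (hg : E.stk .g = G.toWord) (hh : E.stk .h = H.toWord)
    (hs : E.stk .s = c₀.toWord) (hsol : Status w sol (E.cnt .fail) (E.cnt .seen) c₀)
    (hS : ∀ e ∈ S, FreeGroup.mk e.1 = 1 ↔ FreeGroup.mk e.2 = 1)
    (hl : ∀ e ∈ S, FreeGroup.mk e.1 ≠ 1 → G.toWord.length + H.toWord.length + w.length ≤
      7 * (e.1.length + e.2.length)) :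
    WP O processAll E (500000 * (symbols S).length + 1) fun E' =>
      E'.stk .tmp = [] ∧ E'.stk .g = G.toWord ∧ E'.stk .h = H.toWord ∧
        ∃ c₁, E'.stk .s = c₁.toWord ∧ c₁.toWord.length ≤ c₀.toWord.length +
            400 * (symbols S).length ∧
          Status w (fun c => sol c ∧ Solves S (G * c * H⁻¹)) (E'.cnt .fail) (E'.cnt .seen) c₁ := by
  induction S generalizing E sol c₀ with
  | nil =>
    refine loop_done (means_inputNonempty _) (by simp [hr, symbols])
      ⟨ht, hg, hh, c₀, hs, by simp, hsol.congr fun c _ => by simp [Solves]⟩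
  | cons e S ih =>
    rw [List.forall_mem_cons] at hS hl
    refine (loop_step (means_inputNonempty _) (by simp [hr, symbols_cons])
      (t := 30 * (e.1.length + e.2.length) + 9 + (400000 * (e.1.length + e.2.length) + 4002))
      (t' := 500000 * (symbols S).length + 1)
      (.seq <| .readPair ht hr fun E' hsame hr' ha hb hl' => ?_)).le
      (by rw [length_symbols_cons]; omega)
    have hl₁ := length_inv_mk_le e.1
    have hl₂ := length_inv_mk_le e.2
    have hlen := length_symbols_cons e S
    have hsol' : Status w sol (E'.cnt .fail) (E'.cnt .seen) c₀ := by
      rwa [hsame.cnt .fail (by decide), hsame.cnt .seen (by decide)]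
    refine WP.le (.ite (means_nonempty _ _) (t := 400000 * (e.1.length + e.2.length) + 4000)
      (t' := 1) (fun h₁ => ?_) fun h₁ => .skip ?_) (by omega)
    · rw [ha, Ne, inv_toWord_eq_nil] at h₁
      have hl₃ := hl.1 h₁
      refine WP.mono (process (c₀ := c₀) (by rw [hsame.stk _ (by decide), ht]) hw hne
        (by rw [hsame.stk _ (by decide), hz]) ha hb (by rw [hsame.stk _ (by decide), hg])
        (by rw [hsame.stk _ (by decide), hh]) (by rw [hsame.stk _ (by decide), hs]) hsol')
        (by omega) ?_
      rintro E₂ ⟨hr₂, hsame₂, c₁, hc₁, hcl, hsol₂⟩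
      refine (ih (c₀ := c₁) (by rw [hsame₂.stk _ (by decide), hsame.stk _ (by decide), ht])
        (by rw [hr₂, hr']) (by rw [hsame₂.stk _ (by decide), hsame.stk _ (by decide), hz])
        (by rw [hsame₂.stk _ (by decide), hsame.stk _ (by decide), hg])
        (by rw [hsame₂.stk _ (by decide), hsame.stk _ (by decide), hh]) hc₁ hsol₂ hS.2 hl.2).mono
        le_rfl ?_
      rintro E₃ ⟨k₁, k₂, k₃, c₂, k₄, k₅, k₆⟩
      refine ⟨k₁, k₂, k₃, c₂, k₄, by omega, k₆.congr fun c _ => ?_⟩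
      rw [Solves, Solves, List.forall_mem_cons, and_assoc]
      refine and_congr_right fun _ => and_congr_left fun _ => ?_
      exact conj_eq_iff
    · rw [not_not, ha, inv_toWord_eq_nil] at h₁
      refine (ih (c₀ := c₀) (by rw [hsame.stk _ (by decide), ht])
        hr' (by rw [hsame.stk _ (by decide), hz])
        (by rw [hsame.stk _ (by decide), hg])
        (by rw [hsame.stk _ (by decide), hh]) (by rw [hsame.stk _ (by decide), hs]) hsol' hS.2
        hl.2).mono le_rfl ?_
      rintro E₃ ⟨k₁, k₂, k₃, c₂, k₄, k₅, k₆⟩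
      refine ⟨k₁, k₂, k₃, c₂, k₄, by omega, k₆.congr fun c _ => ?_⟩
      rw [Solves, Solves, List.forall_mem_cons]
      exact and_congr_right fun _ => (and_iff_right (by rw [h₁, hS.1.1 h₁]; group)).symm

end WP

/-! ### The algorithm -/

/-- Leave words on `g`, `s` and `h` such that `g * s * h⁻¹` solves the system, or report failure. -/
def findSolution : Prog κ :=
  .seq selectPair (.ite Counter.fail.nonzero .skip (.ite Stack.u.nonempty
    (.seq normalize (.ite Counter.fail.nonzero .skip (.seq rewind processAll))) .skip))

def assemble : Prog κ :=
  .seq (clear .c) (.seq (divLeft .c .h) (.seq (mulLeft .c .s) (mulLeft .c .g)))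

/-- Fill the table of inverse letters and load the first input symbol. -/
def prepare : ℕ → Prog κ
  | 0 => .load 4 0 1
  | k + 1 => .seq (.const 2 (2 * k + 1)) (.seq (.const 3 (2 * k + 2)) (.seq (.store 1 2 3)
      (.seq (.store 1 3 2) (prepare k))))

def writeVerdict : Prog κ :=
  .seq (.const 2 1) (.seq (.ite Counter.fail.nonzero (.const 2 0) .skip)
    (.seq (.store 0 5 2) (.const 0 1)))

def writeWord : Prog κ :=
  .seq (.const 0 0) (.loop Stack.c.nonempty
    (.seq (loadTop 2 .c) (.seq (.store 0 0 2) (.seq (.succ 0) (pop .c)))))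

/-- Decide the simultaneous conjugacy problem. -/
def decideSystem (r : ℕ) : Prog κ := .seq (prepare r) (.seq findSolution writeVerdict)

/-- Solve the simultaneous conjugacy search problem. -/
def solveSystem (r : ℕ) : Prog κ :=
  .seq (prepare r) (.seq findSolution (.seq assemble writeWord))

/-- The abstract initial state. -/
def Env.initial (S : List (Word r × Word r)) : Env r :=
  ⟨symbols S, symbols S, fun _ => [], fun _ => 0⟩

/-- The result of `findSolution`. -/
def Found (S : List (Word r × Word r)) (E : Env r) : Prop :=
  (E.cnt .fail ≠ 0 ∧ ¬ ∃ x, Solves S x) ∨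
  (E.cnt .fail = 0 ∧ E.stk .tmp = [] ∧ ∃ g s h : FreeGroup (Fin r), E.stk .g = g.toWord ∧
    E.stk .s = s.toWord ∧ E.stk .h = h.toWord ∧
    g.toWord.length + s.toWord.length + h.toWord.length ≤ 500 * (symbols S).length ∧
    Solves S (g * s * h⁻¹))

theorem length_le_symbols {e : Word r × Word r} {S : List (Word r × Word r)} (he : e ∈ S) :
    e.1.length + e.2.length ≤ (symbols S).length := by
  induction S with
  | nil => simp at he
  | cons e' S ih =>
    rw [length_symbols_cons]
    rcases List.mem_cons.1 he with rfl | he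
    · omega
    · have := ih he; omega

theorem Solves.inv {S : List (Word r × Word r)} {x : FreeGroup (Fin r)} (h : Solves S x)
    {e : Word r × Word r} (he : e ∈ S) :
    x⁻¹ * (FreeGroup.mk e.1)⁻¹ * x = (FreeGroup.mk e.2)⁻¹ := by
  rw [← h e he]; group

/-- A solution `x` of the system solves the chosen equation, so `g⁻¹ x h` lies in the centralizer of
`w`; failure within the centralizer is therefore failure altogether. If no candidate was ever
forced, `c = 1` serves. -/
theorem Status.found {S : List (Word r × Word r)} {E : Env r} {w : Word r}
    {a b g h c : FreeGroup (Fin r)}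
    (hS : Status w (fun c => True ∧ Solves S (g * c * h⁻¹)) (E.cnt .fail) (E.cnt .seen) c)
    (ht : E.stk .tmp = []) (hg : E.stk .g = g.toWord) (hs : E.stk .s = c.toWord)
    (hh : E.stk .h = h.toWord)
    (hl : g.toWord.length + c.toWord.length + h.toWord.length ≤ 500 * (symbols S).length)
    (ha : g⁻¹ * a * g = FreeGroup.mk w) (hb : h⁻¹ * b * h = FreeGroup.mk w)
    (hx : ∀ x, Solves S x → x⁻¹ * a * x = b) : Found S E := by
  by_cases hf : E.cnt .fail = 0
  · refine Or.inr ⟨hf, ht, g, c, h, hg, hs, hh, hl, ?_⟩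
    by_cases hn : E.cnt .seen = 0
    · obtain ⟨rfl, h⟩ := hS.unseen hf hn
      exact (h 1 (Commute.one_left _)).2
    · obtain ⟨hc, h⟩ := hS.seen hf hn
      exact ((h c hc).2 rfl).2
  · refine Or.inl ⟨hf, fun ⟨x, hsol⟩ => hS.failed hf (g⁻¹ * x * h) ?_ ⟨trivial, ?_⟩⟩
    · have h₁ : g⁻¹ * x * h * (h⁻¹ * b * h) = g⁻¹ * a * g * (g⁻¹ * x * h) := by
        rw [← hx x hsol]; group
      rwa [ha, hb] at h₁
    · rwa [show g * (g⁻¹ * x * h) * h⁻¹ = x by group]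

theorem WP.findSolution (S : List (Word r × Word r)) :
    WP O findSolution (Env.initial S) (600000 * (symbols S).length + 2000) (Found S) := by
  refine WP.le (.seq (t' := 550000 * (symbols S).length + 1500) <|
    (selectPair (D := []) rfl rfl (Or.inr ⟨rfl, by simp, Or.inl ⟨rfl, by simp⟩⟩)).mono le_rfl ?_)
    (by omega)
  rintro E₁ ⟨hs₁, hsel⟩
  rw [List.nil_append] at hsel
  refine WP.le (.ite (means_nonzero _ _) (t := 1) (t' := 540000 * (symbols S).length + 1400)
    (fun h => .skip (Or.inl ⟨h, ?_⟩)) fun h => ?_) (by omega)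
  · rcases hsel with ⟨-, e, he, hne⟩ | ⟨h', -⟩
    · rintro ⟨x, hx⟩
      apply hne
      rw [← hx e he]
      constructor
      · intro h; rw [h]; group
      · intro h
        rw [mul_eq_one_iff_eq_inv, inv_mul_eq_iff_eq_mul] at h
        simpa using h
    · exact absurd h' h
  have ht₁ : E₁.stk .tmp = [] := by rw [hs₁.stk _ (by decide)]; rfl
  rcases hsel with ⟨h', -⟩ | ⟨hf, hiff, hsel⟩
  · exact absurd h' h
  refine WP.le (.ite (means_nonempty _ _) (t := 530000 * (symbols S).length + 1300) (t' := 1)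
    (fun hu => ?_) fun hu => .skip ?_) (by omega)
  · rcases hsel with ⟨h', -⟩ | ⟨e, he, hne, hu, hv, hbest, hmin⟩
    · exact absurd h' hu
    have hl₁ := length_inv_mk_le e.1
    have hl₂ := length_inv_mk_le e.2
    have hle := length_le_symbols he
    refine WP.le (.seq (t' := 500000 * (symbols S).length + 100) <|
      (normalize ht₁ hu hv (by rwa [Ne, inv_eq_one])
        (by rw [Ne, inv_eq_one, ← hiff e he]; exact hne) hf).mono le_rfl ?_) (by omega)
    rintro E₂ ⟨hs₂, hres⟩
    refine WP.le (.ite (means_nonzero _ _) (t := 1) (t' := 500000 * (symbols S).length + 10)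
      (fun h => .skip ?_) fun h => ?_) (by omega)
    · rcases hres with ⟨-, h'⟩ | ⟨h', -⟩
      · exact Or.inl ⟨h, fun ⟨x, hx⟩ => h' ⟨x, hx.inv he⟩⟩
      · exact absurd h' h
    · rcases hres with ⟨h', -⟩ | ⟨hf₂, G, H, w, hw, hwne, hz, hg, hh, hG, hH, k₁, k₂, k₃⟩
      · exact absurd (by rw [h']; exact one_ne_zero) h
      refine WP.le (.seq (t := 2) (t' := 500000 * (symbols S).length + 1) <| .rewind <| (processAll
        (E := E₂.setRem E₂.inp) (S := S) (w := w) (c₀ := 1) (G := G) (H := H)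
        (sol := fun _ => True) ?_ ?_ hw hwne hz hg hh ?_ ?_ hiff fun e' he' hne' => ?_).mono
          le_rfl ?_) (by omega)
      · rw [Env.setRem_stk, hs₂.stk _ (by decide), ht₁]
      · rw [Env.setRem_rem, hs₂.inp, hs₁.inp]; rfl
      · rw [Env.setRem_stk, hs₂.stk _ (by decide), hs₁.stk _ (by decide)]; simp [Env.initial]
      · rw [Env.setRem_cnt, hf₂, hs₂.cnt .seen (by decide), hs₁.cnt .seen (by decide)]
        exact ⟨fun h => absurd rfl h, fun _ _ => ⟨rfl, fun _ _ => trivial⟩,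
          fun _ h => absurd rfl h⟩
      · have := hmin e' he' hne'
        omega
      · rintro E₃ ⟨ht₃, hg₃, hh₃, c, hc, hcl, hst⟩
        simp only [FreeGroup.toWord_one, List.length_nil] at hcl
        exact hst.found ht₃ hg₃ hc hh₃ (by omega) hG hH fun x hx => hx.inv he
  · rw [not_not] at hu
    rcases hsel with ⟨-, hall⟩ | ⟨e, -, hne, hu', -⟩
    -- All words are trivial, and the stacks `g`, `s`, `h`, still empty, represent the solution `1`.
    · refine Or.inr ⟨hf, ht₁, 1, 1, 1, ?_, ?_, ?_, by simp, fun e he => ?_⟩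
      · rw [hs₁.stk _ (by decide)]; simp [Env.initial]
      · rw [hs₁.stk _ (by decide)]; simp [Env.initial]
      · rw [hs₁.stk _ (by decide)]; simp [Env.initial]
      · rw [hall e he, (hiff e he).1 (hall e he)]; group
    · exact absurd (inv_toWord_eq_nil.1 (hu'.symm.trans hu)) hne

theorem WP.assemble {E : Env r} {Q : Env r → Prop} {g s h : FreeGroup (Fin r)}
    (ht : E.stk .tmp = []) (hg : E.stk .g = g.toWord) (hs : E.stk .s = s.toWord)
    (hh : E.stk .h = h.toWord) (hQ : Q (E.setStk .c (g * s * h⁻¹).toWord)) :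
    WP O assemble E (40 * (g.toWord.length + s.toWord.length + h.toWord.length) + 20) Q := by
  refine WP.le (.seq <| .clear <| .seq <|
    .divLeft (k := h) (g := 1) (by simp [hh, FreeGroup.mk_toWord]) (by simp) (by simp [ht]) <|
    .seq <| .mulLeft (k := s) (g := h⁻¹ * 1) (by simp [hs, FreeGroup.mk_toWord]) (by simp)
      (by simp [ht]) <|
    .mulLeft (k := g) (g := s * (h⁻¹ * 1)) (by simp [hg, FreeGroup.mk_toWord]) (by simp)
      (by simp [ht]) ?_) ?_
  · convert hQ using 1
    refine Env.ext_stk rfl rfl (fun c => ?_) fun c => rfl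
    by_cases hc : c = .c
    · simp only [hc, Env.setStk_stk, if_true, mul_assoc, mul_one]
    · simp [hc]
  · simp [hg, hs, hh]; omega

/-! ### Reading the input and writing the answer -/

/-- The clause on the cells above `2 * k` carries the induction: entries written before the
recursive call survive it. -/
theorem exec_prepare (k : ℕ) (s : State) : ∃ s', Exec O (prepare k) s (4 * k + 1) s' ∧
    (∀ x, x ≠ 2 → x ≠ 3 → x ≠ 4 → s'.reg x = s.reg x) ∧ s'.reg 4 = s.arr 0 (s.reg 1) ∧
    (∀ a, a ≠ 1 → s'.arr a = s.arr a) ∧ (∀ i, 2 * k < i → s'.arr 1 i = s.arr 1 i) ∧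
    ∀ i < k, s'.arr 1 (2 * i + 1) = 2 * i + 2 ∧ s'.arr 1 (2 * i + 2) = 2 * i + 1 := by
  induction k generalizing s with
  | zero =>
    refine ⟨_, .load s 4 0 1, fun x _ _ h => by simp [h], by simp, fun _ _ => rfl,
      fun _ _ => rfl, by simp⟩
  | succ k ih =>
    let s₂ := (s.setReg 2 (2 * k + 1)).setReg 3 (2 * k + 2)
    let s₃ := s₂.setCell 1 (s₂.reg 2) (s₂.reg 3)
    let s₄ := s₃.setCell 1 (s₃.reg 3) (s₃.reg 2)
    obtain ⟨s', he, hr, h4, ha, h1, hi⟩ := ih s₄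
    have e : Exec O (prepare (k + 1)) s (1 + (1 + (1 + (1 + (4 * k + 1))))) s' :=
      .seq (.const _ _ _) (.seq (.const _ _ _) (.seq (.store _ _ _ _) (.seq (.store _ _ _ _) he)))
    refine ⟨s', ?_, fun x h h' h'' => ?_, ?_, fun a h => ?_, fun i h => ?_, fun i h => ?_⟩
    · convert e using 1; omega
    · rw [hr x h h' h'']; simp [s₄, s₃, s₂, h, h']
    · rw [h4]; simp [s₄, s₃, s₂]
    · rw [ha a h]; simp [s₄, s₃, s₂, h]
    · rw [h1 i (by omega)]
      simp [s₄, s₃, s₂, show i ≠ 2 * k + 2 by omega,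
        show i ≠ 2 * k + 1 by omega]
    · rcases Nat.lt_succ_iff_lt_or_eq.1 h with h | rfl
      · exact hi i h
      · rw [h1 _ (by omega), h1 _ (by omega)]
        simp [s₄, s₃, s₂]

theorem rep_prepare (S : List (Word r × Word r)) : ∃ s,
    Exec O (prepare r) (State.init (encodeSystem S)) (4 * r + 1) s ∧
      Rep s (Env.initial S) := by
  obtain ⟨s, he, hr, h4, ha, -, hi⟩ := exec_prepare (O := O) r (State.init (encodeSystem S))
  have hreg (x : ℕ) (h2 : x ≠ 2) (h3 : x ≠ 3) (h4 : x ≠ 4) (h0 : x ≠ 0) : s.reg x = 0 := by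
    rw [hr x h2 h3 h4]; simp [State.init, State.setList, h0]
  have h0 : s.reg 0 = (symbols S).length := by
    rw [hr 0 (by decide) (by decide) (by decide)]
    simp [State.init, State.setList, encodeSystem_eq]
  have harr (i : ℕ) : s.arr 0 i = ((symbols S).map encodeSymbol).getD i 0 := by
    rw [ha 0 (by decide)]
    simp [State.init, State.setList, encodeSystem_eq]
  have h1 : s.reg 1 = 0 := hreg 1 (by decide) (by decide) (by decide) (by decide)
  refine ⟨s, he, hreg 5 (by decide) (by decide) (by decide) (by decide), h0, by simp [h1],
    by simp [h1, Env.initial], harr, ?_, fun l => ?_, fun a => ?_, fun a => trivial, fun c => ?_⟩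
  · rw [h4, ← ha 0 (by decide), harr]
    simp [State.init, State.setList, Env.initial]
  · obtain ⟨i, b⟩ := l
    obtain ⟨h₁, h₂⟩ := hi i i.2
    cases b
    · simpa [encodeLetter, Letter.inv] using h₁
    · simpa [encodeLetter, Letter.inv] using h₂
  · have := a.le_reg
    exact hreg _ (by omega) (by omega) (by omega) (by omega)
  · have := c.le_reg
    exact hreg _ (by omega) (by omega) (by omega) (by omega)

theorem exec_writeVerdict {s : State} {E : Env r} (hs : Rep s E) : ∃ t s', t ≤ 5 ∧
    Exec O writeVerdict s t s' ∧ s'.list 0 = [if E.cnt .fail = 0 then 1 else 0] := by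
  have h₅ := hs.zero
  have hf := (means_nonzero .fail E) _ (hs.setScratch (Or.inl rfl) 1)
  by_cases h : E.cnt .fail = 0
  · refine ⟨_, _, ?_, .seq (.const _ _ _) (.seq (.ite_false (by simpa [hf] using h) (.skip _))
      (.seq (.store _ _ _ _) (.const _ _ _))), ?_⟩
    · omega
    · simp [State.list, h, h₅]
  · refine ⟨_, _, ?_, .seq (.const _ _ _) (.seq (.ite_true (by simpa [hf] using h) (.const _ _ _))
      (.seq (.store _ _ _ _) (.const _ _ _))), ?_⟩
    · omega
    · simp [State.list, h, h₅]

/-- The top of the stack is the first letter, so popping writes the word in reading order; it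
overwrites the input, which is no longer needed. -/
theorem exec_writeWord_loop (l : Word r) (s : State) (h₅ : s.reg 5 = 0)
    (hl : s.reg Stack.c.reg = l.length) (hh : Holds (s.arr Stack.c.reg) l) : ∃ t s',
    t ≤ 7 * l.length + 1 ∧ Exec O (.loop Stack.c.nonempty
      (.seq (loadTop 2 .c) (.seq (.store 0 0 2) (.seq (.succ 0) (pop .c))))) s t s' ∧
    s'.list 0 = s.list 0 ++ encodeWord l := by
  induction l generalizing s with
  | nil =>
    refine ⟨1, s, by simp, .loop_false ?_, by simp [encodeWord]⟩
    simp [Stack.nonempty, Test.holds, h₅, hl]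
  | cons x l ih =>
    simp only [Stack.reg, List.length_cons] at hl hh ih
    let s₁ := ((s.setReg 2 (s.reg 42)).setReg 2 (l.length)).setReg 2 (encodeLetter x)
    let s₂ := s₁.setCell 0 (s₁.reg 0) (s₁.reg 2)
    let s₃ := s₂.setReg 0 (s₂.reg 0 + 1)
    let s₄ := s₃.setReg 42 (s₃.reg 42 - 1)
    have e₁ : Exec O (loadTop 2 .c) s (1 + (1 + 1)) s₁ := by
      refine .seq (.copy _ _ _) (.seq (.pred _ _) ?_)
      convert Exec.load _ _ _ _ using 1
      simp [s₁, hl, Stack.reg, hh.1]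
    obtain ⟨t, s', ht, e, h⟩ := ih s₄ (by simp [s₄, s₃, s₂, s₁, h₅])
      (by simp [s₄, s₃, s₂, s₁, hl]) (by simpa [s₄, s₃, s₂, s₁] using hh.2)
    refine ⟨_, s', ?_, .loop_true ?_ (.seq e₁ (.seq (.store _ _ _ _)
      (.seq (.succ _ _) (.pred _ _)))) e, ?_⟩
    · simp; omega
    · simp [Stack.nonempty, Test.holds, h₅, hl, Stack.reg]
    · rw [h]
      simp [s₄, s₃, s₂, s₁, State.list, encodeWord, List.range_succ, Function.update_apply]
      omega

theorem exec_writeWord {s : State} {E : Env r} (hs : Rep s E) : ∃ t s',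
    t ≤ 7 * (E.stk .c).length + 2 ∧ Exec O writeWord s t s' ∧
      s'.list 0 = encodeWord (E.stk .c) := by
  obtain ⟨t, s', ht, e, h⟩ := exec_writeWord_loop (O := O) (E.stk .c) (s.setReg 0 0)
    (by simp [hs.zero]) (by rw [← hs.stkLen]; rfl) (hs.stk .c)
  exact ⟨_, s', by omega, .seq (.const _ _ _) e, by simpa [State.list] using h⟩

theorem exists_solvesSystem_iff {S : List (Word r × Word r)} :
    (∃ x, SolvesSystem S x) ↔ ∃ x, Solves S x :=
  ⟨fun ⟨x, hx⟩ => ⟨.mk x, hx⟩, fun ⟨x, hx⟩ => ⟨x.toWord, fun e he => by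
    rw [Conjugates, FreeGroup.mk_toWord]; exact hx e he⟩⟩

theorem decideSystem_solvesInTime (r : ℕ) (O : κ → List ℕ → List ℕ) :
    SolvesInTime O (decideSystem r) (SCP r) (600000 + (4 * r + 3000)) := by
  intro (S : List (Word r × Word r)) _
  obtain ⟨s₁, e₁, r₁⟩ := rep_prepare (O := O) S
  obtain ⟨t₂, s₂, E₂, ht₂, e₂, r₂, h₂⟩ := WP.findSolution S s₁ r₁
  obtain ⟨t₃, s₃, ht₃, e₃, h₃⟩ := exec_writeVerdict (O := O) r₂
  have hn : (encodeSystem S).length = (symbols S).length := by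
    rw [encodeSystem_eq, List.length_map]
  refine ⟨_, s₃, .seq e₁ (.seq e₂ e₃), ?_, ?_⟩
  · suffices _ ≤ _ * ((encodeSystem S).length + 1) from this
    rw [hn]
    nlinarith
  · suffices Decides (∃ x, SolvesSystem S x) (s₃.list 0) from this
    rw [exists_solvesSystem_iff, h₃]
    rcases h₂ with ⟨hf, h⟩ | ⟨hf, -, g, s, h, -, -, -, -, hsol⟩
    · exact Or.inr ⟨h, by rw [if_neg hf]⟩
    · exact Or.inl ⟨⟨_, hsol⟩, by rw [if_pos hf]⟩

/-- By `Found`, the three factors of the solution have at most `500` letters per input symbol in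
all, so assembling and writing it keeps the time linear. -/
theorem solveSystem_solvesInTime (r : ℕ) (O : κ → List ℕ → List ℕ) :
    SolvesInTime O (solveSystem r) (SCSP r) (700000 + (4 * r + 3000)) := by
  intro (S : List (Word r × Word r)) hS
  obtain ⟨s₁, e₁, r₁⟩ := rep_prepare (O := O) S
  obtain ⟨t₂, s₂, E₂, ht₂, e₂, r₂, h₂⟩ := WP.findSolution S s₁ r₁
  rcases h₂ with ⟨-, h⟩ | ⟨hf, ht, g, s, h, hg, hs, hh, hl, hsol⟩
  · exact absurd (exists_solvesSystem_iff.1 hS) h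
  obtain ⟨t₃, s₃, E₃, ht₃, e₃, r₃, rfl⟩ := WP.assemble (O := O) (Q := fun E => E = _) ht hg hs hh
    rfl s₂ r₂
  obtain ⟨t₄, s₄, ht₄, e₄, h₄⟩ := exec_writeWord (O := O) r₃
  simp only [Env.setStk_stk, if_true] at ht₄ h₄
  have hn : (encodeSystem S).length = (symbols S).length := by
    rw [encodeSystem_eq, List.length_map]
  have hl₁ := length_toWord_mul_le (g * s) h⁻¹
  have hl₂ := length_toWord_mul_le g s
  rw [length_toWord_inv] at hl₁
  refine ⟨_, s₄, .seq e₁ (.seq e₂ (.seq e₃ e₄)), ?_, (g * s * h⁻¹).toWord, h₄, fun e he => ?_⟩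
  · suffices _ ≤ _ * ((encodeSystem S).length + 1) from this
    rw [hn]
    nlinarith
  · rw [Conjugates, FreeGroup.mk_toWord]
    exact hsol e he

end FreeConj

/-! ### The theorem -/

theorem mainTheorem10 (r : ℕ) :
    (RAM.LinearTimeReducible (FreeConj.SCP r)
        (![FreeConj.CP r, FreeConj.CSP r, FreeConj.RSP r] : Fin 3 → RAM.Problem) ∧
      RAM.LinearTimeReducible (FreeConj.SCSP r)
        (![FreeConj.CP r, FreeConj.CSP r, FreeConj.RSP r] : Fin 3 → RAM.Problem)) ∧
    (RAM.LinearTimeSolvable (FreeConj.SCP r) ∧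
      RAM.LinearTimeSolvable (FreeConj.SCSP r)) :=
  ⟨⟨⟨_, _, fun O _ => FreeConj.decideSystem_solvesInTime r O⟩,
    ⟨_, _, fun O _ => FreeConj.solveSystem_solvesInTime r O⟩⟩,
    ⟨_, _, FreeConj.decideSystem_solvesInTime r _⟩,
    ⟨_, _, FreeConj.solveSystem_solvesInTime r _⟩⟩
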